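/- Let $k$ be an algebraically closed field of characteristic zero and let $g\ge 2$. Let $K_0(\mathrm{Var}/k)$ be the Grothendieck ring of varieties, i.e. the free abelian group on isomorphism classes of varieties (separated schemes of finite type) over $k$ modulo the relations $[X]=[Y]+[X\setminus Y]$ for $Y\subset X$ closed, with product induced by the product of varieties over $k$, and put $\mathbb{L}=[\mathbb{A}^1]$. Let $Q_1=\{q_1=0\}$ and $Q_2=\{q_2=0\}$ be quadrics in $\mathbb{P}^{2g+1}$ whose scheme-theoretic intersection $Q_1\cap Q_2$ is smooth of dimension $2g-1$. Let $C$ be the associated hyperelliptic curve, i.e. the double cover of the pencil $\mathbb{P}^1$ branched over the $2g+2$ points corresponding to singular quadrics; explicitly, $C$ is the curve $y^2=\det(sG_1+tG_2)$ in the weighted projective plane $\mathbb{P}(1,1,g+1)$ with coordinates $s,t,y$, where $G_1,G_2$ are the symmetric Gram matrices of $q_1,q_2$. Then \[ \mathbb{L}\,[Q_1\cap Q_2]=\mathbb{L}\left([\mathbb{P}^{2g-1}]-\mathbb{L}^{g-1}[\mathbb{P}^1]+\mathbb{L}^{g-1}[C]\right) \] in $K_0(\mathrm{Var}/k)$. 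-/

import Mathlib

namespace QuadricPencil

open CategoryTheory AlgebraicGeometry MonoidalCategory

universe u

noncomputable section

/-! ### The Grothendieck ring of varieties -/

section GrothendieckRing

variable (k : Type u) [Field k]

/-- A `k`-variety is a separated scheme of finite type over `k`. (Allowing nilpotents does not
change the Grothendieck ring: `X` and `X_red` are identified by the scissor relation for the
closed subscheme `X_red` of `X`, whose complement is empty.) -/
def isVariety : ObjectProperty (Over (Spec (CommRingCat.of k))) := fun X =>
  IsSeparated X.hom ∧ LocallyOfFiniteType X.hom ∧ QuasiCompact X.hom

variable {k} in
lemma isVariety_mk {X : Scheme.{u}} (f : X ⟶ Spec (CommRingCat.of k))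
    (h₁ : IsSeparated f) (h₂ : LocallyOfFiniteType f) (h₃ : QuasiCompact f) :
    isVariety k (Over.mk f) := ⟨h₁, h₂, h₃⟩

instance : (isVariety k).IsMonoidal where
  prop_unit := isVariety_mk (𝟙 _) inferInstance inferInstance inferInstance
  prop_tensor X Y hX hY := by
    obtain ⟨_, _, _⟩ := hX
    obtain ⟨_, _, _⟩ := hY
    exact isVariety_mk (Limits.pullback.fst X.hom Y.hom ≫ X.hom)
      inferInstance inferInstance inferInstance

/-- The category of `k`-varieties; its monoidal structure is the product over `k`. -/
abbrev Var : Type (u + 1) := (isVariety k).FullSubcategory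

/-- The commutative monoid of isomorphism classes of `k`-varieties under the product over `k`. -/
abbrev IsoClass : Type (u + 1) := Skeleton (Var k)

variable {k} in
/-- The isomorphism class of `X` as a generator of the free abelian group. -/
def gen (X : Var k) : FreeAbelianGroup (IsoClass k) := FreeAbelianGroup.of (toSkeleton X)

/-- The elements `[X] - [Y] - [X ∖ Y]`, for `Y` a closed subscheme of a variety `X`. -/
def scissorRelations : Set (FreeAbelianGroup (IsoClass k)) :=
  {r | ∃ (X Y U : Var k) (i : Y ⟶ X) (j : U ⟶ X),
    IsClosedImmersion i.hom.left ∧ IsOpenImmersion j.hom.left ∧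
    Set.range j.hom.left = (Set.range i.hom.left)ᶜ ∧ r = gen X - gen Y - gen U}

/-- The Grothendieck ring of varieties. The ring structure on the free abelian group on
isomorphism classes is the one induced by the product of varieties. The subgroup generated by the
scissor relations is an ideal, since multiplying the relation for `Y` in `X` with `[Z]` gives
the relation for `Y × Z` in `X × Z`. -/
abbrev K0 : Type (u + 1) := FreeAbelianGroup (IsoClass k) ⧸ Ideal.span (scissorRelations k)

variable {k} in
/-- The class `[X]` of a variety in the Grothendieck ring. -/
def cls (X : Var k) : K0 k := Ideal.Quotient.mk _ (gen X)

/-- The affine line over `k`. -/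
def affineLine : Var k :=
  ⟨Over.mk (Spec.map (CommRingCat.ofHom (algebraMap k (Polynomial k)))),
    isVariety_mk _ inferInstance
      ((HasRingHomProperty.Spec_iff (P := @LocallyOfFiniteType)).mpr
        (RingHom.finiteType_algebraMap.mpr inferInstance))
      inferInstance⟩

/-- The Lefschetz class `[𝔸¹]`. -/
def lefschetz : K0 k := cls (affineLine k)

end GrothendieckRing

/-! ### Projective varieties as `Proj` -/

section ProjVariety

variable {k : Type u} [Field k] {A : Type u} [CommRing A] [Algebra k A]
  (𝒜 : ℕ → Submodule k A) [GradedAlgebra 𝒜]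

/-- The structure morphism `Proj A ⟶ Spec A₀ ⟶ Spec k` of a graded `k`-algebra. -/
def projHom : Proj 𝒜 ⟶ Spec (CommRingCat.of k) :=
  Proj.toSpecZero 𝒜 ≫ Spec.map (CommRingCat.ofHom (algebraMap k (𝒜 0)))

/-- `Proj A` as a `k`-variety, for a finitely generated graded `k`-algebra with `A₀ = k`
(or `A₀ = 0`). -/
def projVariety (h0 : Function.Surjective (algebraMap k (𝒜 0))) [Algebra.FiniteType k A] :
    Var k :=
  ⟨Over.mk (projHom 𝒜), by
    have : IsScalarTower k (𝒜 0) A := ⟨fun a b c => smul_mul_assoc a (b : A) c⟩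
    have : Algebra.FiniteType (𝒜 0) A := Algebra.FiniteType.of_restrictScalars_finiteType k _ _
    have : IsClosedImmersion (Spec.map (CommRingCat.ofHom (algebraMap k (𝒜 0)))) :=
      IsClosedImmersion.spec_of_surjective _ h0
    exact isVariety_mk (Proj.toSpecZero 𝒜 ≫ Spec.map (CommRingCat.ofHom (algebraMap k (𝒜 0))))
      inferInstance inferInstance inferInstance⟩

/-- The degree `i` part of the quotient of a graded algebra `A` by a homogeneous ideal `I`:
the image of the degree `i` part of `A`. -/
def quotGrading (I : HomogeneousIdeal 𝒜) (i : ℕ) : Submodule k (A ⧸ I.toIdeal) :=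
  (𝒜 i).map (Ideal.Quotient.mkₐ k I.toIdeal).toLinearMap

/-- The projection from `A`, split into its graded pieces, to the direct sum of the graded
pieces of the quotient. -/
def quotDecomposeAux (I : HomogeneousIdeal 𝒜) : A →ₗ[k] DirectSum ℕ fun i => quotGrading 𝒜 I i :=
  (DirectSum.lmap fun i => (Ideal.Quotient.mkₐ k I.toIdeal).toLinearMap.submoduleMap (𝒜 i)) ∘ₗ
    (DirectSum.decomposeLinearEquiv 𝒜).toLinearMap

lemma quotDecomposeAux_apply (I : HomogeneousIdeal 𝒜) (a : A) (i : ℕ) :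
    ((quotDecomposeAux 𝒜 I a i : quotGrading 𝒜 I i) : A ⧸ I.toIdeal) =
      Ideal.Quotient.mk I.toIdeal (DirectSum.decompose 𝒜 a i : A) := by
  simp [quotDecomposeAux]
  rfl

lemma quotDecomposeAux_of_mem (I : HomogeneousIdeal 𝒜) (a : A) (ha : a ∈ I.toIdeal) :
    quotDecomposeAux 𝒜 I a = 0 := by
  refine DFinsupp.ext fun i => Subtype.ext ?_
  have := quotDecomposeAux_apply 𝒜 I a i
  refine this.trans ?_
  exact Ideal.Quotient.eq_zero_iff_mem.mpr (I.isHomogeneous i ha)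

/-- The decomposition of the quotient into graded pieces. -/
def quotDecompose (I : HomogeneousIdeal 𝒜) :
    (A ⧸ I.toIdeal) →+ DirectSum ℕ fun i => quotGrading 𝒜 I i :=
  QuotientAddGroup.lift _ (quotDecomposeAux 𝒜 I).toAddMonoidHom
    fun a ha => quotDecomposeAux_of_mem 𝒜 I a ha

lemma quotDecompose_mk (I : HomogeneousIdeal 𝒜) (a : A) :
    quotDecompose 𝒜 I (Ideal.Quotient.mk I.toIdeal a) = quotDecomposeAux 𝒜 I a := rfl

lemma quotDecomposeAux_coe (I : HomogeneousIdeal 𝒜) (i : ℕ) (a : A) (ha : a ∈ 𝒜 i) :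
    quotDecomposeAux 𝒜 I a = DirectSum.of (fun i => quotGrading 𝒜 I i) i
      ⟨Ideal.Quotient.mk I.toIdeal a, a, ha, rfl⟩ := by
  refine DFinsupp.ext fun j => Subtype.ext ?_
  refine (quotDecomposeAux_apply 𝒜 I a j).trans ?_
  obtain rfl | hij := eq_or_ne i j
  · rw [DirectSum.decompose_of_mem_same 𝒜 ha, DirectSum.of_eq_same]
  · rw [DirectSum.decompose_of_mem_ne 𝒜 ha hij, DirectSum.of_eq_of_ne _ _ _ hij.symm]
    simp

instance (I : HomogeneousIdeal 𝒜) : GradedAlgebra (quotGrading 𝒜 I) where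
  one_mem := ⟨1, SetLike.GradedOne.one_mem, map_one (Ideal.Quotient.mk I.toIdeal)⟩
  mul_mem := by
    rintro i j _ _ ⟨a, ha, rfl⟩ ⟨b, hb, rfl⟩
    exact ⟨a * b, SetLike.GradedMul.mul_mem ha hb, map_mul (Ideal.Quotient.mk I.toIdeal) a b⟩
  toDecomposition := DirectSum.Decomposition.ofAddHom _ (quotDecompose 𝒜 I)
    (by
      refine AddMonoidHom.ext fun x => ?_
      obtain ⟨a, rfl⟩ := Ideal.Quotient.mk_surjective x
      simp only [AddMonoidHom.comp_apply, quotDecompose_mk, AddMonoidHom.id_apply]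
      induction a using DirectSum.Decomposition.inductionOn 𝒜 with
      | zero => simp
      | homogeneous a =>
        rw [quotDecomposeAux_coe 𝒜 I _ _ a.2, DirectSum.coeAddMonoidHom_of]
      | add a b ha hb => rw [map_add, map_add, ha, hb, map_add])
    (by
      refine DirectSum.addHom_ext fun i x => ?_
      obtain ⟨_, a, ha, rfl⟩ := x
      simp only [AddMonoidHom.comp_apply, DirectSum.coeAddMonoidHom_of, AddMonoidHom.id_apply]
      exact (quotDecompose_mk 𝒜 I a).trans (quotDecomposeAux_coe 𝒜 I i a ha))

variable {𝒜} in
lemma quotGrading_zero_surjective (I : HomogeneousIdeal 𝒜)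
    (h0 : Function.Surjective (algebraMap k (𝒜 0))) :
    Function.Surjective (algebraMap k (quotGrading 𝒜 I 0)) := by
  rintro ⟨_, a, ha, rfl⟩
  obtain ⟨c, hc⟩ := h0 ⟨a, ha⟩
  refine ⟨c, Subtype.ext ?_⟩
  have hc' : algebraMap k A c = a := congrArg Subtype.val hc
  exact congrArg (Ideal.Quotient.mk I.toIdeal) hc'

end ProjVariety

/-! ### Projective space, intersections of two quadrics, and the hyperelliptic curve -/

section Geometry

open MvPolynomial

variable (k : Type u) [Field k]

attribute [local instance] MvPolynomial.gradedAlgebra MvPolynomial.weightedGradedAlgebra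

lemma weighted_zero_surjective {σ : Type} (w : σ → ℕ) (hw : ∀ i, w i ≠ 0) :
    Function.Surjective (algebraMap k (weightedHomogeneousSubmodule k w 0)) := by
  rintro ⟨p, hp⟩
  refine ⟨coeff 0 p, Subtype.ext ?_⟩
  have h := weightedHomogeneousComponent_zero (w := w) p hw
  rw [weightedHomogeneousComponent_eq_self hp] at h
  exact h.symm

lemma homogeneous_zero_surjective (σ : Type) :
    Function.Surjective (algebraMap k (homogeneousSubmodule σ k 0)) := by
  rintro ⟨p, hp⟩
  refine ⟨coeff 0 p, Subtype.ext ?_⟩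
  have h := weightedHomogeneousComponent_zero (w := 1) p (fun _ => Nat.one_ne_zero)
  rw [weightedHomogeneousComponent_eq_self hp] at h
  exact h.symm

/-- Projective space `ℙⁿ = Proj k[x₀, …, xₙ]`. -/
def projectiveSpace (n : ℕ) : Var k :=
  projVariety (homogeneousSubmodule (Fin (n + 1)) k) (homogeneous_zero_surjective k _)

variable {k}

/-- The homogeneous ideal `(q₁, q₂)` generated by two quadratic forms. -/
def quadricIdeal {n : ℕ} (q₁ q₂ : homogeneousSubmodule (Fin (n + 1)) k 2) :
    HomogeneousIdeal (homogeneousSubmodule (Fin (n + 1)) k) :=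
  ⟨Ideal.span {(q₁ : MvPolynomial (Fin (n + 1)) k), (q₂ : MvPolynomial (Fin (n + 1)) k)},
    Ideal.homogeneous_span _ _ (by
      rintro x (rfl | rfl)
      exacts [⟨2, q₁.2⟩, ⟨2, q₂.2⟩])⟩

/-- The scheme-theoretic intersection `Q₁ ∩ Q₂ = Proj k[x₀, …, xₙ]/(q₁, q₂)` in `ℙⁿ` of the
quadrics `Q₁ = {q₁ = 0}` and `Q₂ = {q₂ = 0}`. -/
def quadricIntersection {n : ℕ} (q₁ q₂ : homogeneousSubmodule (Fin (n + 1)) k 2) : Var k :=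
  projVariety (quotGrading _ (quadricIdeal q₁ q₂))
    (quotGrading_zero_surjective _ (homogeneous_zero_surjective k _))

/-- The symmetric Gram matrix of a quadratic form `q` (for `2` invertible in `k`), with entries
`½ ∂ᵢ∂ⱼ q`, so that `q = ∑ᵢⱼ Gᵢⱼ xᵢ xⱼ`. -/
def gramMatrix {n : ℕ} (q : homogeneousSubmodule (Fin (n + 1)) k 2) :
    Matrix (Fin (n + 1)) (Fin (n + 1)) k :=
  fun i j => 2⁻¹ * coeff 0 (pderiv i (pderiv j (q : MvPolynomial (Fin (n + 1)) k)))

/-- The discriminant `det (s G₁ + t G₂)` of the pencil of quadrics `s q₁ + t q₂`, as a polynomial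
in the first two of the variables `s, t, y`. -/
def discriminant {n : ℕ} (q₁ q₂ : homogeneousSubmodule (Fin (n + 1)) k 2) :
    MvPolynomial (Fin 3) k :=
  Matrix.det (Matrix.of fun i j => X 0 * C (gramMatrix q₁ i j) + X 1 * C (gramMatrix q₂ i j))

/-- The weights `1, 1, g + 1` of the variables `s, t, y`. -/
def curveWeights (g : ℕ) : Fin 3 → ℕ := ![1, 1, g + 1]

/-- The equation `y² - det (s G₁ + t G₂)` of the hyperelliptic curve. -/
def curveEquation {n : ℕ} (q₁ q₂ : homogeneousSubmodule (Fin (n + 1)) k 2) :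
    MvPolynomial (Fin 3) k :=
  X 2 ^ 2 - discriminant q₁ q₂

lemma discriminant_homogeneous {n : ℕ} (g : ℕ)
    (q₁ q₂ : homogeneousSubmodule (Fin (n + 1)) k 2) :
    IsWeightedHomogeneous (curveWeights g) (discriminant q₁ q₂) (n + 1) := by
  have entry : ∀ i j, IsWeightedHomogeneous (curveWeights g)
      ((X 0 * C (gramMatrix q₁ i j) + X 1 * C (gramMatrix q₂ i j)) : MvPolynomial (Fin 3) k)
      1 := by
    intro i j
    exact ((isWeightedHomogeneous_X k (curveWeights g) 0).mul
      (isWeightedHomogeneous_C (curveWeights g) _)).add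
      ((isWeightedHomogeneous_X k (curveWeights g) 1).mul
      (isWeightedHomogeneous_C (curveWeights g) _))
  rw [discriminant, Matrix.det_apply]
  refine IsWeightedHomogeneous.sum _ _ _ fun σ _ => ?_
  have hp := IsWeightedHomogeneous.prod Finset.univ
    (fun i => (Matrix.of fun i j => (X 0 * C (gramMatrix q₁ i j) + X 1 * C (gramMatrix q₂ i j) :
      MvPolynomial (Fin 3) k)) (σ i) i) (fun _ => 1) (w := curveWeights g) fun i _ => by
      rw [Matrix.of_apply]; exact entry (σ i) i
  simp only [Finset.sum_const, Finset.card_univ, Fintype.card_fin, smul_eq_mul, mul_one] at hp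
  rcases Int.units_eq_one_or (Equiv.Perm.sign σ) with h | h
  · rw [h, one_smul]; exact hp
  · rw [h, Units.neg_smul, one_smul]; exact hp.neg

lemma curveEquation_homogeneous (g : ℕ)
    (q₁ q₂ : homogeneousSubmodule (Fin (2 * g + 1 + 1)) k 2) :
    IsWeightedHomogeneous (curveWeights g) (curveEquation q₁ q₂) (2 * g + 1 + 1) := by
  refine IsWeightedHomogeneous.sub ?_ (discriminant_homogeneous g q₁ q₂)
  have h := (isWeightedHomogeneous_X k (curveWeights g) 2).pow 2
  have e : 2 • curveWeights g 2 = 2 * g + 1 + 1 := by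
    simp [curveWeights]; ring
  rwa [e] at h

/-- The homogeneous ideal of the hyperelliptic curve in the weighted projective plane. -/
def curveIdeal {g : ℕ} (q₁ q₂ : homogeneousSubmodule (Fin (2 * g + 1 + 1)) k 2) :
    HomogeneousIdeal (weightedHomogeneousSubmodule k (curveWeights g)) :=
  ⟨Ideal.span {curveEquation q₁ q₂}, Ideal.homogeneous_span _ _ (by
      rintro x rfl
      exact ⟨_, curveEquation_homogeneous g q₁ q₂⟩)⟩

/-- The hyperelliptic curve associated with `Q₁ ∩ Q₂ ⊂ ℙ^{2g+1}`: the double cover of the line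
`ℙ¹` with coordinates `s, t` branched over the singular members of the pencil `s q₁ + t q₂`,
i.e. the curve `y² = det (s G₁ + t G₂)` in the weighted projective plane `ℙ(1, 1, g + 1)`. -/
def hyperellipticCurve {g : ℕ} (q₁ q₂ : homogeneousSubmodule (Fin (2 * g + 1 + 1)) k 2) :
    Var k :=
  projVariety (quotGrading _ (curveIdeal q₁ q₂))
    (quotGrading_zero_surjective _ (weighted_zero_surjective k (curveWeights g) (by
      intro i; fin_cases i <;> simp [curveWeights])))

end Geometry

end

end QuadricPencil

/-! The class of the incidence variety `E = {(x, p) : p₀ q₁(x) + p₁ q₂(x) = 0}` in `ℙ^{2g+1} × ℙ¹`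
is computed in two ways. Write `X = Q₁ ∩ Q₂`.

Over `X` the projection to `ℙ^{2g+1}` has fibre `ℙ¹`, and elsewhere the fibre is the single point
`[-q₂(x) : q₁(x)]`. Hence `[E] = [ℙ^{2g+1}] + 𝕃[X]` (`mu_incidence`). This is where the factor `𝕃`
in front of `[X]` comes from.

Over `ℙ¹`, `E` is a quadric fibration. All its members contain a common linear subspace `ℙ(Λ)` with
`dim Λ = g` (`IsSmoothPencil.exists_isotropic`). In coordinates `(w, z)` with `z` along `Λ`, the
member at `p` is `2 (Bₚᵀ w) · z + wᵀ Aₚ w`, which is affine linear in `z`. Projecting from `Λ`, the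
fibre over `w ≠ 0` is an affine space of dimension `g - 1` when `Bₚᵀ w ≠ 0`; otherwise it is
everything or nothing, according to whether `wᵀ Aₚ w` vanishes (`mu_quadric_blocks`). Smoothness
makes `Bₚ` injective, so `ker Bₚᵀ` is a plane. The form `Aₚ` restricts to a nonzero binary form on
it, whose discriminant is `det (p₀ G₁ + p₁ G₂)` up to a nonzero square. Its zeros in the
projectivized plane therefore correspond to the points of `C` over `p` (`mu_isotropic_kernel`).
Altogether `[E] = [ℙ^{g-1}][ℙ¹] + 𝕃^{g-1}([ℙ^{g+1}][ℙ¹] - [ℙ¹]²) + 𝕃^g [C]`, and comparing the two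
values is a computation with geometric sums.

To find `Λ`, change the generators of the pencil so that `G₁` is invertible, and let `M = G₁⁻¹ G₂`.
Smoothness says that `M` has no `G₁`-isotropic eigenvector, so `M` has a `G₁`-orthogonal eigenbasis.
Then `vᵀ G₁ Mⁱ v = 0` for `i < 2g` is a system of linear equations in the squares of the coordinates
of `v`, and the span of `v, Mv, …, M^{g-1}v` is isotropic for both forms.

None of these fibrations is treated scheme-theoretically. Every constructible set of `k`-points in a
finite-dimensional vector space has a class `mu`, which is additive and invariant under bijections
that are piecewise rational in both directions (`mu_eq_of_bij`). The class of a `Proj` is `mu` of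
the vectors of its cone whose first nonzero coordinate is `1` (`cls_projVariety_eq_mu`). Smoothness
enters only through the Jacobian criterion (`mulVec_ne_zero_of_smooth`). -/

open CategoryTheory AlgebraicGeometry MonoidalCategory TensorProduct

universe u

noncomputable section

namespace QuadricPencil

/-! ### Scissor relations in the Grothendieck ring -/

section Scissor

variable {k : Type u} [Field k]

/-- A morphism that makes its source a `k`-variety. -/
class IsVar {X : Scheme.{u}} (f : X ⟶ Spec (CommRingCat.of k)) : Prop where
  isSeparated : IsSeparated f
  locallyOfFiniteType : LocallyOfFiniteType f
  quasiCompact : QuasiCompact f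

attribute [instance] IsVar.isSeparated IsVar.locallyOfFiniteType IsVar.quasiCompact

/-- The class of a variety given by its structure morphism. -/
def vcls {X : Scheme.{u}} (f : X ⟶ Spec (CommRingCat.of k)) [IsVar f] : K0 k :=
  cls ⟨Over.mk f, isVariety_mk f inferInstance inferInstance inferInstance⟩

instance (X : Var k) : IsVar X.obj.hom := ⟨X.property.1, X.property.2.1, X.property.2.2⟩

section

variable {X Y U : Scheme.{u}} (f : X ⟶ Spec (CommRingCat.of k)) [IsVar f]

/-- Needed because open immersions into a Noetherian scheme are quasi-compact, so that open
subschemes of varieties are varieties. -/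
lemma isNoetherian_of_isVar {X : Scheme.{u}} (f : X ⟶ Spec (CommRingCat.of k)) [IsVar f] :
    IsNoetherian X where
  toIsLocallyNoetherian := LocallyOfFiniteType.isLocallyNoetherian f
  isCompact_univ := by
    have : CompactSpace X := QuasiCompact.compactSpace_of_compactSpace f
    exact isCompact_univ

instance isVar_comp_of_isOpenImmersion (j : U ⟶ X) [IsOpenImmersion j] : IsVar (j ≫ f) := by
  have := isNoetherian_of_isVar f
  exact ⟨inferInstance, inferInstance, inferInstance⟩

instance isVar_comp_of_isClosedImmersion (i : Y ⟶ X) [IsClosedImmersion i] : IsVar (i ≫ f) :=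
  ⟨inferInstance, inferInstance, inferInstance⟩

lemma vcls_eq_of_isIso (h : Y ⟶ Spec (CommRingCat.of k)) [IsVar h] (e : X ⟶ Y) [IsIso e]
    (w : e ≫ h = f) : vcls f = vcls h := by
  have e : (⟨Over.mk f, isVariety_mk f inferInstance inferInstance inferInstance⟩ : Var k) ≅
      ⟨Over.mk h, isVariety_mk h inferInstance inferInstance inferInstance⟩ :=
    (isVariety k).isoMk (Over.isoMk (asIso e) w)
  have h : toSkeleton _ = toSkeleton _ := Quotient.sound ⟨e⟩
  rw [vcls, vcls, cls, cls, gen, gen, h]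

lemma vcls_congr {f' : X ⟶ Spec (CommRingCat.of k)} [IsVar f'] (h : f = f') :
    vcls f = vcls f' := by
  subst h; rfl

lemma vcls_eq_closed_add_open (i : Y ⟶ X) (j : U ⟶ X)
    [hi : IsClosedImmersion i] [hj : IsOpenImmersion j] (h : Set.range j = (Set.range i)ᶜ) :
    vcls f = vcls (i ≫ f) + vcls (j ≫ f) := by
  let V {X : Scheme.{u}} (f : X ⟶ Spec (CommRingCat.of k)) [IsVar f] : Var k :=
    ⟨Over.mk f, isVariety_mk f inferInstance inferInstance inferInstance⟩
  have : gen (V f) - gen (V (i ≫ f)) - gen (V (j ≫ f)) ∈ Ideal.span (scissorRelations k) :=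
    Ideal.subset_span ⟨V f, V (i ≫ f), V (j ≫ f), ObjectProperty.homMk (Over.homMk i rfl),
      ObjectProperty.homMk (Over.homMk j rfl), hi, hj, h, rfl⟩
  have h0 := Ideal.Quotient.eq_zero_iff_mem.mpr this
  rw [map_sub, map_sub, sub_sub, sub_eq_zero] at h0
  exact h0

/-- The empty scheme is its own open complement, so its class `c` satisfies `c = c + c`. -/
lemma vcls_of_isEmpty [IsEmpty X] : vcls f = 0 := by
  have h := vcls_eq_closed_add_open f (𝟙 X) (𝟙 X) (by ext x; exact (IsEmpty.false x).elim)
  rw [vcls_congr (𝟙 X ≫ f) (Category.id_comp f)] at h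
  simpa using h

/-- The complement of an open subset `W` in a union `U ∪ W` of open subsets may be computed
in `U`. -/
lemma vcls_sup {W T Z : Scheme.{u}} (j : U ⟶ X) (l : W ⟶ X) (m : T ⟶ X)
    [IsOpenImmersion j] [IsOpenImmersion l] [IsOpenImmersion m]
    (hT : Set.range m = Set.range j ∪ Set.range l) (z : Z ⟶ U) [IsClosedImmersion z]
    (hz : Set.range z = (j ⁻¹' (Set.range l))ᶜ) :
    vcls (m ≫ f) = vcls (l ≫ f) + vcls (z ≫ j ≫ f) := by
  let C : TopologicalSpace.Closeds T := ⟨(m ⁻¹' (Set.range l))ᶜ,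
    (l.isOpenEmbedding.isOpen_range.preimage m.continuous).isClosed_compl⟩
  let I := Scheme.IdealSheafData.vanishingIdeal C
  let c : I.subscheme ⟶ T := I.subschemeι
  have hc : Set.range c = (m ⁻¹' (Set.range l))ᶜ := by
    have := I.range_subschemeι
    rwa [Scheme.IdealSheafData.coe_support_vanishingIdeal] at this
  have hlm : Set.range l ⊆ Set.range m := hT ▸ Set.subset_union_right
  have hjm : Set.range j ⊆ Set.range m := hT ▸ Set.subset_union_left
  let l' := IsOpenImmersion.lift m l hlm
  have hl' : l' ≫ m = l := IsOpenImmersion.lift_fac _ _ _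
  have h1 := vcls_eq_closed_add_open (m ≫ f) c l' (by
    rw [hc, compl_compl, ← hl', Scheme.Hom.comp_base, TopCat.coe_comp, Set.range_comp,
      Set.preimage_image_eq _ m.isOpenEmbedding.injective])
  have hcj : Set.range (c ≫ m) ⊆ Set.range j := by
    rintro _ ⟨x, rfl⟩
    have hx : c x ∈ (m ⁻¹' (Set.range l))ᶜ := hc ▸ ⟨x, rfl⟩
    have : m (c x) ∈ Set.range j ∪ Set.range l := hT ▸ ⟨_, rfl⟩
    rw [Scheme.Hom.comp_apply]
    exact this.resolve_right hx
  let c' := IsOpenImmersion.lift j (c ≫ m) hcj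
  have hc' : c' ≫ j = c ≫ m := IsOpenImmersion.lift_fac _ _ _
  let j' := IsOpenImmersion.lift m j hjm
  have hj' : j' ≫ m = j := IsOpenImmersion.lift_fac _ _ _
  have hcj' : c' ≫ j' = c := by
    rw [← cancel_mono m, Category.assoc, hj', hc']
  have : IsClosedImmersion (c' ≫ j') := hcj' ▸ inferInstance
  have : IsClosedImmersion c' := IsClosedImmersion.of_comp c' j'
  have hrc' : Set.range c' = Set.range z := by
    rw [hz]
    ext x
    simp only [Set.mem_compl_iff, Set.mem_preimage]
    constructor
    · rintro ⟨y, rfl⟩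
      have hy : c y ∈ (m ⁻¹' (Set.range l))ᶜ := hc ▸ ⟨y, rfl⟩
      rw [← Scheme.Hom.comp_apply, hc', Scheme.Hom.comp_apply]
      exact hy
    · intro hx
      have : j' x ∈ Set.range c := by
        rw [hc, Set.mem_compl_iff, Set.mem_preimage, ← Scheme.Hom.comp_apply, hj']
        exact hx
      obtain ⟨y, hy⟩ := this
      refine ⟨y, j.isOpenEmbedding.injective ?_⟩
      rw [← Scheme.Hom.comp_apply, hc', Scheme.Hom.comp_apply, hy, ← Scheme.Hom.comp_apply, hj']
  -- The closed subschemes `z` and `c'` of `U` may differ by nilpotents, but they have the same open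
  -- complement `O`. Two scissor relations in `U` therefore give them the same class.
  let O : U.Opens := ⟨(Set.range z)ᶜ, z.isClosedEmbedding.isClosed_range.isOpen_compl⟩
  have hO : Set.range O.ι = (Set.range z)ᶜ := by simp [O]
  have h2 := vcls_eq_closed_add_open (j ≫ f) z O.ι hO
  have h3 := vcls_eq_closed_add_open (j ≫ f) c' O.ι (hrc' ▸ hO)
  have h4 : vcls (c' ≫ j ≫ f) = vcls (c ≫ m ≫ f) :=
    vcls_congr _ (by rw [← Category.assoc c', hc', Category.assoc])
  have h5 : vcls (l' ≫ m ≫ f) = vcls (l ≫ f) :=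
    vcls_congr _ (by rw [← Category.assoc l', hl'])
  rw [h1, h5, ← h4, add_comm, add_right_inj]
  exact add_right_cancel (h3.symm.trans h2)

end

end Scissor

/-! ### Classes of affine varieties -/

section Affine

variable {k : Type u} [Field k]

/-- The structure morphism of the spectrum of a `k`-algebra. -/
abbrev specHom (k : Type u) [Field k] (A : Type u) [CommRing A] [Algebra k A] :
    Spec (CommRingCat.of A) ⟶ Spec (CommRingCat.of k) :=
  Spec.map (CommRingCat.ofHom (algebraMap k A))

instance (A : Type u) [CommRing A] [Algebra k A] [Algebra.FiniteType k A] :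
    IsVar (specHom k A) :=
  ⟨inferInstance, (HasRingHomProperty.Spec_iff (P := @LocallyOfFiniteType)).mpr
    (RingHom.finiteType_algebraMap.mpr inferInstance), inferInstance⟩

/-- The class of the spectrum of a finitely generated algebra. -/
def scls (k : Type u) [Field k] (A : Type u) [CommRing A] [Algebra k A]
    [Algebra.FiniteType k A] : K0 k := vcls (specHom k A)

variable {A B C : Type u} [CommRing A] [Algebra k A] [CommRing B] [Algebra k B]
  [CommRing C] [Algebra k C]

/-- The morphism of spectra given by an algebra homomorphism. -/
abbrev specMap (f : A →ₐ[k] B) : Spec (CommRingCat.of B) ⟶ Spec (CommRingCat.of A) :=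
  Spec.map (CommRingCat.ofHom f.toRingHom)

lemma specMap_comp_specHom (f : A →ₐ[k] B) : specMap f ≫ specHom k A = specHom k B := by
  rw [← Spec.map_comp, ← CommRingCat.ofHom_comp]
  congr 2
  exact f.comp_algebraMap

lemma range_specMap_of_surjective (f : A →ₐ[k] B) (hf : Function.Surjective f) :
    Set.range (specMap f) = PrimeSpectrum.zeroLocus (RingHom.ker f : Set A) :=
  range_comap_of_surjective _ f.toRingHom hf

instance isClosedImmersion_specMap (f : A →ₐ[k] B) [Fact (Function.Surjective f)] :
    IsClosedImmersion (specMap f) :=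
  IsClosedImmersion.spec_of_surjective _ Fact.out

variable [Algebra.FiniteType k A] [Algebra.FiniteType k B] [Algebra.FiniteType k C]

lemma scls_congr (e : A ≃ₐ[k] B) : scls k A = scls k B := by
  have : IsIso (CommRingCat.ofHom e.symm.toAlgHom.toRingHom) :=
    (e.symm.toRingEquiv.toCommRingCatIso).isIso_hom
  have : IsIso (specMap e.symm.toAlgHom) := inferInstance
  exact vcls_eq_of_isIso _ _ (specMap e.symm.toAlgHom) (specMap_comp_specHom e.symm.toAlgHom)

lemma scls_eq_zero [Subsingleton A] : scls k A = 0 := by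
  have : IsEmpty (Spec (CommRingCat.of A)) := inferInstanceAs (IsEmpty (PrimeSpectrum A))
  exact vcls_of_isEmpty _

lemma scls_eq_quotient_add_away (a : A) (f : A →ₐ[k] B) (hf : Function.Surjective f)
    (hker : RingHom.ker f = Ideal.span {a}) [Algebra A C] [IsScalarTower k A C]
    [IsLocalization.Away a C] : scls k A = scls k B + scls k C := by
  have : Fact (Function.Surjective f) := ⟨hf⟩
  have : IsOpenImmersion (specMap (IsScalarTower.toAlgHom k A C)) :=
    IsOpenImmersion.of_isLocalization (R := CommRingCat.of A) (S := CommRingCat.of C) a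
  have h := vcls_eq_closed_add_open (specHom k A) (specMap f)
    (specMap (IsScalarTower.toAlgHom k A C)) (by
      rw [range_specMap_of_surjective f hf, hker, PrimeSpectrum.zeroLocus_span]
      exact (PrimeSpectrum.localization_away_comap_range C a).trans
        (PrimeSpectrum.basicOpen_eq_zeroLocus_compl a))
  rw [scls, h, vcls_congr _ (specMap_comp_specHom f),
    vcls_congr _ (specMap_comp_specHom (IsScalarTower.toAlgHom k A C))]
  rfl

/-- Nilpotents do not matter. -/
lemma scls_eq_of_ker_le_nilradical (f : A →ₐ[k] B) (hf : Function.Surjective f)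
    (hker : RingHom.ker f ≤ nilradical A) : scls k A = scls k B := by
  have : Fact (Function.Surjective f) := ⟨hf⟩
  have hr : Set.range (specMap f) = Set.univ := by
    rw [range_specMap_of_surjective f hf]
    exact PrimeSpectrum.zeroLocus_eq_univ_iff _ |>.mpr hker
  have h := vcls_eq_closed_add_open (specHom k A) (specMap f)
    (Scheme.Opens.ι (⊥ : (Spec (CommRingCat.of A)).Opens)) (by simp [hr])
  have : IsEmpty (Scheme.Opens.toScheme (⊥ : (Spec (CommRingCat.of A)).Opens)) :=
    ⟨fun x => x.2⟩
  rw [vcls_of_isEmpty (Scheme.Opens.ι ⊥ ≫ _), add_zero,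
    vcls_congr _ (specMap_comp_specHom f)] at h
  exact h

/-- The variety given by its structure morphism. -/
def mkVar {X : Scheme.{u}} (f : X ⟶ Spec (CommRingCat.of k)) [IsVar f] : Var k :=
  ⟨Over.mk f, isVariety_mk f inferInstance inferInstance inferInstance⟩

omit [Algebra.FiniteType k A] [Algebra.FiniteType k B] in
lemma pullbackSpecIso_inv_comp_specHom :
    (pullbackSpecIso k A B).inv ≫ Limits.pullback.fst _ _ ≫ specHom k A =
      specHom k (A ⊗[k] B) := by
  rw [pullbackSpecIso_inv_fst_assoc, ← Spec.map_comp, ← CommRingCat.ofHom_comp]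

lemma scls_tensorProduct [Algebra.FiniteType k (A ⊗[k] B)] :
    scls k (A ⊗[k] B) = scls k A * scls k B := by
  have e : mkVar (specHom k (A ⊗[k] B)) ≅ mkVar (specHom k A) ⊗ mkVar (specHom k B) :=
    (isVariety k).isoMk (Over.isoMk (pullbackSpecIso k A B).symm
      pullbackSpecIso_inv_comp_specHom)
  have h : toSkeleton _ = toSkeleton _ := Quotient.sound ⟨e⟩
  change cls (mkVar _) = cls (mkVar _) * cls (mkVar _)
  rw [cls, cls, cls, gen, gen, gen, h, Skeleton.toSkeleton_tensorObj, FreeAbelianGroup.of_mul,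
    map_mul]

lemma scls_self : scls k k = 1 := by
  have h : specHom k k = 𝟙 _ := Spec.map_id _
  have : IsVar (𝟙 (Spec (CommRingCat.of k))) := ⟨inferInstance, inferInstance, inferInstance⟩
  rw [scls, vcls_congr _ h]
  change Ideal.Quotient.mk _ (FreeAbelianGroup.of (toSkeleton (𝟙_ (Var k)))) = 1
  rw [← Skeleton.one_eq, ← FreeAbelianGroup.one_def, map_one]

lemma scls_polynomial : scls k (Polynomial A) = lefschetz k * scls k A := by
  have : Algebra.FiniteType k (A ⊗[k] Polynomial k) :=
    .trans (S := A) inferInstance inferInstance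
  rw [scls_congr (polyEquivTensor k A), scls_tensorProduct, mul_comm]
  rfl

end Affine

/-! ### Regular functions on subsets of a vector space -/

section RegularFunctions

variable (k : Type u) [Field k] (V : Type u) [AddCommGroup V] [Module k V]

/-- The algebra of polynomial functions on a vector space. -/
def polyFun : Subalgebra k (V → k) :=
  Algebra.adjoin k (Set.range fun (ℓ : Module.Dual k V) => (ℓ : V → k))

variable {k V}

lemma dual_mem_polyFun (ℓ : Module.Dual k V) : (ℓ : V → k) ∈ polyFun k V :=
  Algebra.subset_adjoin ⟨ℓ, rfl⟩

lemma const_mem_polyFun (c : k) : (fun _ => c : V → k) ∈ polyFun k V :=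
  (polyFun k V).algebraMap_mem c

lemma polyFun_finiteType [FiniteDimensional k V] : Algebra.FiniteType k (polyFun k V) := by
  classical
  refine (Subalgebra.fg_iff_finiteType _).mp ?_
  let b := Module.finBasis k V
  refine ⟨Finset.univ.image fun i => (b.coord i : V → k), le_antisymm ?_ ?_⟩
  · refine Algebra.adjoin_le ?_
    intro f hf
    obtain ⟨i, -, rfl⟩ := by simpa using hf
    exact dual_mem_polyFun _
  · refine Algebra.adjoin_le ?_
    rintro _ ⟨ℓ, rfl⟩
    have : (ℓ : V → k) = ∑ i, ℓ (b i) • (b.coord i : V → k) := by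
      ext x
      simp only [Finset.sum_apply, Pi.smul_apply, smul_eq_mul]
      conv_lhs => rw [← b.sum_repr x, map_sum]
      simp [mul_comm]
    change (ℓ : V → k) ∈ _
    rw [this]
    exact Subalgebra.sum_mem _ fun i _ => Subalgebra.smul_mem _
      (Algebra.subset_adjoin (by simp)) _

variable (k) in
/-- The algebra of regular functions on a subset: quotients of polynomial functions whose
denominator has no zero on the subset. -/
def regFun (S : Set V) : Subalgebra k (S → k) where
  carrier := {φ | ∃ f ∈ polyFun k V, ∃ h ∈ polyFun k V, ∀ x : S, h x ≠ 0 ∧ φ x = f x / h x}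
  algebraMap_mem' c := ⟨_, const_mem_polyFun c, 1, one_mem _, fun x => by simp⟩
  add_mem' := by
    rintro _ _ ⟨f, hf, h, hh, H⟩ ⟨f', hf', h', hh', H'⟩
    refine ⟨f * h' + h * f', add_mem (mul_mem hf hh') (mul_mem hh hf'), h * h', mul_mem hh hh',
      fun x => ⟨mul_ne_zero (H x).1 (H' x).1, ?_⟩⟩
    simp only [Pi.add_apply, Pi.mul_apply, (H x).2, (H' x).2]
    exact div_add_div _ _ (H x).1 (H' x).1
  mul_mem' := by
    rintro _ _ ⟨f, hf, h, hh, H⟩ ⟨f', hf', h', hh', H'⟩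
    refine ⟨f * f', mul_mem hf hf', h * h', mul_mem hh hh',
      fun x => ⟨mul_ne_zero (H x).1 (H' x).1, ?_⟩⟩
    simp only [Pi.mul_apply, (H x).2, (H' x).2]
    exact div_mul_div_comm _ _ _ _

lemma restrict_mem_regFun {f : V → k} (hf : f ∈ polyFun k V) (S : Set V) :
    (fun x : S => f x) ∈ regFun k S :=
  ⟨f, hf, 1, one_mem _, fun x => by simp⟩

/-- A function which is regular on a subset. -/
def RegOn (S : Set V) (φ : V → k) : Prop := (fun x : S => φ x) ∈ regFun k S

lemma RegOn.exists_frac {S : Set V} {φ : V → k} (h : RegOn S φ) :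
    ∃ f ∈ polyFun k V, ∃ h ∈ polyFun k V, ∀ x ∈ S, h x ≠ 0 ∧ φ x = f x / h x := by
  obtain ⟨f, hf, h, hh, H⟩ := h
  exact ⟨f, hf, h, hh, fun x hx => H ⟨x, hx⟩⟩

lemma RegOn.mono {S T : Set V} {φ : V → k} (h : RegOn S φ) (hT : T ⊆ S) : RegOn T φ := by
  obtain ⟨f, hf, h, hh, H⟩ := h
  exact ⟨f, hf, h, hh, fun x => H ⟨x, hT x.2⟩⟩

lemma regOn_of_mem_polyFun {f : V → k} (hf : f ∈ polyFun k V) (S : Set V) : RegOn S f :=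
  restrict_mem_regFun hf S

/-- An affine subset: the points are the homomorphisms from the algebra of regular functions,
which is finitely generated. -/
structure IsAff (S : Set V) : Prop where
  finiteType : Algebra.FiniteType k (regFun k S)
  exists_eval : ∀ φ : regFun k S →ₐ[k] k, ∃ s : S, ∀ f, φ f = f.1 s

variable (k) in
open Classical in
/-- The class of an affine subset. -/
def affClass (S : Set V) : K0 k :=
  if _h : Algebra.FiniteType k (regFun k S) then scls k (regFun k S) else 0

lemma IsAff.affClass_eq {S : Set V} (h : IsAff (k := k) S) :
    haveI := h.finiteType
    affClass k S = scls k (regFun k S) :=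
  dif_pos h.finiteType

end RegularFunctions

/-! ### The Nullstellensatz and cuts of affine subsets -/

section Nullstellensatz

variable {k : Type u} [Field k] [IsAlgClosed k] {A : Type u} [CommRing A] [Algebra k A]
  [Algebra.FiniteType k A]

/-- By Zariski's lemma the residue field is finite over `k`, hence equal to `k`. -/
lemma exists_algHom_of_isMaximal (m : Ideal A) [m.IsMaximal] :
    ∃ φ : A →ₐ[k] k, ∀ a ∈ m, φ a = 0 := by
  let := Ideal.Quotient.field m
  have : Algebra.FiniteType k (A ⧸ m) := inferInstance
  have : Module.Finite k (A ⧸ m) := finite_of_finite_type_of_isJacobsonRing k (A ⧸ m)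
  have hb := IsAlgClosed.algebraMap_bijective_of_isIntegral (k := k) (K := A ⧸ m)
  let e : k ≃ₐ[k] (A ⧸ m) := AlgEquiv.ofBijective (Algebra.ofId k _) hb
  refine ⟨e.symm.toAlgHom.comp (Ideal.Quotient.mkₐ k m), fun a ha => ?_⟩
  have : Ideal.Quotient.mk m a = 0 := Ideal.Quotient.eq_zero_iff_mem.mpr ha
  simp [this]

lemma isUnit_of_forall_algHom_ne_zero (a : A) (h : ∀ φ : A →ₐ[k] k, φ a ≠ 0) : IsUnit a := by
  by_contra ha
  obtain ⟨m, hm, ham⟩ := exists_max_ideal_of_mem_nonunits ha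
  obtain ⟨φ, hφ⟩ := exists_algHom_of_isMaximal (k := k) m
  exact h φ (hφ a ham)

/-- In a Jacobson ring the nilradical is the Jacobson radical, and `1 + ab` is a unit because it
takes the value `1` at every `k`-point. -/
lemma mem_nilradical_of_forall_algHom_eq_zero (a : A) (h : ∀ φ : A →ₐ[k] k, φ a = 0) :
    a ∈ nilradical A := by
  have : IsJacobsonRing A := isJacobsonRing_of_finiteType (A := k)
  rw [nilradical, Ideal.radical_eq_jacobson]
  refine Ideal.mem_jacobson_bot.mpr ?_
  intro b
  refine isUnit_of_forall_algHom_ne_zero (k := k) _ fun φ => ?_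
  simp [h φ]

variable {V : Type u} [AddCommGroup V] [Module k V]

/-- Recognition principle: it identifies an affine subset from any algebra whose `k`-points are
given by the points of `S`. The map `A → regFun k S` is onto because a denominator without zeros on
`S` lifts to an element of `A` that vanishes at no `k`-point, hence to a unit. Its kernel vanishes
at all `k`-points, hence is nilpotent and does not affect the class. -/
lemma affClass_eq_of_eval {S : Set V} (ev : S → (A →ₐ[k] k)) (hsurj : Function.Surjective ev)
    (hreg : ∀ a, (fun s => ev s a) ∈ regFun k S)
    (hlin : ∀ ℓ : Module.Dual k V, ∃ a, ∀ s : S, ev s a = ℓ s) :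
    IsAff (k := k) S ∧ affClass k S = scls k A := by
  let π₀ : A →ₐ[k] (S → k) := AlgHom.pi ev
  let π : A →ₐ[k] regFun k S := π₀.codRestrict (regFun k S) hreg
  have hinv : ∀ a, (∀ s, ev s a ≠ 0) → IsUnit a := fun a ha =>
    isUnit_of_forall_algHom_ne_zero (k := k) a fun φ => by
      obtain ⟨s, rfl⟩ := hsurj φ
      exact ha s
  have hpoly : ∀ f ∈ polyFun k V, ∃ a, ∀ s : S, ev s a = f s := by
    intro f hf
    induction hf using Algebra.adjoin_induction with
    | mem f hf => obtain ⟨ℓ, rfl⟩ := hf; exact hlin ℓ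
    | algebraMap c => exact ⟨algebraMap k A c, fun s => by simp⟩
    | add f g _ _ hf hg =>
      obtain ⟨a, ha⟩ := hf
      obtain ⟨b, hb⟩ := hg
      exact ⟨a + b, fun s => by simp [ha, hb]⟩
    | mul f g _ _ hf hg =>
      obtain ⟨a, ha⟩ := hf
      obtain ⟨b, hb⟩ := hg
      exact ⟨a * b, fun s => by simp [ha, hb]⟩
  have hπ : Function.Surjective π := by
    rintro ⟨φ, f, hf, h, hh, H⟩
    obtain ⟨a, ha⟩ := hpoly f hf
    obtain ⟨b, hb⟩ := hpoly h hh
    obtain ⟨c, hc⟩ := (hinv b fun s => by rw [hb]; exact (H s).1).exists_right_inv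
    refine ⟨a * c, Subtype.ext (funext fun s => ?_)⟩
    have h1 : ev s b * ev s c = 1 := by rw [← map_mul, hc, map_one]
    rw [hb] at h1
    change ev s (a * c) = φ s
    rw [map_mul, ha, (H s).2, div_eq_mul_inv, eq_inv_of_mul_eq_one_right h1]
  have hft : Algebra.FiniteType k (regFun k S) := .of_surjective π hπ
  refine ⟨⟨hft, fun φ => ?_⟩, ?_⟩
  · obtain ⟨s, hs⟩ := hsurj (φ.comp π)
    refine ⟨s, fun f => ?_⟩
    obtain ⟨a, rfl⟩ := hπ f
    exact (DFunLike.congr_fun hs a).symm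
  · rw [affClass, dif_pos hft]
    refine (scls_eq_of_ker_le_nilradical π hπ fun a ha => ?_).symm
    refine mem_nilradical_of_forall_algHom_eq_zero (k := k) a fun φ => ?_
    obtain ⟨s, rfl⟩ := hsurj φ
    exact congrFun (congrArg Subtype.val ha) s

/-- A character of the algebra of polynomial functions restricts to a linear form on the dual of
`V`, that is, to evaluation at a vector. -/
lemma isAff_univ [FiniteDimensional k V] : IsAff (k := k) (Set.univ : Set V) := by
  have := polyFun_finiteType (k := k) (V := V)
  refine (affClass_eq_of_eval (A := polyFun k V)
    (fun s => (Pi.evalAlgHom k (fun _ : V => k) s.1).comp (polyFun k V).val) ?_ ?_ ?_).1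
  · intro φ
    let θ : Module.Dual k (Module.Dual k V) :=
      { toFun := fun ℓ => φ ⟨_, dual_mem_polyFun ℓ⟩
        map_add' := fun a b => by
          rw [← map_add]; rfl
        map_smul' := fun c a => by
          simp only [RingHom.id_apply]
          rw [← map_smul]; rfl }
    obtain ⟨x, hx⟩ := (Module.evalEquiv k V).surjective θ
    refine ⟨⟨x, trivial⟩, AlgHom.ext ?_⟩
    rintro ⟨f, hf⟩
    simp only [AlgHom.comp_apply, Subalgebra.coe_val, Pi.evalAlgHom_apply]
    induction hf using Algebra.adjoin_induction with
    | mem f hf => obtain ⟨ℓ, rfl⟩ := hf; exact DFunLike.congr_fun hx ℓ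
    | algebraMap c => exact (φ.commutes c).symm
    | add f g hf hg h1 h2 =>
      have : φ ⟨f + g, add_mem hf hg⟩ = φ ⟨f, hf⟩ + φ ⟨g, hg⟩ := by rw [← map_add]; rfl
      rw [this, ← h1, ← h2]; rfl
    | mul f g hf hg h1 h2 =>
      have : φ ⟨f * g, mul_mem hf hg⟩ = φ ⟨f, hf⟩ * φ ⟨g, hg⟩ := by rw [← map_mul]; rfl
      rw [this, ← h1, ← h2]; rfl
  · rintro ⟨f, hf⟩
    exact restrict_mem_regFun hf _
  · exact fun ℓ => ⟨⟨_, dual_mem_polyFun ℓ⟩, fun s => rfl⟩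

/-- With `A` the algebra of `S` and `a` the function `f`, the two pieces have algebras `A/(a)` and
`A[1/a]`, and the equation of classes is the scissor relation in `Spec A`. Allowing `f` to be
regular, rather than polynomial, makes it possible to pull cuts back along regular maps. -/
lemma IsAff.cut {S : Set V} (hS : IsAff (k := k) S) {f : V → k} (hf : RegOn S f) :
    IsAff (k := k) (S ∩ {x | f x = 0}) ∧ IsAff (k := k) (S ∩ {x | f x ≠ 0}) ∧
      affClass k S = affClass k (S ∩ {x | f x = 0}) + affClass k (S ∩ {x | f x ≠ 0}) := by
  have hft := hS.finiteType
  let A := regFun k S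
  let a : A := ⟨_, hf⟩
  have h1 := affClass_eq_of_eval (k := k) (A := A ⧸ Ideal.span {a}) (S := S ∩ {x | f x = 0})
    (fun s => Ideal.Quotient.liftₐ _
      ((Pi.evalAlgHom k (fun _ : S => k) ⟨s.1, s.2.1⟩).comp A.val) (by
        intro b hb
        obtain ⟨c, rfl⟩ := Ideal.mem_span_singleton'.mp hb
        rw [map_mul]
        exact mul_eq_zero_of_right _ s.2.2))
    (by
      intro φ
      obtain ⟨s, hs⟩ := hS.exists_eval (φ.comp (Ideal.Quotient.mkₐ k _))
      refine ⟨⟨s.1, s.2, ?_⟩, ?_⟩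
      · have := hs a
        rw [AlgHom.comp_apply, Ideal.Quotient.mkₐ_eq_mk,
          Ideal.Quotient.eq_zero_iff_mem.mpr (Ideal.mem_span_singleton_self a), map_zero] at this
        exact this.symm
      · refine Ideal.Quotient.algHom_ext _ (AlgHom.ext fun b => ?_)
        exact (hs b).symm)
    (by
      intro b
      obtain ⟨⟨b, g, hg, h, hh, H⟩, rfl⟩ := Ideal.Quotient.mk_surjective b
      exact ⟨g, hg, h, hh, fun x => H ⟨x.1, x.2.1⟩⟩)
    (fun ℓ => ⟨Ideal.Quotient.mk _ ⟨_, restrict_mem_regFun (dual_mem_polyFun ℓ) S⟩,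
      fun s => rfl⟩)
  have hftL : Algebra.FiniteType k (Localization.Away a) := inferInstance
  have hu (s : (S ∩ {x | f x ≠ 0} : Set V)) : ∀ y : Submonoid.powers a,
      IsUnit (((Pi.evalAlgHom k (fun _ : S => k) ⟨s.1, s.2.1⟩).comp A.val) y) := by
    rintro ⟨_, n, rfl⟩
    simp only [map_pow]
    exact (isUnit_iff_ne_zero.mpr s.2.2).pow n
  let ev (s : (S ∩ {x | f x ≠ 0} : Set V)) : Localization.Away a →ₐ[k] k :=
    IsLocalization.liftAlgHom (M := Submonoid.powers a)
      (f := (Pi.evalAlgHom k (fun _ : S => k) ⟨s.1, s.2.1⟩).comp A.val) (hu s)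
  have hev (s) (b : A) : ev s (algebraMap A _ b) = b.1 ⟨s.1, s.2.1⟩ :=
    IsLocalization.lift_eq (M := Submonoid.powers a) (hu s) b
  have h2 := affClass_eq_of_eval (k := k) (A := Localization.Away a) (S := S ∩ {x | f x ≠ 0}) ev
    (by
      intro φ
      obtain ⟨s, hs⟩ := hS.exists_eval (φ.comp (IsScalarTower.toAlgHom k A _))
      have hsa : f s ≠ 0 := by
        have h0 := hs a
        change φ (algebraMap A _ a) = f s at h0
        rw [← h0]
        exact ((IsLocalization.Away.algebraMap_isUnit a).map φ).ne_zero
      refine ⟨⟨s.1, s.2, hsa⟩, ?_⟩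
      refine IsLocalization.algHom_ext (Submonoid.powers a) ?_
      refine AlgHom.ext fun b => ?_
      exact (hev ⟨s.1, s.2, hsa⟩ b).trans (hs b).symm)
    (by
      intro b
      obtain ⟨⟨c, ⟨_, n, rfl⟩⟩, hb⟩ := IsLocalization.surj (Submonoid.powers a) b
      obtain ⟨g, hg, h, hh, H⟩ := c.2
      obtain ⟨g', hg', h', hh', H'⟩ := hf
      -- The element is `c / aⁿ`; with `c = g / h` and `f = g' / h'` its values are `(g / h) (h' /
      -- g')ⁿ`.
      refine ⟨g * h' ^ n, mul_mem hg (pow_mem hh' n), h * g' ^ n, mul_mem hh (pow_mem hg' n),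
        fun x => ?_⟩
      have hx := congrArg (ev x) hb
      simp only [map_mul, hev] at hx
      change ev x _ * (f x) ^ n = c.1 _ at hx
      obtain ⟨e1, e2⟩ := H ⟨x.1, x.2.1⟩
      obtain ⟨e3, e4⟩ := H' ⟨x.1, x.2.1⟩
      simp only at e1 e2 e3 e4
      have e5 : f x ≠ 0 := x.2.2
      have e6 : g' x ≠ 0 := by
        intro h0; rw [h0, zero_div] at e4; exact e5 e4
      rw [e2, e4] at hx
      refine ⟨mul_ne_zero e1 (pow_ne_zero _ e6), ?_⟩
      simp only [Pi.mul_apply, Pi.pow_apply]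
      rw [div_pow] at hx
      field_simp at hx ⊢
      linear_combination hx)
    (fun ℓ => ⟨algebraMap A _ ⟨_, restrict_mem_regFun (dual_mem_polyFun ℓ) S⟩,
      fun s => hev s _⟩)
  refine ⟨h1.1, h2.1, ?_⟩
  rw [h1.2, h2.2, hS.affClass_eq]
  exact scls_eq_quotient_add_away a (Ideal.Quotient.mkₐ k (Ideal.span {a}))
    (Ideal.Quotient.mkₐ_surjective k _) (Ideal.Quotient.mkₐ_ker k _)

lemma affClass_empty : IsAff (k := k) (∅ : Set V) ∧ affClass k (∅ : Set V) = 0 := by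
  have h := affClass_eq_of_eval (k := k) (A := PUnit.{u + 1}) (S := (∅ : Set V))
    (fun s => s.2.elim) (fun φ => by
      have h0 : (1 : k) = 0 := (map_one φ).symm.trans (map_zero φ)
      exact (one_ne_zero h0).elim) (fun _ => ⟨1, one_mem _, 1, one_mem _, fun s => s.2.elim⟩)
    (fun _ => ⟨0, fun s => s.2.elim⟩)
  exact ⟨h.1, h.2.trans scls_eq_zero⟩

end Nullstellensatz

/-! ### Constructible functions, sets and maps -/

section Constructible

variable {k : Type u} [Field k] {V : Type u} [AddCommGroup V] [Module k V]
  {V' : Type u} [AddCommGroup V'] [Module k V']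

/-- Constructible functions: the smallest class of functions containing constants and linear
forms that is closed under sums, products and pointwise inversion (with `0⁻¹ = 0`). -/
inductive DefFun : (V → k) → Prop
  | const (c : k) : DefFun fun _ => c
  | dual (ℓ : Module.Dual k V) : DefFun fun x => ℓ x
  | add {f g : V → k} : DefFun f → DefFun g → DefFun fun x => f x + g x
  | mul {f g : V → k} : DefFun f → DefFun g → DefFun fun x => f x * g x
  | inv {f : V → k} : DefFun f → DefFun fun x => (f x)⁻¹

namespace DefFun

lemma neg {f : V → k} (hf : DefFun f) : DefFun fun x => -f x := by
  simpa using (DefFun.const (-1)).mul hf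

lemma sub {f g : V → k} (hf : DefFun f) (hg : DefFun g) : DefFun fun x => f x - g x := by
  simpa [sub_eq_add_neg] using hf.add hg.neg

lemma div {f g : V → k} (hf : DefFun f) (hg : DefFun g) : DefFun fun x => f x / g x := by
  simpa [div_eq_mul_inv] using hf.mul hg.inv

lemma pow {f : V → k} (hf : DefFun f) (n : ℕ) : DefFun fun x => f x ^ n := by
  induction n with
  | zero => simpa using DefFun.const 1
  | succ n ih => simpa [pow_succ] using ih.mul hf

lemma sum {ι : Type*} (s : Finset ι) {f : ι → V → k} (hf : ∀ i ∈ s, DefFun (f i)) :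
    DefFun fun x => ∑ i ∈ s, f i x := by
  classical
  induction s using Finset.induction_on with
  | empty => simpa using DefFun.const 0
  | insert a s ha ih =>
    simpa [Finset.sum_insert ha] using (hf a (by simp)).add (ih fun i hi => hf i (by simp [hi]))

lemma prod {ι : Type*} (s : Finset ι) {f : ι → V → k} (hf : ∀ i ∈ s, DefFun (f i)) :
    DefFun fun x => ∏ i ∈ s, f i x := by
  classical
  induction s using Finset.induction_on with
  | empty => simpa using DefFun.const 1
  | insert a s ha ih =>
    simpa [Finset.prod_insert ha] using (hf a (by simp)).mul (ih fun i hi => hf i (by simp [hi]))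

lemma of_mem_polyFun {f : V → k} (hf : f ∈ polyFun k V) : DefFun f := by
  induction hf using Algebra.adjoin_induction with
  | mem f hf => obtain ⟨ℓ, rfl⟩ := hf; exact .dual ℓ
  | algebraMap c => exact .const c
  | add f g _ _ hf hg => exact hf.add hg
  | mul f g _ _ hf hg => exact hf.mul hg

end DefFun

variable (k) in
/-- Constructible maps. -/
def DefMap (φ : V → V') : Prop := ∀ ℓ : Module.Dual k V', DefFun fun x => ℓ (φ x)

lemma DefFun.comp {f : V' → k} (hf : DefFun f) {φ : V → V'} (hφ : DefMap k φ) :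
    DefFun fun x => f (φ x) := by
  induction hf with
  | const c => exact .const c
  | dual ℓ => exact hφ ℓ
  | add _ _ h1 h2 => exact h1.add h2
  | mul _ _ h1 h2 => exact h1.mul h2
  | inv _ h => exact h.inv

namespace DefMap

variable {V'' : Type u} [AddCommGroup V''] [Module k V'']

lemma comp {ψ : V' → V''} {φ : V → V'} (hψ : DefMap k ψ) (hφ : DefMap k φ) :
    DefMap k fun x => ψ (φ x) := fun ℓ => (hψ ℓ).comp hφ

lemma linearMap (g : V →ₗ[k] V') : DefMap k fun x => g x := fun ℓ => .dual (ℓ.comp g)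

lemma id : DefMap k fun x : V => x := linearMap LinearMap.id

lemma fst : DefMap k fun x : V × V' => x.1 := linearMap (LinearMap.fst k V V')

lemma snd : DefMap k fun x : V × V' => x.2 := linearMap (LinearMap.snd k V V')

lemma const (y : V') : DefMap k fun _ : V => y := fun ℓ => .const (ℓ y)

lemma prodMk {φ : V → V'} {ψ : V → V''} (hφ : DefMap k φ) (hψ : DefMap k ψ) :
    DefMap k fun x => (φ x, ψ x) := fun ℓ => by
  have h := (hφ (ℓ.comp (LinearMap.inl k V' V''))).add (hψ (ℓ.comp (LinearMap.inr k V' V'')))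
  convert h using 2 with x
  simp only [LinearMap.comp_apply, LinearMap.inl_apply, LinearMap.inr_apply, ← map_add]
  simp

lemma smul {f : V → k} {φ : V → V'} (hf : DefFun f) (hφ : DefMap k φ) :
    DefMap k fun x => f x • φ x :=
  fun ℓ => by simpa using hf.mul (hφ ℓ)

lemma of_defFun {f : V → k} (hf : DefFun f) : DefMap k f := fun ℓ => by
  have : (fun x => ℓ (f x)) = fun x => f x * ℓ 1 := by
    ext x
    rw [← smul_eq_mul, ← map_smul, smul_eq_mul, mul_one]
  rw [this]
  exact hf.mul (.const _)

lemma defFun {f : V → k} (hf : DefMap k f) : DefFun f := hf LinearMap.id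

lemma pi {ι : Type} [Finite ι] {φ : V → ι → k} (h : ∀ i, DefFun fun x => φ x i) :
    DefMap k φ := fun ℓ => by
  classical
  cases nonempty_fintype ι
  have : (fun x => ℓ (φ x)) = fun x => ∑ i, φ x i * ℓ (fun j => if i = j then 1 else 0) := by
    ext x
    conv_lhs => rw [pi_eq_sum_univ (φ x), map_sum]
    simp
  rw [this]
  exact DefFun.sum _ fun i _ => (h i).mul (.const _)

lemma apply {ι : Type} {φ : V → ι → k} (h : DefMap k φ) (i : ι) : DefFun fun x => φ x i :=
  h (LinearMap.proj i)

end DefMap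

variable (k) in
/-- Constructible sets. -/
def IsCon (T : Set V) : Prop := ∃ e : V → k, DefFun e ∧ ∀ x, x ∈ T ↔ e x = 0

namespace IsCon

lemma eq_zero {e : V → k} (he : DefFun e) : IsCon k {x | e x = 0} := ⟨e, he, fun _ => Iff.rfl⟩

lemma compl {T : Set V} (hT : IsCon k T) : IsCon k Tᶜ := by
  obtain ⟨e, he, h⟩ := hT
  -- Since `0⁻¹ = 0`, the function `e x * (e x)⁻¹` is the indicator function of `e x ≠ 0`. The same
  -- device gives definitions by cases below.
  refine ⟨fun x => 1 - e x * (e x)⁻¹, (DefFun.const 1).sub (he.mul he.inv), fun x => ?_⟩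
  rw [Set.mem_compl_iff, h]
  by_cases hx : e x = 0 <;> simp [hx]

lemma union {T T' : Set V} (hT : IsCon k T) (hT' : IsCon k T') : IsCon k (T ∪ T') := by
  obtain ⟨e, he, h⟩ := hT
  obtain ⟨e', he', h'⟩ := hT'
  exact ⟨_, he.mul he', fun x => by simp [h, h']⟩

lemma inter {T T' : Set V} (hT : IsCon k T) (hT' : IsCon k T') : IsCon k (T ∩ T') := by
  simpa [Set.compl_union] using (hT.compl.union hT'.compl).compl

lemma ne_zero {e : V → k} (he : DefFun e) : IsCon k {x | e x ≠ 0} := (eq_zero he).compl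

lemma eq {e f : V → k} (he : DefFun e) (hf : DefFun f) : IsCon k {x | e x = f x} :=
  ⟨_, he.sub hf, fun x => by simp [sub_eq_zero]⟩

lemma univ : IsCon k (Set.univ : Set V) := ⟨_, .const 0, fun x => by simp⟩

lemma empty : IsCon k (∅ : Set V) := ⟨_, .const 1, fun x => by simp⟩

lemma diff {T T' : Set V} (hT : IsCon k T) (hT' : IsCon k T') : IsCon k (T \ T') :=
  hT.inter hT'.compl

lemma preimage {T : Set V'} (hT : IsCon k T) {φ : V → V'} (hφ : DefMap k φ) :
    IsCon k (φ ⁻¹' T) := by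
  obtain ⟨e, he, h⟩ := hT
  exact ⟨_, he.comp hφ, fun x => h _⟩

lemma prod {T : Set V} {T' : Set V'} (hT : IsCon k T) (hT' : IsCon k T') : IsCon k (T ×ˢ T') :=
  (hT.preimage .fst).inter (hT'.preimage .snd)

lemma and {P Q : V → Prop} (hP : IsCon k {x | P x}) (hQ : IsCon k {x | Q x}) :
    IsCon k {x | P x ∧ Q x} := hP.inter hQ

lemma forall_finite {ι : Type*} [Finite ι] {P : ι → V → Prop} (h : ∀ i, IsCon k {x | P i x}) :
    IsCon k {x | ∀ i, P i x} := by
  classical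
  cases nonempty_fintype ι
  have : ∀ s : Finset ι, IsCon k {x | ∀ i ∈ s, P i x} := by
    intro s
    induction s using Finset.induction_on with
    | empty => simpa using univ
    | insert a s _ ih => simpa using (h a).and ih
  simpa using this Finset.univ

lemma eq_zero_pi {ι : Type} [Finite ι] {φ : V → ι → k} (h : DefMap k φ) :
    IsCon k {x | φ x = 0} := by
  simpa [funext_iff] using forall_finite fun i => eq_zero (h.apply i)

end IsCon

lemma DefFun.ite {P : V → Prop} [DecidablePred P] (hP : IsCon k {x | P x}) {f g : V → k}
    (hf : DefFun f) (hg : DefFun g) : DefFun fun x => if P x then f x else g x := by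
  obtain ⟨e, he, h⟩ := hP
  have := ((DefFun.const 1).sub (he.mul he.inv)).mul hf |>.add ((he.mul he.inv).mul hg)
  convert this using 2 with x
  have hx := h x
  simp only [Set.mem_ofPred_eq] at hx
  by_cases h0 : e x = 0
  · simp [hx.mpr h0, h0]
  · simp [mt hx.mp h0, h0]

lemma DefMap.ite {P : V → Prop} [DecidablePred P] (hP : IsCon k {x | P x}) {f g : V → V'}
    (hf : DefMap k f) (hg : DefMap k g) : DefMap k fun x => if P x then f x else g x := fun ℓ => by
  have := DefFun.ite hP (hf ℓ) (hg ℓ)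
  convert this using 2 with x
  by_cases hx : P x <;> simp [hx]

/-! ### Decomposition into affine subsets -/

/-- Finite decision trees: `S` may be cut successively by polynomial functions into pieces
satisfying `P`. -/
inductive Splits (k : Type u) [Field k] {V : Type u} [AddCommGroup V] [Module k V]
    (P : Set V → Prop) : Set V → Prop
  | leaf {S : Set V} : P S → Splits k P S
  | node {S : Set V} {f : V → k} : f ∈ polyFun k V → Splits k P (S ∩ {x | f x = 0}) →
      Splits k P (S ∩ {x | f x ≠ 0}) → Splits k P S

namespace Splits

variable {P Q : Set V → Prop} {S T : Set V}

lemma bind (h : Splits k P S) (hPQ : ∀ S' ⊆ S, P S' → Splits k Q S') : Splits k Q S := by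
  induction h with
  | leaf h => exact hPQ _ subset_rfl h
  | node hf _ _ h1 h2 =>
    exact .node hf (h1 fun S' hS' => hPQ S' (hS'.trans Set.inter_subset_left))
      (h2 fun S' hS' => hPQ S' (hS'.trans Set.inter_subset_left))

lemma mono_set (hP : ∀ S T, T ⊆ S → P S → P T) (h : Splits k P S) (hT : T ⊆ S) :
    Splits k P T := by
  induction h generalizing T with
  | leaf h => exact .leaf (hP _ _ hT h)
  | node hf _ _ h1 h2 =>
    exact .node hf (h1 (Set.inter_subset_inter_left _ hT)) (h2 (Set.inter_subset_inter_left _ hT))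

lemma and (hP : ∀ S T, T ⊆ S → P S → P T) (hQ : ∀ S T, T ⊆ S → Q S → Q T)
    (h1 : Splits k P S) (h2 : Splits k Q S) : Splits k (fun S => P S ∧ Q S) S :=
  h1.bind fun _ hS' hP' => (h2.mono_set hQ hS').bind fun _ hS'' hQ'' =>
    .leaf ⟨hP _ _ hS'' hP', hQ''⟩

lemma forall_finite {ι : Type*} [Finite ι] {P : ι → Set V → Prop}
    (hP : ∀ i S T, T ⊆ S → P i S → P i T) (h : ∀ i, Splits k (P i) S) :
    Splits k (fun S => ∀ i, P i S) S := by
  classical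
  cases nonempty_fintype ι
  have : ∀ s : Finset ι, Splits k (fun S => ∀ i ∈ s, P i S) S := by
    intro s
    induction s using Finset.induction_on with
    | empty => exact .leaf (by simp)
    | insert a s _ ih =>
      refine ((h a).and (hP a) (fun S T hT h i hi => hP i S T hT (h i hi)) ih).bind
        fun S' _ hS' => .leaf (by simpa using hS')
  exact (this Finset.univ).bind fun _ _ h => .leaf fun i => h i (by simp)

end Splits

lemma RegOn.congr {S : Set V} {f g : V → k} (hf : RegOn S f) (h : ∀ x ∈ S, f x = g x) :
    RegOn S g := by
  have : (fun x : S => g x) = fun x : S => f x := by ext x; exact (h x x.2).symm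
  rw [RegOn, this]
  exact hf

lemma RegOn.div {S : Set V} {f g : V → k} (hf : RegOn S f) (hg : RegOn S g)
    (h0 : ∀ x ∈ S, g x ≠ 0) : RegOn S fun x => f x / g x := by
  obtain ⟨a, ha, b, hb, H⟩ := hf.exists_frac
  obtain ⟨c, hc, d, hd, H'⟩ := hg.exists_frac
  refine ⟨a * d, mul_mem ha hd, b * c, mul_mem hb hc, fun x => ?_⟩
  obtain ⟨h1, h2⟩ := H x x.2
  obtain ⟨h3, h4⟩ := H' x x.2
  have h5 := h0 x x.2
  rw [h4] at h5
  refine ⟨mul_ne_zero h1 (div_ne_zero_iff.mp h5).1, ?_⟩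
  simp only [Pi.mul_apply]
  rw [h2, h4, div_div_div_eq]

/-- Only inversion leads out of the regular functions. On a piece where `f = a / b`, cutting by the
polynomial `a` leaves one piece where `f⁻¹` is `0` and one where `f` has no zero. -/
lemma DefFun.splits {e : V → k} (he : DefFun e) (S : Set V) : Splits k (fun S => RegOn S e) S := by
  induction he generalizing S with
  | const c => exact .leaf (regOn_of_mem_polyFun (const_mem_polyFun c) S)
  | dual ℓ => exact .leaf (regOn_of_mem_polyFun (dual_mem_polyFun ℓ) S)
  | add _ _ h1 h2 =>
    exact ((h1 S).and (fun _ _ hT h => h.mono hT) (fun _ _ hT h => h.mono hT) (h2 S)).bind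
      fun S' _ h => .leaf (add_mem h.1 h.2)
  | mul _ _ h1 h2 =>
    exact ((h1 S).and (fun _ _ hT h => h.mono hT) (fun _ _ hT h => h.mono hT) (h2 S)).bind
      fun S' _ h => .leaf (mul_mem h.1 h.2)
  | inv _ h =>
    refine (h S).bind fun S' _ hS' => ?_
    obtain ⟨a, ha, b, hb, H⟩ := hS'.exists_frac
    refine .node ha (.leaf ?_) (.leaf ?_)
    · refine (regOn_of_mem_polyFun (const_mem_polyFun (0 : k)) _).congr fun x hx => ?_
      rw [(H x hx.1).2, show a x = 0 from hx.2]
      simp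
    · refine ((regOn_of_mem_polyFun (const_mem_polyFun (1 : k)) _).div (hS'.mono
        Set.inter_subset_left) fun x hx => ?_).congr fun x _ => one_div _
      rw [(H x hx.1).2]
      exact div_ne_zero hx.2 (H x hx.1).1

/-- Once the defining function of `T` is a fraction on a piece, cutting by its numerator separates
`T` from its complement. -/
lemma IsCon.splits {T : Set V} (hT : IsCon k T) (S : Set V) :
    Splits k (fun S => S ⊆ T ∨ Disjoint S T) S := by
  obtain ⟨e, he, h⟩ := hT
  refine (he.splits S).bind fun S' _ hS' => ?_
  obtain ⟨a, ha, b, hb, H⟩ := hS'.exists_frac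
  refine .node ha (.leaf (.inl fun x hx => ?_)) (.leaf (.inr ?_))
  · rw [h, (H x hx.1).2, show a x = 0 from hx.2, zero_div]
  · refine Set.disjoint_left.mpr fun x hx hxT => ?_
    rw [h, (H x hx.1).2, div_eq_zero_iff] at hxT
    exact hxT.elim hx.2 (H x hx.1).1

/-- Subsets obtained from the whole space by finitely many cuts. -/
inductive Basic (k : Type u) [Field k] {V : Type u} [AddCommGroup V] [Module k V] :
    Set V → Prop
  | univ : Basic k Set.univ
  | eq_zero {S : Set V} {f : V → k} : f ∈ polyFun k V → Basic k S → Basic k (S ∩ {x | f x = 0})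
  | ne_zero {S : Set V} {f : V → k} : f ∈ polyFun k V → Basic k S → Basic k (S ∩ {x | f x ≠ 0})

lemma Basic.isCon {S : Set V} (hS : Basic k S) : IsCon k S := by
  induction hS with
  | univ => exact .univ
  | eq_zero hf _ h => exact h.inter (.eq_zero (.of_mem_polyFun hf))
  | ne_zero hf _ h => exact h.inter (.ne_zero (.of_mem_polyFun hf))

/-- To prove a property of the whole space that is compatible with cuts, it is enough to prove it
for the leaves of a decision tree. -/
lemma Splits.basic_induction {P Q : Set V → Prop} (h : Splits k P (Set.univ : Set V))
    (hleaf : ∀ S, Basic k S → P S → Q S)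
    (hnode : ∀ S, ∀ f ∈ polyFun k V, Basic k S → Q (S ∩ {x | f x = 0}) →
      Q (S ∩ {x | f x ≠ 0}) → Q S) : Q (Set.univ : Set V) := by
  have : ∀ S, Splits k P S → Basic k S → Q S := by
    intro S hS
    induction hS with
    | leaf h => exact fun hS => hleaf _ hS h
    | node hf _ _ h1 h2 =>
      exact fun hS => hnode _ _ hf hS (h1 (.eq_zero hf hS)) (h2 (.ne_zero hf hS))
  exact this _ h .univ

end Constructible

/-! ### The class of a constructible set -/

section Measure

variable {k : Type u} [Field k] [IsAlgClosed k] {V : Type u} [AddCommGroup V] [Module k V]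
  {V' : Type u} [AddCommGroup V'] [Module k V']

/-- `Cl T S c` means that `c` is the sum of the classes of affine pieces of `T ∩ S`. -/
inductive Cl (T : Set V) : Set V → K0 k → Prop
  | inside {S : Set V} : S ⊆ T → Cl T S (affClass k S)
  | outside {S : Set V} : Disjoint S T → Cl T S 0
  | node {S : Set V} {f : V → k} {c d : K0 k} : f ∈ polyFun k V → Cl T (S ∩ {x | f x = 0}) c →
      Cl T (S ∩ {x | f x ≠ 0}) d → Cl T S (c + d)

omit [IsAlgClosed k] in
lemma Cl.congr {T T' S : Set V} {c : K0 k} (h : Cl T S c) (hT : ∀ x ∈ S, x ∈ T ↔ x ∈ T') :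
    Cl T' S c := by
  induction h with
  | inside h => exact .inside fun x hx => (hT x hx).mp (h hx)
  | outside h =>
    exact .outside (Set.disjoint_left.mpr fun x hx hx' =>
      Set.disjoint_left.mp h hx ((hT x hx).mpr hx'))
  | node hf _ _ h1 h2 => exact .node hf (h1 fun x hx => hT x hx.1) (h2 fun x hx => hT x hx.1)

/-- The class of an affine subset is additive under cuts, so any decision tree computes the right
value if the whole intersection is affine. -/
lemma Cl.eq_affClass_inter {T S : Set V} {c : K0 k} (h : Cl T S c) (hS : IsAff (k := k) (S ∩ T)) :
    c = affClass k (S ∩ T) := by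
  induction h with
  | inside h => rw [Set.inter_eq_left.mpr h]
  | outside h => rw [Set.disjoint_iff_inter_eq_empty.mp h, affClass_empty.2]
  | node hf _ _ h1 h2 =>
    obtain ⟨a1, a2, a3⟩ := hS.cut (regOn_of_mem_polyFun hf _)
    rw [Set.inter_right_comm] at a1 a2
    rw [h1 a1, h2 a2, a3, Set.inter_right_comm, Set.inter_right_comm _ {x | _ ≠ _}]

/-- Moves an additional cut to the root of a decision tree: cuts commute, and cutting each leaf does
not change the sum. -/
lemma Cl.cut {T S : Set V} {c : K0 k} (h : Cl T S c) (hS : IsAff (k := k) S) {f : V → k}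
    (hf : f ∈ polyFun k V) :
    ∃ c₁ c₂, Cl T (S ∩ {x | f x = 0}) c₁ ∧ Cl T (S ∩ {x | f x ≠ 0}) c₂ ∧ c = c₁ + c₂ := by
  induction h with
  | inside h =>
    exact ⟨_, _, .inside (Set.inter_subset_left.trans h), .inside (Set.inter_subset_left.trans h),
      (hS.cut (regOn_of_mem_polyFun hf _)).2.2⟩
  | outside h =>
    exact ⟨_, _, .outside (h.mono_left Set.inter_subset_left),
      .outside (h.mono_left Set.inter_subset_left), (add_zero 0).symm⟩
  | node hg _ _ h1 h2 =>
    obtain ⟨a1, a2, -⟩ := hS.cut (regOn_of_mem_polyFun hg _)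
    obtain ⟨c₁, c₂, e1, e2, rfl⟩ := h1 a1
    obtain ⟨d₁, d₂, f1, f2, rfl⟩ := h2 a2
    rw [Set.inter_right_comm] at e1 e2 f1 f2
    exact ⟨_, _, .node hg e1 f1, .node hg e2 f2, by abel⟩

lemma Cl.add {T T' S : Set V} {c c' : K0 k} (h : Cl T S c) (h' : Cl T' S c')
    (hS : IsAff (k := k) S) (hd : Disjoint T T') : Cl (T ∪ T') S (c + c') := by
  induction h generalizing c' with
  | @inside S h =>
    have hST : S ∩ T' = ∅ := Set.disjoint_iff_inter_eq_empty.mp (hd.mono_left h)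
    have h0 := h'.eq_affClass_inter (by rw [hST]; exact affClass_empty.1)
    rw [h0, hST, affClass_empty.2, add_zero]
    exact .inside (h.trans Set.subset_union_left)
  | outside h =>
    rw [zero_add]
    exact h'.congr fun x hx => by
      have := Set.disjoint_left.mp h hx
      simp [this]
  | node hf _ _ h1 h2 =>
    obtain ⟨d₁, d₂, e1, e2, rfl⟩ := h'.cut hS hf
    obtain ⟨a1, a2, -⟩ := hS.cut (regOn_of_mem_polyFun hf _)
    rw [add_add_add_comm]
    exact .node hf (h1 e1 a1) (h2 e2 a2)

/-- Well-definedness of the class of a constructible set. By induction on the first tree, the second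
tree is cut along the root of the first (`Cl.cut`); at a leaf of the first tree the remaining set is
affine or empty and `Cl.eq_affClass_inter` applies. -/
lemma Cl.unique {T S : Set V} {c c' : K0 k} (h : Cl T S c) (h' : Cl T S c')
    (hS : IsAff (k := k) S) : c = c' := by
  induction h generalizing c' with
  | inside h =>
    rw [h'.eq_affClass_inter (by rwa [Set.inter_eq_left.mpr h]), Set.inter_eq_left.mpr h]
  | outside h =>
    have hST := Set.disjoint_iff_inter_eq_empty.mp h
    rw [h'.eq_affClass_inter (by rw [hST]; exact affClass_empty.1), hST, affClass_empty.2]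
  | node hf _ _ h1 h2 =>
    obtain ⟨d₁, d₂, e1, e2, rfl⟩ := h'.cut hS hf
    obtain ⟨a1, a2, -⟩ := hS.cut (regOn_of_mem_polyFun hf _)
    rw [h1 e1 a1, h2 e2 a2]

omit [IsAlgClosed k] in
lemma IsCon.exists_cl {T : Set V} (hT : IsCon k T) : ∃ c : K0 k, Cl T Set.univ c := by
  refine Splits.basic_induction (Q := fun S => ∃ c : K0 k, Cl T S c) (hT.splits Set.univ) ?_ ?_
  · exact fun S _ h => h.elim (fun h => ⟨_, .inside h⟩) fun h => ⟨_, .outside h⟩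
  · rintro S f hf - ⟨c, hc⟩ ⟨d, hd⟩
    exact ⟨_, .node hf hc hd⟩

variable (k) in
open Classical in
/-- The class of a constructible set in the Grothendieck ring. -/
def mu (T : Set V) : K0 k := if h : ∃ c : K0 k, Cl T Set.univ c then h.choose else 0

omit [IsAlgClosed k] in
lemma IsCon.cl_mu {T : Set V} (hT : IsCon k T) : Cl T Set.univ (mu k T) := by
  rw [mu, dif_pos hT.exists_cl]
  exact hT.exists_cl.choose_spec

variable [FiniteDimensional k V] [FiniteDimensional k V']

lemma mu_union {T T' : Set V} (hT : IsCon k T) (hT' : IsCon k T') (hd : Disjoint T T') :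
    mu k (T ∪ T') = mu k T + mu k T' :=
  (hT.union hT').cl_mu.unique (hT.cl_mu.add hT'.cl_mu isAff_univ hd) isAff_univ

omit [FiniteDimensional k V] in
lemma mu_eq_affClass {T : Set V} (hT : IsCon k T) (h : IsAff (k := k) T) :
    mu k T = affClass k T := by
  have := hT.cl_mu.eq_affClass_inter (by rwa [Set.univ_inter])
  rwa [Set.univ_inter] at this

omit [FiniteDimensional k V] in
lemma mu_empty : mu k (∅ : Set V) = 0 := by
  have := (IsCon.empty (k := k) (V := V)).cl_mu.eq_affClass_inter
    (by rw [Set.inter_empty]; exact affClass_empty.1)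
  rwa [Set.inter_empty, affClass_empty.2] at this

lemma mu_inter_add_diff {T S : Set V} (hT : IsCon k T) (hS : IsCon k S) :
    mu k T = mu k (T ∩ S) + mu k (T \ S) := by
  rw [← mu_union (hT.inter hS) (hT.diff hS) Set.disjoint_sdiff_inter.symm, Set.inter_union_sdiff]

lemma mu_cut {T : Set V} (hT : IsCon k T) {f : V → k} (hf : DefFun f) :
    mu k T = mu k (T ∩ {x | f x = 0}) + mu k (T ∩ {x | f x ≠ 0}) :=
  mu_inter_add_diff hT (.eq_zero hf)

lemma Basic.isAff {S : Set V} (hS : Basic k S) : IsAff (k := k) S := by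
  induction hS with
  | univ => exact isAff_univ
  | eq_zero hf _ h => exact (h.cut (regOn_of_mem_polyFun hf _)).1
  | ne_zero hf _ h => exact (h.cut (regOn_of_mem_polyFun hf _)).2.1

lemma Basic.mu_eq {S : Set V} (hS : Basic k S) : mu k S = affClass k S :=
  mu_eq_affClass hS.isCon hS.isAff

variable (k) in
/-- Maps which are regular on a subset. -/
def RegMapOn (S : Set V) (φ : V → V') : Prop := ∀ ℓ : Module.Dual k V', RegOn S fun x => ℓ (φ x)

omit [IsAlgClosed k] [FiniteDimensional k V] [FiniteDimensional k V'] in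
lemma RegMapOn.comp_polyFun {S : Set V} {φ : V → V'} (hφ : RegMapOn k S φ) {f : V' → k}
    (hf : f ∈ polyFun k V') : RegOn S fun x => f (φ x) := by
  induction hf using Algebra.adjoin_induction with
  | mem f hf => obtain ⟨ℓ, rfl⟩ := hf; exact hφ ℓ
  | algebraMap c => exact regOn_of_mem_polyFun (const_mem_polyFun c) S
  | add f g _ _ hf hg => exact add_mem hf hg
  | mul f g _ _ hf hg => exact mul_mem hf hg

omit [IsAlgClosed k] [FiniteDimensional k V] [FiniteDimensional k V'] in
lemma RegMapOn.mono {S T : Set V} {φ : V → V'} (hφ : RegMapOn k S φ) (hT : T ⊆ S) :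
    RegMapOn k T φ := fun ℓ => (hφ ℓ).mono hT

omit [IsAlgClosed k] [FiniteDimensional k V] in
lemma DefMap.splits {φ : V → V'} (hφ : DefMap k φ) (S : Set V) :
    Splits k (fun S => RegMapOn k S φ) S := by
  let b := Module.finBasis k V'
  refine (Splits.forall_finite (P := fun i S => RegOn S fun x => b.coord i (φ x))
    (fun i S T hT h => h.mono hT) fun i => (hφ (b.coord i)).splits S).bind fun S' _ h => .leaf ?_
  intro ℓ
  have : (fun x : S' => ℓ (φ x)) = ∑ i, ℓ (b i) • fun x : S' => b.coord i (φ x) := by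
    ext x
    simp only [Finset.sum_apply, Pi.smul_apply, smul_eq_mul]
    conv_lhs => rw [← b.sum_repr (φ x), map_sum]
    simp [mul_comm]
  rw [RegOn, this]
  exact Subalgebra.sum_mem _ fun i _ => Subalgebra.smul_mem _ (h i) _

-- The cuts defining `S'` pull back along `φ` to cuts of `S` by regular functions.
omit [FiniteDimensional k V] [FiniteDimensional k V'] in
lemma Basic.isAff_inter_preimage {S : Set V} (hS : IsAff (k := k) S) {φ : V → V'}
    (hφ : RegMapOn k S φ) {S' : Set V'} (hS' : Basic k S') : IsAff (k := k) (S ∩ φ ⁻¹' S') := by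
  induction hS' with
  | univ => simpa using hS
  | @eq_zero S' f hf _ h =>
    have := (h.cut ((hφ.comp_polyFun hf).mono Set.inter_subset_left)).1
    rwa [Set.inter_assoc] at this
  | @ne_zero S' f hf _ h =>
    have := (h.cut ((hφ.comp_polyFun hf).mono Set.inter_subset_left)).2.1
    rwa [Set.inter_assoc] at this

omit [FiniteDimensional k V] [FiniteDimensional k V'] in
lemma affClass_eq_of_regMapOn {S : Set V} {S' : Set V'} (hS' : IsAff (k := k) S')
    {φ : V → V'} {ψ : V' → V} (hφ : RegMapOn k S φ) (hψ : RegMapOn k S' ψ)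
    (h1 : ∀ x ∈ S, φ x ∈ S' ∧ ψ (φ x) = x) (h2 : ∀ y ∈ S', ψ y ∈ S ∧ φ (ψ y) = y) :
    affClass k S = affClass k S' := by
  have := hS'.finiteType
  rw [hS'.affClass_eq]
  refine (affClass_eq_of_eval (A := regFun k S') (fun s =>
    (Pi.evalAlgHom k (fun _ : S' => k) ⟨φ s, (h1 s s.2).1⟩).comp (regFun k S').val) ?_ ?_ ?_).2
  · intro θ
    obtain ⟨y, hy⟩ := hS'.exists_eval θ
    refine ⟨⟨ψ y, (h2 y y.2).1⟩, AlgHom.ext fun f => ?_⟩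
    rw [hy f]
    have : (⟨φ (ψ y), (h1 _ (h2 y y.2).1).1⟩ : S') = y := Subtype.ext (h2 y y.2).2
    exact congrArg f.1 this
  · rintro ⟨f, a, ha, b, hb, H⟩
    exact ((hφ.comp_polyFun ha).div (hφ.comp_polyFun hb) fun x hx => (H ⟨_, (h1 x hx).1⟩).1).congr
      (g := fun x => a (φ x) / b (φ x)) (fun x hx => rfl) |> fun h => by
        have e : (fun s : S => f ⟨φ s, (h1 s s.2).1⟩) = fun s : S => a (φ s) / b (φ s) := by
          ext s; exact (H ⟨_, (h1 s s.2).1⟩).2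
        change (fun s : S => f ⟨φ s, (h1 s s.2).1⟩) ∈ _
        rw [e]
        exact h
  · intro ℓ
    exact ⟨⟨_, hψ ℓ⟩, fun s => congrArg ℓ (h1 s s.2).2⟩

/-- The class of a constructible set is invariant under constructible bijections. -/
theorem mu_eq_of_bij {T : Set V} {T' : Set V'} (hT : IsCon k T) (hT' : IsCon k T')
    {φ : V → V'} {ψ : V' → V} (hφ : DefMap k φ) (hψ : DefMap k ψ)
    (h1 : ∀ x ∈ T, φ x ∈ T' ∧ ψ (φ x) = x) (h2 : ∀ y ∈ T', ψ y ∈ T ∧ φ (ψ y) = y) :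
    mu k T = mu k T' := by
  -- The source is cut into leaves `S` inside or outside `T` on which `φ` is regular; then, for each
  -- `S` inside `T`, the target is cut into leaves `S'` inside or outside `T'` on which `ψ` is
  -- regular. For leaves inside `T` and `T'`, the maps restrict to inverse regular bijections
  -- between the affine sets `S ∩ φ⁻¹ S'` and `S' ∩ ψ⁻¹ S`.
  have key : mu k (T ∩ Set.univ) = mu k (T' ∩ ψ ⁻¹' Set.univ) := by
    refine Splits.basic_induction (Q := fun S => mu k (T ∩ S) = mu k (T' ∩ ψ ⁻¹' S))
      ((hT.splits Set.univ).and ?_ (fun _ _ hT h => h.mono hT) (hφ.splits Set.univ)) ?_ ?_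
    · exact fun S S' hS h => h.imp hS.trans fun h => h.mono_left hS
    · rintro S hS ⟨hST | hST, hreg⟩
      · have key' : mu k (S ∩ φ ⁻¹' Set.univ) = mu k (T' ∩ ψ ⁻¹' S ∩ Set.univ) := by
          refine Splits.basic_induction
            (Q := fun S' => mu k (S ∩ φ ⁻¹' S') = mu k (T' ∩ ψ ⁻¹' S ∩ S'))
            ((hT'.splits Set.univ).and ?_ (fun _ _ hT h => h.mono hT) (hψ.splits Set.univ)) ?_ ?_
          · exact fun S S' hS h => h.imp hS.trans fun h => h.mono_left hS
          · rintro S' hS' ⟨hST' | hST', hreg'⟩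
            · have e : T' ∩ ψ ⁻¹' S ∩ S' = S' ∩ ψ ⁻¹' S := by
                rw [Set.inter_right_comm, Set.inter_eq_right.mpr hST']
              have a1 := hS'.isAff_inter_preimage hS.isAff hreg
              have a2 := hS.isAff_inter_preimage hS'.isAff hreg'
              rw [e, mu_eq_affClass (hS.isCon.inter (hS'.isCon.preimage hφ)) a1,
                mu_eq_affClass (hS'.isCon.inter (hS.isCon.preimage hψ)) a2]
              refine affClass_eq_of_regMapOn a2 (hreg.mono Set.inter_subset_left)
                (hreg'.mono Set.inter_subset_left) (fun x hx => ?_) fun y hy => ?_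
              · have := (h1 x (hST hx.1)).2
                exact ⟨⟨hx.2, by rw [Set.mem_preimage, this]; exact hx.1⟩, this⟩
              · have := (h2 y (hST' hy.1)).2
                exact ⟨⟨hy.2, by rw [Set.mem_preimage, this]; exact hy.1⟩, this⟩
            · have e1 : S ∩ φ ⁻¹' S' = ∅ := Set.eq_empty_of_forall_notMem fun x hx =>
                Set.disjoint_left.mp hST' hx.2 (h1 x (hST hx.1)).1
              have e2 : T' ∩ ψ ⁻¹' S ∩ S' = ∅ := Set.eq_empty_of_forall_notMem fun x hx =>
                Set.disjoint_left.mp hST' hx.2 hx.1.1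
              rw [e1, e2, mu_empty, mu_empty]
          · intro S' f hf hS' e1 e2
            rw [mu_cut (hS.isCon.inter (hS'.isCon.preimage hφ)) ((DefFun.of_mem_polyFun hf).comp hφ),
              mu_cut ((hT'.inter (hS.isCon.preimage hψ)).inter hS'.isCon)
                (DefFun.of_mem_polyFun hf), Set.inter_assoc, Set.inter_assoc, Set.inter_assoc _ S',
              Set.inter_assoc _ S']
            exact congrArg₂ _ e1 e2
        rw [Set.preimage_univ, Set.inter_univ, Set.inter_univ] at key'
        rw [Set.inter_eq_right.mpr hST, key']
      · have e1 : T ∩ S = ∅ := Set.disjoint_iff_inter_eq_empty.mp hST.symm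
        have e2 : T' ∩ ψ ⁻¹' S = ∅ := Set.eq_empty_of_forall_notMem fun y hy =>
          Set.disjoint_left.mp hST hy.2 (h2 y hy.1).1
        rw [e1, e2, mu_empty, mu_empty]
    · intro S f hf hS e1 e2
      rw [mu_cut (hT.inter hS.isCon) (DefFun.of_mem_polyFun hf),
        mu_cut (hT'.inter (hS.isCon.preimage hψ)) ((DefFun.of_mem_polyFun hf).comp hψ),
        Set.inter_assoc, Set.inter_assoc, Set.inter_assoc, Set.inter_assoc]
      exact congrArg₂ _ e1 e2
  simpa using key

end Measure

/-! ### Products with affine spaces and families of hyperplanes -/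

section Bundles

variable {k : Type u} [Field k] [IsAlgClosed k] {V : Type u} [AddCommGroup V] [Module k V]
  {V' : Type u} [AddCommGroup V'] [Module k V'] {P : Type u} [AddCommGroup P] [Module k P]

/-- The algebra of the product is the polynomial ring over the algebra of `S`: a character of `A[X]`
is a point of `S` together with the value of `X`. -/
lemma affClass_prod_line {S : Set V} (hS : IsAff (k := k) S) :
    IsAff (k := k) (S ×ˢ Set.univ : Set (V × k)) ∧
      affClass k (S ×ˢ Set.univ : Set (V × k)) = lefschetz k * affClass k S := by
  have := hS.finiteType
  let A := regFun k S
  rw [hS.affClass_eq, ← scls_polynomial]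
  have hm (s : (S ×ˢ Set.univ : Set (V × k))) : s.1.1 ∈ S := s.2.1
  let e (s : (S ×ˢ Set.univ : Set (V × k))) : A →ₐ[k] k :=
    (Pi.evalAlgHom k (fun _ : S => k) ⟨s.1.1, hm s⟩).comp A.val
  let ev (s : (S ×ˢ Set.univ : Set (V × k))) : Polynomial A →ₐ[k] k :=
    Polynomial.eval₂AlgHom (e s) s.1.2 fun a => Commute.all _ _
  have hevC (s) (a : A) : ev s (Polynomial.C a) = a.1 ⟨s.1.1, hm s⟩ := Polynomial.eval₂_C _ _
  have hevX (s) : ev s Polynomial.X = s.1.2 := Polynomial.eval₂_X _ _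
  have hC (a : A) : (fun s => ev s (Polynomial.C a)) ∈
      regFun k (S ×ˢ Set.univ : Set (V × k)) := by
    obtain ⟨a, f, hf, h, hh, H⟩ := a
    have hl : RegMapOn k (S ×ˢ Set.univ : Set (V × k)) (fun x : V × k => x.1) := fun ℓ =>
      regOn_of_mem_polyFun (dual_mem_polyFun (ℓ.comp (LinearMap.fst k V k))) _
    have := (hl.comp_polyFun hf).div (hl.comp_polyFun hh) (fun x hx => (H ⟨x.1, hx.1⟩).1)
    have e : (fun s => ev s (Polynomial.C ⟨a, f, hf, h, hh, H⟩)) =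
        fun s : (S ×ˢ Set.univ : Set (V × k)) => f s.1.1 / h s.1.1 := by
      ext s
      rw [hevC]
      exact (H ⟨s.1.1, hm s⟩).2
    rw [e]
    exact this
  have hX : (fun s => ev s Polynomial.X) ∈ regFun k (S ×ˢ Set.univ : Set (V × k)) := by
    simp only [hevX]
    exact restrict_mem_regFun (dual_mem_polyFun (LinearMap.snd k V k)) _
  refine affClass_eq_of_eval ev (fun θ => ?_) (fun p => ?_) fun ℓ => ?_
  · obtain ⟨s, hs⟩ := hS.exists_eval (θ.comp (IsScalarTower.toAlgHom k A (Polynomial A)))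
    refine ⟨⟨(s, θ Polynomial.X), s.2, trivial⟩, ?_⟩
    refine AlgHom.ext fun p => ?_
    induction p using Polynomial.induction_on' with
    | add p q hp hq => rw [map_add, map_add, hp, hq]
    | monomial n a =>
      rw [← Polynomial.C_mul_X_pow_eq_monomial, map_mul, map_mul, map_pow, map_pow, hevC, hevX]
      exact congrArg (· * θ Polynomial.X ^ n) (hs a).symm
  · induction p using Polynomial.induction_on' with
    | add p q hp hq =>
      simp only [map_add]
      exact add_mem hp hq
    | monomial n a =>
      simp only [← Polynomial.C_mul_X_pow_eq_monomial, map_mul, map_pow]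
      exact mul_mem (hC a) (pow_mem hX n)
  · refine ⟨Polynomial.C ⟨_, restrict_mem_regFun
      (dual_mem_polyFun (ℓ.comp (LinearMap.inl k V k))) S⟩ +
      Polynomial.C (algebraMap k A (ℓ (0, 1))) * Polynomial.X, fun s => ?_⟩
    rw [map_add, map_mul, hevC, hevC, hevX]
    change ℓ (s.1.1, 0) + ℓ (0, 1) * s.1.2 = ℓ s.1
    rw [mul_comm, ← smul_eq_mul, ← map_smul, ← map_add]
    simp

variable [FiniteDimensional k V] [FiniteDimensional k V'] [FiniteDimensional k P]

lemma mu_prod_line {T : Set V} (hT : IsCon k T) :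
    mu k (T ×ˢ Set.univ : Set (V × k)) = lefschetz k * mu k T := by
  have key : mu k ((T ∩ Set.univ) ×ˢ Set.univ : Set (V × k)) =
      lefschetz k * mu k (T ∩ Set.univ) := by
    refine Splits.basic_induction
      (Q := fun S => mu k ((T ∩ S) ×ˢ Set.univ : Set (V × k)) = lefschetz k * mu k (T ∩ S))
      (hT.splits Set.univ) ?_ ?_
    · rintro S hS (h | h)
      · obtain ⟨h1, h2⟩ := affClass_prod_line hS.isAff
        rw [Set.inter_eq_right.mpr h, mu_eq_affClass (hS.isCon.prod .univ) h1, h2, hS.mu_eq]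
      · rw [Set.disjoint_iff_inter_eq_empty.mp h.symm, Set.empty_prod, mu_empty, mu_empty, mul_zero]
    · intro S f hf hS h1 h2
      have hf' := DefFun.of_mem_polyFun hf
      rw [mu_cut (hT.inter hS.isCon) hf', mul_add, Set.inter_assoc, Set.inter_assoc, ← h1, ← h2,
        mu_cut ((hT.inter hS.isCon).prod .univ) (hf'.comp .fst)]
      congr 2 <;> ext x <;> simp [and_assoc]
  simpa using key

/-- Affine bundles that are trivial up to a constructible bijection. -/
lemma mu_prod_pi {T : Set V} (hT : IsCon k T) (n : ℕ) :
    mu k (T ×ˢ Set.univ : Set (V × (Fin n → k))) = lefschetz k ^ n * mu k T := by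
  induction n with
  | zero =>
    rw [pow_zero, one_mul]
    refine mu_eq_of_bij (hT.prod .univ) hT (φ := fun x => x.1) (ψ := fun x => (x, 0)) .fst
      (.prodMk .id (.const _)) (fun x hx => ⟨hx.1, Prod.ext rfl (Subsingleton.elim _ _)⟩)
      fun x hx => ⟨⟨hx, trivial⟩, rfl⟩
  | succ n ih =>
    rw [pow_succ', mul_assoc, ← ih, ← mu_prod_line (hT.prod .univ)]
    refine mu_eq_of_bij (hT.prod .univ) ((hT.prod .univ).prod .univ)
      (φ := fun x => ((x.1, Fin.tail x.2), x.2 0)) (ψ := fun x => (x.1.1, Fin.cons x.2 x.1.2))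
      ?_ ?_ (fun x hx => ⟨⟨⟨hx.1, trivial⟩, trivial⟩, ?_⟩) fun x hx => ⟨⟨hx.1.1, trivial⟩, ?_⟩
    · exact .prodMk (.prodMk .fst (.pi fun i => DefMap.snd.apply _))
        (.of_defFun (DefMap.snd.apply _))
    · refine .prodMk (DefMap.fst.comp .fst) (.pi fun i => ?_)
      refine Fin.cases ?_ (fun j => ?_) i
      · exact DefMap.snd.defFun
      · exact (DefMap.snd.comp .fst).apply j
    · simp
    · simp

lemma mu_singleton (x : V) : mu k ({x} : Set V) = 1 := by
  have h := affClass_eq_of_eval (k := k) (A := k) (S := {x}) (fun _ => AlgHom.id k k)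
    (fun φ => ⟨⟨x, rfl⟩, AlgHom.ext fun c => by simpa using (φ.commutes c).symm⟩)
    (fun a => restrict_mem_regFun (const_mem_polyFun a) _)
    (fun ℓ => ⟨ℓ x, fun s => by rw [s.2]; rfl⟩)
  have hc : IsCon k ({x} : Set V) := by
    let b := Module.finBasis k V
    have : IsCon k {y : V | ∀ i, b.coord i y = b.coord i x} :=
      .forall_finite fun i => .eq (.dual _) (.const _)
    convert this using 1
    ext y
    exact ⟨fun h i => by rw [show y = x from h], fun h => b.ext_elem h⟩
  rw [mu_eq_affClass hc h.1, h.2, scls_self]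

omit [IsAlgClosed k] [FiniteDimensional k V] in
/-- A constructible set covered by finitely many principal constructible subsets. -/
lemma IsCon.strat_induction {ι : Type*} [Finite ι] {h : ι → V → k} (hh : ∀ i, DefFun (h i))
    {T₀ : Set V} (hT₀ : IsCon k T₀) (hcov : ∀ x ∈ T₀, ∃ i, h i x ≠ 0) (Q : Set V → Prop)
    (hempty : Q ∅)
    (hunion : ∀ T T', IsCon k T → IsCon k T' → Disjoint T T' → Q T → Q T' → Q (T ∪ T'))
    (hleaf : ∀ i T, IsCon k T → T ⊆ T₀ → (∀ x ∈ T, h i x ≠ 0) → Q T) : Q T₀ := by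
  classical
  cases nonempty_fintype ι
  have : ∀ (s : Finset ι) (T : Set V), IsCon k T → T ⊆ T₀ → (∀ x ∈ T, ∃ i ∈ s, h i x ≠ 0) →
      Q T := by
    intro s
    induction s using Finset.induction_on with
    | empty =>
      intro T _ _ hT
      have : T = ∅ := Set.eq_empty_of_forall_notMem fun x hx => by simpa using hT x hx
      rwa [this]
    | insert a s _ ih =>
      intro T hT hT₀ hc
      have e : T = (T ∩ {x | h a x ≠ 0}) ∪ (T \ {x | h a x ≠ 0}) :=
        (Set.inter_union_sdiff _ _).symm
      have c1 := hT.inter (.ne_zero (hh a))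
      have c2 := hT.diff (.ne_zero (hh a))
      rw [e]
      refine hunion _ _ c1 c2 Set.disjoint_sdiff_inter.symm
        (hleaf a _ c1 (Set.inter_subset_left.trans hT₀) fun x hx => hx.2)
        (ih _ c2 (Set.sdiff_subset.trans hT₀) fun x hx => ?_)
      obtain ⟨i, hi, hi'⟩ := hc x hx.1
      rcases Finset.mem_insert.mp hi with rfl | hi
      · exact (hx.2 hi').elim
      · exact ⟨i, hi, hi'⟩
  exact this Finset.univ T₀ hT₀ subset_rfl fun x hx => by simpa using hcov x hx

/-- A family of hyperplanes in affine space. -/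
lemma mu_hyperplane {S : Set P} (hS : IsCon k S) {n : ℕ} {c : P → Fin (n + 1) → k}
    (hc : DefMap k c) {d : P → k} (hd : DefFun d) (h0 : ∀ p ∈ S, ∃ i, c p i ≠ 0) :
    mu k {x : P × (Fin (n + 1) → k) | x.1 ∈ S ∧ ∑ i, c x.1 i * x.2 i + d x.1 = 0} =
      lefschetz k ^ n * mu k S := by
  have hcon (T : Set P) (hT : IsCon k T) :
      IsCon k {x : P × (Fin (n + 1) → k) | x.1 ∈ T ∧ ∑ i, c x.1 i * x.2 i + d x.1 = 0} :=
    .and (hT.preimage .fst) (.eq_zero (.add (.sum _ fun i _ => .mul ((hc.apply i).comp .fst)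
      (DefMap.snd.apply i)) (hd.comp .fst)))
  refine IsCon.strat_induction (fun i => hc.apply i) hS h0 (fun S =>
    mu k {x : P × (Fin (n + 1) → k) | x.1 ∈ S ∧ ∑ i, c x.1 i * x.2 i + d x.1 = 0} =
      lefschetz k ^ n * mu k S) ?_ ?_ ?_
  · simp [mu_empty]
  · intro T T' hT hT' hTT' h1 h2
    rw [mu_union hT hT' hTT', mul_add, ← h1, ← h2, ← mu_union (hcon T hT) (hcon T' hT')]
    · congr 1
      ext x
      simp [or_and_right]
    · exact Set.disjoint_left.mpr fun x hx hx' => Set.disjoint_left.mp hTT' hx.1 hx'.1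
  · intro i T hT _ hi
    rw [← mu_prod_pi hT n]
    -- Where `c p i ≠ 0`, the equation determines the `i`-th coordinate from the others, which are
    -- free.
    refine mu_eq_of_bij (hcon T hT) (hT.prod .univ) (φ := fun x => (x.1, i.removeNth x.2))
      (ψ := fun x => (x.1, i.insertNth
        (-(∑ j, c x.1 (i.succAbove j) * x.2 j + d x.1) / c x.1 i) x.2)) ?_ ?_ ?_ ?_
    · exact .prodMk .fst (.pi fun j => DefMap.snd.apply _)
    · refine .prodMk .fst (.pi fun j => ?_)
      refine Fin.succAboveCases i ?_ (fun j => ?_) j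
      · simp only [Fin.insertNth_apply_same]
        exact .div (.neg (.add (.sum _ fun j _ => .mul ((hc.apply _).comp .fst)
          (DefMap.snd.apply j)) (hd.comp .fst))) ((hc.apply i).comp .fst)
      · simp only [Fin.insertNth_apply_succAbove]
        exact DefMap.snd.apply j
    · rintro ⟨p, x⟩ ⟨hp, hx⟩
      refine ⟨⟨hp, trivial⟩, Prod.ext rfl ?_⟩
      simp only at hp hx ⊢
      rw [Fin.sum_univ_succAbove _ i] at hx
      rw [Fin.insertNth_eq_iff]
      refine ⟨?_, rfl⟩
      simp only [Fin.removeNth_apply]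
      rw [div_eq_iff (hi p hp)]
      linear_combination -hx
    · rintro ⟨p, x⟩ ⟨hp, -⟩
      refine ⟨⟨hp, ?_⟩, ?_⟩
      · rw [Fin.sum_univ_succAbove _ i]
        simp only [Fin.insertNth_apply_same, Fin.insertNth_apply_succAbove]
        rw [mul_div_cancel₀ _ (hi p hp)]
        ring
      · simp

end Bundles

/-! ### Projective classes -/

section Projective

variable {k : Type u} [Field k] {V : Type u} [AddCommGroup V] [Module k V]
  {V' : Type u} [AddCommGroup V'] [Module k V'] {P : Type u} [AddCommGroup P] [Module k P]

/-- A homogeneous constructible function without zeros outside the origin; the set where it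
takes the value `1` represents the projective space. -/
structure IsNorm (ν : V → k) : Prop where
  defFun : DefFun ν
  map_smul : ∀ (c : k) x, ν (c • x) = c * ν x
  eq_zero : ∀ x, ν x = 0 → x = 0

lemma IsNorm.zero {ν : V → k} (hν : IsNorm ν) : ν 0 = 0 := by
  simpa using hν.map_smul 0 0

-- Looks at the first component as long as it is nonzero. This is the normalization adapted to the
-- linear projection onto `V`: away from the centre of projection it depends only on the image.
open Classical in
lemma IsNorm.prod {ν : V → k} {ν' : V' → k} (hν : IsNorm ν) (hν' : IsNorm ν') :
    IsNorm fun x : V × V' => if x.1 = 0 then ν' x.2 else ν x.1 where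
  defFun := by
    have : IsCon k {x : V × V' | x.1 = 0} := by
      have := (IsCon.eq_zero hν.defFun).preimage (DefMap.fst (k := k) (V := V) (V' := V'))
      convert this using 1
      ext x
      exact ⟨fun h => by rw [Set.mem_preimage, show x.1 = 0 from h]; exact hν.zero,
        fun h => hν.eq_zero _ h⟩
    exact .ite this (hν'.defFun.comp .snd) (hν.defFun.comp .fst)
  map_smul c x := by
    by_cases hc : c = 0
    · simp [hc, hν'.zero]
    · by_cases hx : x.1 = 0 <;> simp [hx, hc, hν.map_smul, hν'.map_smul]
  eq_zero x hx := by
    by_cases h : x.1 = 0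
    · rw [if_pos h] at hx
      exact Prod.ext h (hν'.eq_zero _ hx)
    · rw [if_neg h] at hx
      exact (h (hν.eq_zero _ hx)).elim

open Classical in
/-- The first nonzero coordinate of a vector. -/
def lead {n : ℕ} (x : Fin n → k) : k := ∑ i, if ∀ j < i, x j = 0 then x i else 0

open Classical in
lemma lead_cons {n : ℕ} (a : k) (x : Fin n → k) :
    lead (Fin.cons a x : Fin (n + 1) → k) = if a = 0 then lead x else a := by
  rw [lead, Fin.sum_univ_succ]
  have (i : Fin n) : (∀ j < i.succ, (Fin.cons a x : Fin (n + 1) → k) j = 0) ↔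
      a = 0 ∧ ∀ j < i, x j = 0 := by
    rw [Fin.forall_fin_succ]
    simp
  simp only [this]
  by_cases ha : a = 0 <;> simp [ha, lead]

lemma isNorm_lead (n : ℕ) : IsNorm (lead : (Fin n → k) → k) := by
  classical
  refine ⟨.sum _ fun i _ => .ite ?_ ((DefMap.id (k := k)).apply i) (.const 0), fun c x => ?_, ?_⟩
  · exact .forall_finite fun j => by
      by_cases h : j < i
      · simpa [h] using IsCon.eq_zero ((DefMap.id (k := k)).apply j)
      · simpa [h] using IsCon.univ (k := k) (V := Fin n → k)
  · by_cases hc : c = 0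
    · simp [hc, lead]
    · simp [lead, hc, Finset.mul_sum]
  · induction n with
    | zero => exact fun x _ => Subsingleton.elim _ _
    | succ n ih =>
      intro x hx
      rw [← Fin.cons_self_tail x, lead_cons] at hx
      by_cases h0 : x 0 = 0
      · rw [if_pos h0] at hx
        rw [← Fin.cons_self_tail x, ih _ hx, h0]
        ext i
        exact Fin.cases rfl (fun _ => rfl) i
      · rw [if_neg h0] at hx
        exact (h0 hx).elim

variable [IsAlgClosed k] [FiniteDimensional k V] [FiniteDimensional k V'] [FiniteDimensional k P]

/-- The projectivization of a family of cones is independent of the normalization, and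
invariant under families of homogeneous constructible bijections. -/
lemma mu_cone_eq {ν : V → k} {ν' : V' → k} (hν : IsNorm ν) (hν' : IsNorm ν')
    {S : Set (V × P)} {S' : Set (V' × P)} (hS : IsCon k S) (hS' : IsCon k S')
    (hcone : ∀ (c : k) x p, c ≠ 0 → (x, p) ∈ S → (c • x, p) ∈ S)
    (hcone' : ∀ (c : k) x p, c ≠ 0 → (x, p) ∈ S' → (c • x, p) ∈ S')
    (h0 : ∀ p, ((0 : V), p) ∉ S) (h0' : ∀ p, ((0 : V'), p) ∉ S')
    {φ : V × P → V'} {ψ : V' × P → V} (hφ : DefMap k φ) (hψ : DefMap k ψ)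
    (hφc : ∀ (c : k) x p, φ (c • x, p) = c • φ (x, p))
    (hψc : ∀ (c : k) x p, ψ (c • x, p) = c • ψ (x, p))
    (h1 : ∀ x p, (x, p) ∈ S → (φ (x, p), p) ∈ S' ∧ ψ (φ (x, p), p) = x)
    (h2 : ∀ y p, (y, p) ∈ S' → (ψ (y, p), p) ∈ S ∧ φ (ψ (y, p), p) = y) :
    mu k {x | x ∈ S ∧ ν x.1 = 1} = mu k {x | x ∈ S' ∧ ν' x.1 = 1} := by
  -- One half of the bijection, stated for arbitrary spaces so that it serves both directions. The
  -- rescaled image is mapped back to a multiple of `x`, and normalizing again removes the factor.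
  have aux : ∀ {V V' : Type u} [AddCommGroup V] [Module k V] [AddCommGroup V'] [Module k V']
      {ν : V → k} {ν' : V' → k} (_ : IsNorm ν) (_ : IsNorm ν') {S : Set (V × P)}
      {S' : Set (V' × P)}
      (_ : ∀ (c : k) x p, c ≠ 0 → (x, p) ∈ S' → (c • x, p) ∈ S') (_ : ∀ p, ((0 : V'), p) ∉ S')
      {φ : V × P → V'} {ψ : V' × P → V}
      (_ : ∀ (c : k) x p, ψ (c • x, p) = c • ψ (x, p))
      (_ : ∀ x p, (x, p) ∈ S → (φ (x, p), p) ∈ S' ∧ ψ (φ (x, p), p) = x) (x : V × P)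
      (_ : x ∈ S ∧ ν x.1 = 1),
      (((ν' (φ x))⁻¹ • φ x, x.2) ∈ S' ∧ ν' ((ν' (φ x))⁻¹ • φ x) = 1) ∧
      ((ν (ψ ((ν' (φ x))⁻¹ • φ x, x.2)))⁻¹ • ψ ((ν' (φ x))⁻¹ • φ x, x.2), x.2) = x := by
    intro V V' _ _ _ _ ν ν' hν hν' S S' hcone' h0' φ ψ hψc h1 x hx
    obtain ⟨a1, a2⟩ := h1 x.1 x.2 hx.1
    have hne : ν' (φ x) ≠ 0 := fun h => by
      rw [Prod.mk.eta, hν'.eq_zero _ h] at a1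
      exact h0' _ a1
    refine ⟨⟨hcone' _ _ _ (inv_ne_zero hne) a1, ?_⟩, ?_⟩
    · rw [hν'.map_smul, inv_mul_cancel₀ hne]
    · rw [hψc, show (φ x) = φ (x.1, x.2) from rfl, a2, hν.map_smul, hx.2, smul_smul]
      simp [hne]
  refine mu_eq_of_bij (hS.and (.eq (hν.defFun.comp .fst) (.const 1)))
    (hS'.and (.eq (hν'.defFun.comp .fst) (.const 1)))
    (φ := fun x => ((ν' (φ x))⁻¹ • φ x, x.2)) (ψ := fun x => ((ν (ψ x))⁻¹ • ψ x, x.2)) ?_ ?_ ?_ ?_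
  · exact .prodMk (.smul (hν'.defFun.comp hφ).inv hφ) .snd
  · exact .prodMk (.smul (hν.defFun.comp hψ).inv hψ) .snd
  · exact fun x hx => aux hν hν' hcone' h0' hψc h1 x hx
  · exact fun x hx => aux hν' hν hcone h0 hφc h2 x hx

/-- The class `1 + 𝕃 + ⋯ + 𝕃ⁿ⁻¹` of the projective space of an `n`-dimensional space. -/
def projClass (k : Type u) [Field k] (n : ℕ) : K0 k := ∑ i ∈ Finset.range n, lefschetz k ^ i

/-- Cell decomposition: a normalized vector has first coordinate `0`, with a normalized tail, or
first coordinate `1`, with an arbitrary tail. The second cell contributes `𝕃ⁿ` when passing from `n`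
to `n + 1` coordinates. -/
lemma mu_prod_lead {T : Set P} (hT : IsCon k T) (n : ℕ) :
    mu k {x : P × (Fin n → k) | x.1 ∈ T ∧ lead x.2 = 1} = projClass k n * mu k T := by
  classical
  induction n with
  | zero =>
    have : {x : P × (Fin 0 → k) | x.1 ∈ T ∧ lead x.2 = 1} = ∅ := by
      ext x
      simp [lead]
    rw [this, mu_empty, projClass, Finset.sum_range_zero, zero_mul]
  | succ n ih =>
    have hcon : IsCon k {x : P × (Fin (n + 1) → k) | x.1 ∈ T ∧ lead x.2 = 1} :=
      (hT.preimage .fst).and (.eq ((isNorm_lead _).defFun.comp .snd) (.const 1))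
    have h0 : DefFun fun x : P × (Fin (n + 1) → k) => x.2 0 := DefMap.snd.apply 0
    have hlead (x : Fin (n + 1) → k) : lead x = if x 0 = 0 then lead (Fin.tail x) else x 0 := by
      conv_lhs => rw [← Fin.cons_self_tail x, lead_cons]
    rw [mu_cut hcon h0, projClass, Finset.sum_range_succ, add_mul, ← mu_prod_pi hT n, ← projClass,
      ← ih]
    congr 1
    · refine mu_eq_of_bij (hcon.inter (.eq_zero h0))
        ((hT.preimage .fst).and (.eq ((isNorm_lead _).defFun.comp .snd) (.const 1)))
        (φ := fun x => (x.1, Fin.tail x.2)) (ψ := fun x => (x.1, Fin.cons 0 x.2))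
        (.prodMk .fst (.pi fun i => DefMap.snd.apply _)) (.prodMk .fst (.pi fun i => ?_)) ?_ ?_
      · refine Fin.cases ?_ (fun j => ?_) i
        · exact .const 0
        · exact DefMap.snd.apply j
      · rintro ⟨p, x⟩ ⟨⟨hp, hx⟩, hx0⟩
        simp only [Set.mem_ofPred_eq] at hp hx hx0
        rw [hlead, if_pos hx0] at hx
        refine ⟨⟨hp, hx⟩, Prod.ext rfl ?_⟩
        simp only
        rw [← hx0, Fin.cons_self_tail]
      · rintro ⟨p, x⟩ ⟨hp, hx⟩
        simp only at hp hx
        exact ⟨⟨⟨hp, by simp [lead_cons, hx]⟩, by simp⟩, by simp⟩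
    · refine mu_eq_of_bij (hcon.inter (.ne_zero h0)) (hT.prod .univ)
        (φ := fun x => (x.1, Fin.tail x.2)) (ψ := fun x => (x.1, Fin.cons 1 x.2))
        (.prodMk .fst (.pi fun i => DefMap.snd.apply _)) (.prodMk .fst (.pi fun i => ?_)) ?_ ?_
      · refine Fin.cases ?_ (fun j => ?_) i
        · exact .const 1
        · exact DefMap.snd.apply j
      · rintro ⟨p, x⟩ ⟨⟨hp, hx⟩, hx0⟩
        simp only [Set.mem_ofPred_eq] at hp hx hx0
        rw [hlead, if_neg hx0] at hx
        refine ⟨⟨hp, trivial⟩, Prod.ext rfl ?_⟩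
        simp only
        rw [← hx, Fin.cons_self_tail]
      · rintro ⟨p, x⟩ ⟨hp, -⟩
        exact ⟨⟨⟨hp, by simp [lead_cons]⟩, by simp⟩, by simp⟩

lemma mu_lead (n : ℕ) : mu k {x : Fin n → k | lead x = 1} = projClass k n := by
  have hT : IsCon k ({0} : Set (Fin 0 → k)) := by
    have : ({0} : Set (Fin 0 → k)) = Set.univ :=
      Set.eq_univ_of_forall fun x => Subsingleton.elim _ _
    rw [this]
    exact .univ
  have h := mu_prod_lead hT n
  rw [mu_singleton, mul_one] at h
  rw [← h]
  exact mu_eq_of_bij (.eq (isNorm_lead n).defFun (.const 1))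
    ((hT.preimage .fst).and (.eq ((isNorm_lead n).defFun.comp .snd) (.const 1)))
    (φ := fun x => (0, x)) (ψ := fun x => x.2) (.prodMk (.const 0) .id) .snd
    (fun x hx => ⟨⟨rfl, hx⟩, rfl⟩) fun x hx => ⟨hx.2, Prod.ext (Subsingleton.elim _ _) rfl⟩

end Projective

/-! ### Varieties covered by affine charts -/

section Charts

variable {k : Type u} [Field k]

/-- The part of the `i`-th chart not covered by earlier charts is closed in that chart, with
underlying set that of `Spec (C i)`. Adding the charts one at a time, `vcls_sup` shows that each
contributes exactly this part. -/
lemma vcls_eq_sum_charts {X : Scheme.{u}} (f : X ⟶ Spec (CommRingCat.of k)) [IsVar f] {n : ℕ}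
    {B C : Fin n → Type u} [∀ i, CommRing (B i)] [∀ i, Algebra k (B i)]
    [∀ i, CommRing (C i)] [∀ i, Algebra k (C i)] [∀ i, Algebra.FiniteType k (C i)]
    (ι : ∀ i, Spec (CommRingCat.of (B i)) ⟶ X) [∀ i, IsOpenImmersion (ι i)]
    (w : ∀ i, ι i ≫ f = specHom k (B i)) (hcov : ∀ x, ∃ i, x ∈ Set.range (ι i))
    (σ : ∀ i, B i →ₐ[k] C i) (hσ : ∀ i, Function.Surjective (σ i))
    (hker : ∀ i, (PrimeSpectrum.zeroLocus (RingHom.ker (σ i) : Set (B i)) :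
      Set (Spec (CommRingCat.of (B i)))) = {y | ∀ j < i, ι i y ∉ Set.range (ι j)}) :
    vcls f = ∑ i, scls k (C i) := by
  classical
  let W (m : ℕ) : X.Opens := ⨆ i : {i : Fin n // (i : ℕ) < m}, (ι i.1).opensRange
  have hW (m : ℕ) (x : X) : x ∈ W m ↔ ∃ i : Fin n, (i : ℕ) < m ∧ x ∈ Set.range (ι i) := by
    simp only [W, TopologicalSpace.Opens.mem_iSup]
    exact ⟨fun ⟨i, hi⟩ => ⟨i.1, i.2, hi⟩, fun ⟨i, hi, h⟩ => ⟨⟨i, hi⟩, h⟩⟩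
  have key (m : ℕ) (hm : m ≤ n) : vcls ((W m).ι ≫ f) =
      ∑ i ∈ Finset.univ.filter (fun i : Fin n => (i : ℕ) < m), scls k (C i) := by
    induction m with
    | zero =>
      have : IsEmpty (W 0).toScheme := ⟨fun x => by simpa using (hW 0 x.1).mp x.2⟩
      rw [vcls_of_isEmpty]
      simp
    | succ m ih =>
      let i : Fin n := ⟨m, hm⟩
      have : Fact (Function.Surjective (σ i)) := ⟨hσ i⟩
      have h := vcls_sup f (ι i) (W m).ι (W (m + 1)).ι (by
        simp only [Scheme.Opens.range_ι]
        ext x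
        simp only [Set.mem_union, SetLike.mem_coe, hW]
        constructor
        · rintro ⟨j, hj, hx⟩
          rcases Nat.lt_succ_iff_lt_or_eq.mp hj with hj | hj
          · exact .inr ⟨j, hj, hx⟩
          · have : j = i := Fin.ext hj
            exact .inl (this ▸ hx)
        · rintro (hx | ⟨j, hj, hx⟩)
          · exact ⟨i, Nat.lt_succ_self m, hx⟩
          · exact ⟨j, hj.trans (Nat.lt_succ_self m), hx⟩)
        (specMap (σ i)) (by
          rw [range_specMap_of_surjective _ (hσ i), hker i]
          ext y
          simp only [Set.mem_compl_iff, Set.mem_preimage, Scheme.Opens.range_ι, SetLike.mem_coe, hW,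
            Set.mem_ofPred_eq, not_exists, not_and]
          rfl)
      have e : Finset.univ.filter (fun j : Fin n => (j : ℕ) < m + 1) =
          insert i (Finset.univ.filter (fun j : Fin n => (j : ℕ) < m)) := by
        ext j
        simp only [Finset.mem_filter, Finset.mem_univ, true_and, Finset.mem_insert]
        rw [Nat.lt_succ_iff_lt_or_eq, or_comm, Fin.ext_iff]
      have hw : specMap (σ i) ≫ ι i ≫ f = specHom k (C i) := by
        rw [w i, specMap_comp_specHom]
      rw [h, e, Finset.sum_insert (by simp [i]), ih (by omega), vcls_congr _ hw, add_comm]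
      rfl
  have hn := key n le_rfl
  have htop : W n = ⊤ := by
    ext x
    simp only [SetLike.mem_coe, hW, TopologicalSpace.Opens.coe_top, Set.mem_univ, iff_true]
    obtain ⟨i, hi⟩ := hcov x
    exact ⟨i, i.2, hi⟩
  have : IsIso (W n).ι := by
    rw [htop, ← Scheme.topIso_hom]
    infer_instance
  rw [← vcls_eq_of_isIso ((W n).ι ≫ f) f (W n).ι rfl, hn]
  refine Finset.sum_congr (Finset.filter_true_of_mem fun i _ => i.2) fun _ _ => rfl

end Charts

/-! ### Classes of quotients of polynomial rings -/

section PolynomialQuotient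

variable {k : Type u} [Field k] {N : ℕ}

lemma eval_mem_polyFun (p : MvPolynomial (Fin N) k) :
    (fun v : Fin N → k => MvPolynomial.eval v p) ∈ polyFun k (Fin N → k) := by
  induction p using MvPolynomial.induction_on with
  | C a => simpa using const_mem_polyFun a
  | add p q hp hq =>
    simp only [map_add]
    exact add_mem hp hq
  | mul_X p i hp =>
    simp only [map_mul, MvPolynomial.eval_X]
    exact mul_mem hp (dual_mem_polyFun (LinearMap.proj i : Module.Dual k (Fin N → k)))

lemma DefFun.eval {V : Type u} [AddCommGroup V] [Module k V] (p : MvPolynomial (Fin N) k)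
    {φ : V → Fin N → k} (hφ : DefMap k φ) : DefFun fun x => MvPolynomial.eval (φ x) p :=
  (DefFun.of_mem_polyFun (eval_mem_polyFun p)).comp hφ

/-- A character of `C` is determined by the images of the variables, and a vector arises in this way
exactly when it is a zero of the kernel of `τ`. -/
lemma scls_eq_mu [IsAlgClosed k] {C : Type u} [CommRing C] [Algebra k C] [Algebra.FiniteType k C]
    (τ : MvPolynomial (Fin N) k →ₐ[k] C) (hτ : Function.Surjective τ) {S : Set (Fin N → k)}
    (hS : IsCon k S) (hmem : ∀ v, v ∈ S ↔ ∀ p, τ p = 0 → MvPolynomial.eval v p = 0) :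
    scls k C = mu k S := by
  let ev (s : S) : C →ₐ[k] k := AlgHom.liftOfSurjective τ hτ (MvPolynomial.aeval s.1) (by
    intro p hp
    have := (hmem s).mp s.2 p hp
    exact (RingHom.congr_fun (MvPolynomial.coe_aeval_eq_eval _) p).trans this)
  have hev (s : S) (p) : ev s (τ p) = MvPolynomial.eval s.1 p := by
    refine (AlgHom.liftOfSurjective_apply ..).trans ?_
    exact RingHom.congr_fun (MvPolynomial.coe_aeval_eq_eval _) p
  suffices h : IsAff (k := k) S ∧ affClass k S = scls k C by
    rw [mu_eq_affClass hS h.1, h.2]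
  refine affClass_eq_of_eval ev (fun θ => ?_) (fun a => ?_) fun ℓ => ?_
  · have hθ (p) : θ (τ p) = MvPolynomial.eval (fun j => θ (τ (MvPolynomial.X j))) p := by
      have : θ.comp τ = MvPolynomial.aeval fun j => θ (τ (MvPolynomial.X j)) :=
        MvPolynomial.algHom_ext fun j => by simp
      exact (AlgHom.congr_fun this p).trans
        (RingHom.congr_fun (MvPolynomial.coe_aeval_eq_eval _) p)
    refine ⟨⟨fun j => θ (τ (MvPolynomial.X j)), (hmem _).mpr fun p hp => ?_⟩, ?_⟩
    · rw [← hθ, hp, map_zero]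
    · refine AlgHom.ext fun a => ?_
      obtain ⟨p, rfl⟩ := hτ a
      rw [hev, hθ]
  · obtain ⟨p, rfl⟩ := hτ a
    simp only [hev]
    exact restrict_mem_regFun (eval_mem_polyFun p) S
  · refine ⟨τ (∑ i, MvPolynomial.C (ℓ fun j => if i = j then 1 else 0) * MvPolynomial.X i),
      fun s => ?_⟩
    rw [hev]
    conv_rhs => rw [pi_eq_sum_univ s.1, map_sum]
    simp [mul_comm]

/-- Weighted homogeneity as a scaling rule. It is applied with `u` the inverse of a coordinate, to
compare homogeneous with affine coordinates. -/
lemma aeval_eq_mul_pow {S : Type u} [CommRing S] [Algebra k S] {w : Fin N → ℕ} {u : S}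
    (φ ψ : MvPolynomial (Fin N) k →ₐ[k] S)
    (h : ∀ j, φ (MvPolynomial.X j) = ψ (MvPolynomial.X j) * u ^ w j) {n : ℕ}
    {p : MvPolynomial (Fin N) k} (hp : MvPolynomial.IsWeightedHomogeneous w p n) :
    φ p = ψ p * u ^ n := by
  rw [p.as_sum]
  simp only [map_sum, Finset.sum_mul]
  refine Finset.sum_congr rfl fun m hm => ?_
  have hw : Finsupp.weight w m = n := hp (MvPolynomial.mem_support_iff.mp hm)
  rw [MvPolynomial.monomial_eq, Finsupp.prod]
  simp only [map_mul, map_prod, map_pow, h]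
  rw [← hw, Finsupp.weight_apply, Finsupp.sum]
  simp only [mul_pow, Finset.prod_mul_distrib, ← pow_mul]
  rw [Finset.prod_pow_eq_pow_sum, ← MvPolynomial.algebraMap_eq, AlgHom.commutes, AlgHom.commutes,
    mul_assoc]
  simp only [smul_eq_mul, mul_comm]

end PolynomialQuotient

/-! ### The class of a `Proj` -/

section Proj

open HomogeneousLocalization

variable {k : Type u} [Field k] {A : Type u} [CommRing A] [Algebra k A]
  (𝒜 : ℕ → Submodule k A) [GradedAlgebra 𝒜]

/-- The degree zero part of a localization as an algebra over the base field. -/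
instance awayAlgebra (f : A) : Algebra k (Away 𝒜 f) where
  algebraMap := (fromZeroRingHom 𝒜 (Submonoid.powers f)).comp (algebraMap k (𝒜 0))
  commutes' _ _ := mul_comm _ _
  smul_def' c x := by
    apply val_injective
    rw [val_smul, val_mul]
    change c • x.val = algebraMap A _ (algebraMap k A c) * x.val
    rw [← IsScalarTower.algebraMap_apply, Algebra.smul_def]

lemma awayι_comp_projHom (f : A) {m : ℕ} (hf : f ∈ 𝒜 m) (hm : 0 < m) :
    Proj.awayι 𝒜 f hf hm ≫ projHom 𝒜 = specHom k (Away 𝒜 f) := by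
  rw [projHom, Proj.awayι_toSpecZero_assoc, ← Spec.map_comp, ← CommRingCat.ofHom_comp]

/-- The inclusion of the degree zero part of a localization, as a homomorphism of algebras. -/
def awayVal (f : A) : Away 𝒜 f →ₐ[k] Localization.Away f where
  toFun := val
  map_one' := val_one
  map_mul' := val_mul
  map_zero' := val_zero
  map_add' := val_add
  commutes' c := by
    change algebraMap A _ (algebraMap k A c) = _
    rw [← IsScalarTower.algebraMap_apply]

variable {𝒜} {N : ℕ} {w : Fin N → ℕ} (π : MvPolynomial (Fin N) k →ₐ[k] A)
  (hdeg : ∀ n p, MvPolynomial.IsWeightedHomogeneous w p n → π p ∈ 𝒜 n)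

omit [GradedAlgebra 𝒜] in
include hdeg in
lemma X_mem (j : Fin N) : π (MvPolynomial.X j) ∈ 𝒜 (w j • 1) := by
  simpa using hdeg _ _ (MvPolynomial.isWeightedHomogeneous_X k w j)

/-- The coordinates on a standard chart. -/
def chartMap {i : Fin N} (hi : π (MvPolynomial.X i) ∈ 𝒜 1) :
    MvPolynomial (Fin N) k →ₐ[k] Away 𝒜 (π (MvPolynomial.X i)) :=
  MvPolynomial.aeval fun j => Away.mk 𝒜 hi (w j) (π (MvPolynomial.X j)) (X_mem π hdeg j)

/-- Dehomogenization. Inside the localization at `x`, the image of `X i`, the `j`-th affine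
coordinate is the `j`-th homogeneous one times `(1/x)^(w j)`, so `aeval_eq_mul_pow` applies with `u
= 1/x`. -/
lemma chartMap_of_isWeightedHomogeneous {i : Fin N} (hi : π (MvPolynomial.X i) ∈ 𝒜 1)
    {n : ℕ} {p : MvPolynomial (Fin N) k} (hp : MvPolynomial.IsWeightedHomogeneous w p n) :
    chartMap π hdeg hi p = Away.mk 𝒜 hi n (π p) (by simpa using hdeg _ _ hp) := by
  apply val_injective
  rw [Away.val_mk]
  change awayVal 𝒜 _ (chartMap π hdeg hi p) = _
  have hX (j) : awayVal 𝒜 _ (chartMap π hdeg hi (MvPolynomial.X j)) =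
      Localization.mk (π (MvPolynomial.X j)) 
        (⟨π (MvPolynomial.X i) ^ w j, w j, rfl⟩ : Submonoid.powers (π (MvPolynomial.X i))) := by
    rw [chartMap, MvPolynomial.aeval_X]
    exact Away.val_mk 𝒜 (w j) hi _ _
  let x : A := π (MvPolynomial.X i)
  let u : Localization.Away x := Localization.mk 1 ⟨x, 1, pow_one _⟩
  have hmk (a : A) (m : ℕ) : (Localization.mk a ⟨x ^ m, m, rfl⟩ : Localization.Away x) =
      algebraMap A _ a * u ^ m := by
    simp only [u]
    rw [Localization.mk_pow, ← Localization.mk_one_eq_algebraMap, Localization.mk_mul]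
    congr 1
    · simp
    · exact Subtype.ext (by simp)
  replace hX (j) := (hX j).trans (hmk _ _)
  change _ = Localization.mk (π p) ⟨x ^ n, _⟩
  rw [hmk]
  exact aeval_eq_mul_pow (S := Localization.Away x)
    ((awayVal 𝒜 _).comp (chartMap π hdeg hi))
    ((Algebra.ofId A (Localization.Away x)).restrictScalars k |>.comp π) hX hp

-- The kernel of a graded homomorphism is homogeneous; this lets `chartMap` factor through `π`.
include hdeg in
lemma map_component_eq_zero {p : MvPolynomial (Fin N) k} (hp : π p = 0) (n : ℕ) :
    π (MvPolynomial.weightedHomogeneousComponent w n p) = 0 := by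
  have h : (DirectSum.decompose 𝒜 (π p) n : A) =
      π (MvPolynomial.weightedHomogeneousComponent w n p) := by
    have hfin := MvPolynomial.weightedHomogeneousComponent_finsupp (w := w) p
    have hsum : p = ∑ m ∈ hfin.toFinset, MvPolynomial.weightedHomogeneousComponent w m p := by
      conv_lhs => rw [← MvPolynomial.sum_weightedHomogeneousComponent w p]
      exact finsum_eq_sum _ hfin
    conv_lhs => rw [hsum, map_sum, DirectSum.decompose_sum]
    rw [DFinsupp.finsetSum_apply, AddSubmonoidClass.coe_finsetSum]
    have hm (m) : π (MvPolynomial.weightedHomogeneousComponent w m p) ∈ 𝒜 m :=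
      hdeg _ _ (MvPolynomial.weightedHomogeneousComponent_isWeightedHomogeneous _ _)
    rw [Finset.sum_eq_single n]
    · rw [DirectSum.decompose_of_mem_same _ (hm n)]
    · intro m _ hmn
      rw [DirectSum.decompose_of_mem_ne _ (hm m) hmn]
    · intro hn
      have : MvPolynomial.weightedHomogeneousComponent w n p = 0 := by
        by_contra h
        exact hn (hfin.mem_toFinset.mpr h)
      rw [this]
      simp
  rw [← h, hp]
  simp

lemma chartMap_eq_zero_of_map_eq_zero {i : Fin N} (hi : π (MvPolynomial.X i) ∈ 𝒜 1)
    {p : MvPolynomial (Fin N) k} (hp : π p = 0) : chartMap π hdeg hi p = 0 := by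
  have hfin := MvPolynomial.weightedHomogeneousComponent_finsupp (w := w) p
  have hsum : p = ∑ m ∈ hfin.toFinset, MvPolynomial.weightedHomogeneousComponent w m p := by
    conv_lhs => rw [← MvPolynomial.sum_weightedHomogeneousComponent w p]
    exact finsum_eq_sum _ hfin
  rw [hsum, map_sum]
  refine Finset.sum_eq_zero fun m _ => ?_
  rw [chartMap_of_isWeightedHomogeneous π hdeg hi
    (MvPolynomial.weightedHomogeneousComponent_isWeightedHomogeneous _ _)]
  apply val_injective
  rw [Away.val_mk, map_component_eq_zero π hdeg hp, val_zero, Localization.mk_zero]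

/-- The points of a standard chart, with values in an arbitrary algebra. -/
lemma chartMap_eval {R : Type u} [CommRing R] [Algebra k R] {i : Fin N}
    (hi : π (MvPolynomial.X i) ∈ 𝒜 1) {v : Fin N → R} (hv : v i = 1)
    (hπ : Function.Surjective π) (hvan : ∀ p, π p = 0 → MvPolynomial.aeval v p = 0) :
    ∃ θ : Away 𝒜 (π (MvPolynomial.X i)) →ₐ[k] R,
      ∀ p, θ (chartMap π hdeg hi p) = MvPolynomial.aeval v p := by
  let e : A →ₐ[k] R := AlgHom.liftOfSurjective π hπ (MvPolynomial.aeval v) hvan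
  have he (p) : e (π p) = MvPolynomial.aeval v p := AlgHom.liftOfSurjective_apply ..
  have hu : ∀ y : Submonoid.powers (π (MvPolynomial.X i)), IsUnit (e y) := by
    rintro ⟨_, n, rfl⟩
    simp [he, hv]
  let θ' : Localization.Away (π (MvPolynomial.X i)) →ₐ[k] R :=
    IsLocalization.liftAlgHom (M := Submonoid.powers (π (MvPolynomial.X i))) (f := e) hu
  refine ⟨θ'.comp (awayVal 𝒜 _), fun p => ?_⟩
  suffices h : (θ'.comp (awayVal 𝒜 _)).comp (chartMap π hdeg hi) = MvPolynomial.aeval v from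
    AlgHom.congr_fun h p
  refine MvPolynomial.algHom_ext fun j => ?_
  simp only [AlgHom.comp_apply, MvPolynomial.aeval_X]
  have hX : awayVal 𝒜 _ (chartMap π hdeg hi (MvPolynomial.X j)) =
      Localization.mk (π (MvPolynomial.X j))
        (⟨π (MvPolynomial.X i) ^ w j, w j, rfl⟩ : Submonoid.powers (π (MvPolynomial.X i))) := by
    rw [chartMap, MvPolynomial.aeval_X]
    exact Away.val_mk 𝒜 (w j) hi _ _
  rw [hX, Localization.mk_eq_mk']
  refine (IsLocalization.lift_mk'_spec (g := e.toRingHom) (hg := hu) _ _ _).mpr ?_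
  change e (π (MvPolynomial.X j)) = e (π (MvPolynomial.X i) ^ w j) * v j
  simp [he, hv]

variable (hsurj : ∀ n, ∀ a ∈ 𝒜 n, ∃ p, MvPolynomial.IsWeightedHomogeneous w p n ∧ π p = a)

include hsurj in
lemma chartMap_surjective {i : Fin N} (hi : π (MvPolynomial.X i) ∈ 𝒜 1) :
    Function.Surjective (chartMap π hdeg hi) := by
  intro a
  obtain ⟨n, a, ha, rfl⟩ := Away.mk_surjective 𝒜 hi a
  obtain ⟨p, hp, rfl⟩ := hsurj n a (by simpa using ha)
  exact ⟨p, chartMap_of_isWeightedHomogeneous π hdeg hi hp⟩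

-- The `i`-th stratum is the part of the standard chart of `X (c i)` outside the earlier charts,
-- that is, the zero set of the functions `x (c j) / x (c i)` with `j < i`. Only coordinates of
-- weight one are used as charts, because there every point has a unique representative with that
-- coordinate `1`; in `ℙ(1, 1, g + 1)` this leaves out `y`.
include hdeg hsurj in
theorem cls_projVariety_eq_sum [IsAlgClosed k]
    (h0 : Function.Surjective (algebraMap k (𝒜 0))) [Algebra.FiniteType k A]
    (hπ : Function.Surjective π) {m : ℕ} (c : Fin m → Fin N) (hc : ∀ i, w (c i) = 1)
    (hcov : ⨆ i, Proj.basicOpen 𝒜 (π (MvPolynomial.X (c i))) = ⊤) {Z : Set (Fin N → k)}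
    (hZ : IsCon k Z) (hmem : ∀ v, v ∈ Z ↔ ∀ p, π p = 0 → MvPolynomial.eval v p = 0) :
    cls (projVariety 𝒜 h0) =
      ∑ i, mu k {v | v ∈ Z ∧ v (c i) = 1 ∧ ∀ j < i, v (c j) = 0} := by
  have hi (i : Fin m) : π (MvPolynomial.X (c i)) ∈ 𝒜 1 := by
    simpa [hc] using X_mem π hdeg (c i)
  let B (i : Fin m) := Away 𝒜 (π (MvPolynomial.X (c i)))
  let J (i : Fin m) : Ideal (B i) :=
    Ideal.span {b | ∃ j < i, b = chartMap π hdeg (hi i) (MvPolynomial.X (c j))}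
  have hft (i : Fin m) : Algebra.FiniteType k (B i) :=
    .of_surjective _ (chartMap_surjective π hdeg hsurj (hi i))
  have hvar : IsVar (projHom 𝒜) := inferInstanceAs (IsVar (projVariety 𝒜 h0).obj.hom)
  have hsum : cls (projVariety 𝒜 h0) = ∑ i, scls k (B i ⧸ J i) := by
    refine vcls_eq_sum_charts (projHom 𝒜) (B := B) (C := fun i => B i ⧸ J i)
      (fun i => Proj.awayι 𝒜 _ (hi i) one_pos) (fun i => awayι_comp_projHom 𝒜 _ (hi i) one_pos)
      (fun x => ?_) (fun i => Ideal.Quotient.mkₐ k (J i))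
      (fun i => Ideal.Quotient.mkₐ_surjective k _) fun i => ?_
    · have hx : x ∈ ⨆ i, Proj.basicOpen 𝒜 (π (MvPolynomial.X (c i))) := hcov ▸ trivial
      obtain ⟨i, hxi⟩ := TopologicalSpace.Opens.mem_iSup.mp hx
      refine ⟨i, ?_⟩
      rw [← Proj.opensRange_awayι 𝒜 _ (hi i) one_pos] at hxi
      exact hxi
    · have hJ : RingHom.ker (Ideal.Quotient.mkₐ k (J i)) = J i := Ideal.Quotient.mkₐ_ker k _
      ext y
      have hy (j : Fin m) : Proj.awayι 𝒜 _ (hi i) one_pos y ∈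
          Set.range (Proj.awayι 𝒜 _ (hi j) one_pos) ↔
          chartMap π hdeg (hi i) (MvPolynomial.X (c j)) ∉ y.asIdeal := by
        have h1 := Proj.awayι_preimage_basicOpen 𝒜 (hi i) one_pos (hi j) one_pos
        have h2 : Proj.awayι 𝒜 _ (hi i) one_pos y ∈ Set.range (Proj.awayι 𝒜 _ (hi j) one_pos) ↔
            y ∈ Proj.awayι 𝒜 _ (hi i) one_pos ⁻¹ᵁ
              Proj.basicOpen 𝒜 (π (MvPolynomial.X (c j))) := by
          rw [← Proj.opensRange_awayι 𝒜 _ (hi j) one_pos]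
          rfl
        have h3 : chartMap π hdeg (hi i) (MvPolynomial.X (c j)) =
            Away.isLocalizationElem (hi i) (hi j) := by
          rw [chartMap, MvPolynomial.aeval_X]
          apply val_injective
          rw [Away.isLocalizationElem, Away.val_mk, Away.val_mk]
          simp [hc]
        rw [h2, h1, h3]
        rfl
      rw [hJ]
      change (J i : Set (B i)) ⊆ y.asIdeal ↔ ∀ j < i, Proj.awayι 𝒜 _ (hi i) one_pos y ∉
          Set.range (Proj.awayι 𝒜 _ (hi j) one_pos)
      simp only [hy, not_not]
      rw [SetLike.coe_subset_coe, Ideal.span_le]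
      constructor
      · exact fun h j hj => h ⟨j, hj, rfl⟩
      · rintro h _ ⟨j, hj, rfl⟩
        exact h j hj
  rw [hsum]
  refine Finset.sum_congr rfl fun i _ => ?_
  refine scls_eq_mu ((Ideal.Quotient.mkₐ k (J i)).comp (chartMap π hdeg (hi i)))
    ((Ideal.Quotient.mkₐ_surjective k _).comp (chartMap_surjective π hdeg hsurj (hi i))) ?_ ?_
  · refine hZ.and (.and (.eq (DefMap.id.apply _) (.const 1)) (.forall_finite fun j => ?_))
    by_cases h : j < i
    · simpa [h] using IsCon.eq_zero ((DefMap.id (k := k)).apply (c j))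
    · simpa [h] using IsCon.univ (k := k) (V := Fin N → k)
  · intro v
    have hJ (p) : ((Ideal.Quotient.mkₐ k (J i)).comp (chartMap π hdeg (hi i))) p = 0 ↔
        chartMap π hdeg (hi i) p ∈ J i := Ideal.Quotient.eq_zero_iff_mem
    simp only [hJ]
    constructor
    · rintro ⟨hv, hvi, hvj⟩ p hp
      have haev (p) : MvPolynomial.aeval v p = MvPolynomial.eval v p :=
        RingHom.congr_fun (MvPolynomial.coe_aeval_eq_eval _) p
      obtain ⟨θ, hθ⟩ := chartMap_eval π hdeg (hi i) hvi hπ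
        fun p hp => (haev p).trans ((hmem v).mp hv p hp)
      have hle : J i ≤ RingHom.ker θ := by
        refine Ideal.span_le.mpr ?_
        rintro _ ⟨j, hj, rfl⟩
        change θ _ = 0
        rw [hθ, MvPolynomial.aeval_X, hvj j hj]
      rw [← haev, ← hθ]
      exact hle hp
    · intro h
      refine ⟨(hmem v).mpr fun p hp => h p ?_, ?_, fun j hj => ?_⟩
      · rw [chartMap_eq_zero_of_map_eq_zero π hdeg (hi i) hp]
        exact zero_mem _
      -- Dehomogenizing at `X (c i)` sends this variable to `1`, so the difference vanishes on the
      -- chart.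
      · have := h (MvPolynomial.X (c i) - 1) (by
          have h1 : chartMap π hdeg (hi i) (MvPolynomial.X (c i)) = 1 := by
            rw [chartMap, MvPolynomial.aeval_X]
            apply val_injective
            rw [Away.val_mk, val_one]
            simp [hc]
          rw [map_sub, h1, map_one, sub_self]
          exact zero_mem _)
        simpa [sub_eq_zero] using this
      · simpa using h (MvPolynomial.X (c j)) (Ideal.subset_span ⟨j, hj, rfl⟩)

end Proj

/-! ### Classes of finite disjoint unions -/

section FiniteUnion

variable {k : Type u} [Field k] {V : Type u} [AddCommGroup V] [Module k V]

variable [IsAlgClosed k] [FiniteDimensional k V]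

lemma mu_exists_finite {ι : Type*} [Fintype ι] {P : ι → V → Prop}
    (h : ∀ i, IsCon k {x | P i x}) (hd : ∀ i j x, P i x → P j x → i = j) :
    mu k {x | ∃ i, P i x} = ∑ i, mu k {x | P i x} := by
  classical
  have key (s : Finset ι) : IsCon k {x | ∃ i ∈ s, P i x} ∧
      mu k {x | ∃ i ∈ s, P i x} = ∑ i ∈ s, mu k {x | P i x} := by
    induction s using Finset.induction_on with
    | empty =>
      have : {x | ∃ i ∈ (∅ : Finset ι), P i x} = ∅ := by ext x; simp
      rw [this]
      exact ⟨.empty, by simp [mu_empty]⟩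
    | insert i s hi ih =>
      have : {x | ∃ j ∈ insert i s, P j x} = {x | P i x} ∪ {x | ∃ j ∈ s, P j x} := by
        ext x; simp
      rw [this]
      refine ⟨(h i).union ih.1, ?_⟩
      rw [mu_union (h i) ih.1, Finset.sum_insert hi, ih.2]
      refine Set.disjoint_left.mpr ?_
      rintro x hx ⟨j, hj, hx'⟩
      exact hi (hd i j x hx hx' ▸ hj)
  simpa using (key Finset.univ).2

end FiniteUnion

/-! ### Vectors with leading coordinate one -/

section Lead

variable {k : Type u} [Field k]

lemma lead_eq_of_forall_lt {n : ℕ} {x : Fin n → k} {i : Fin n} (hi : x i ≠ 0)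
    (h : ∀ j < i, x j = 0) : lead x = x i := by
  rw [lead, Finset.sum_eq_single i, if_pos h]
  · intro j _ hj
    rcases lt_or_gt_of_ne hj with hj | hj
    · rw [h j hj, ite_self]
    · exact if_neg fun h' => hi (h' i hj)
  · simp

lemma lead_eq_one_iff {n : ℕ} {x : Fin n → k} :
    lead x = 1 ↔ ∃ i, x i = 1 ∧ ∀ j < i, x j = 0 := by
  constructor
  · intro h
    have hne : ∃ i, x i ≠ 0 := by
      by_contra! h0
      rw [show x = 0 from funext h0, (isNorm_lead n).zero] at h
      exact zero_ne_one h
    obtain ⟨i, hmem, hlt⟩ := (wellFounded_lt (α := Fin n)).has_min {i | x i ≠ 0} hne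
    have h0 : ∀ j < i, x j = 0 := fun j hj => by
      by_contra hjx
      exact hlt j hjx hj
    exact ⟨i, (lead_eq_of_forall_lt hmem h0).symm.trans h, h0⟩
  · rintro ⟨i, hi, h⟩
    rw [lead_eq_of_forall_lt (hi ▸ one_ne_zero) h, hi]

end Lead

/-! ### The class of a `Proj` as the class of its normalized vectors -/

section Proj

variable {k : Type u} [Field k] {A : Type u} [CommRing A] [Algebra k A]
  {𝒜 : ℕ → Submodule k A} [GradedAlgebra 𝒜]

/-- A point outside all the chosen charts would be a homogeneous prime containing every variable,
while the charts of all variables cover `Proj`. -/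
lemma iSup_basicOpen_eq_top_of_prime {N m : ℕ} {w : Fin N → ℕ} (π : MvPolynomial (Fin N) k →ₐ[k] A)
    (hdeg : ∀ n p, MvPolynomial.IsWeightedHomogeneous w p n → π p ∈ 𝒜 n)
    (hπ : Function.Surjective π) (c : Fin m → Fin N)
    (hcov : ∀ 𝔭 : Ideal A, 𝔭.IsPrime → (∀ i, π (MvPolynomial.X (c i)) ∈ 𝔭) →
      ∀ j, π (MvPolynomial.X j) ∈ 𝔭) :
    ⨆ i, Proj.basicOpen 𝒜 (π (MvPolynomial.X (c i))) = ⊤ := by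
  have h := Proj.iSup_basicOpen_eq_top' 𝒜 (fun j => π (MvPolynomial.X j))
    (fun j => ⟨_, hdeg _ _ (MvPolynomial.isWeightedHomogeneous_X k w j)⟩) (by
      refine Algebra.eq_top_iff.mpr fun a => ?_
      obtain ⟨p, rfl⟩ := hπ a
      induction p using MvPolynomial.induction_on with
      | C r =>
        have hr : π (MvPolynomial.C r) = algebraMap (𝒜 0) A (algebraMap k (𝒜 0) r) := by
          rw [← MvPolynomial.algebraMap_eq, AlgHom.commutes]
          rfl
        rw [hr]
        exact Subalgebra.algebraMap_mem _ _
      | add p q hp hq => rw [map_add]; exact add_mem hp hq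
      | mul_X p i hp => rw [map_mul]; exact mul_mem hp (Algebra.subset_adjoin ⟨i, rfl⟩))
  refine top_le_iff.mp fun x _ => ?_
  have hx : x ∈ ⨆ j, Proj.basicOpen 𝒜 (π (MvPolynomial.X j)) := h ▸ trivial
  obtain ⟨j, hj⟩ := TopologicalSpace.Opens.mem_iSup.mp hx
  rw [Proj.mem_basicOpen] at hj
  refine TopologicalSpace.Opens.mem_iSup.mpr ?_
  by_contra! H
  simp only [Proj.mem_basicOpen, not_not] at H
  exact hj (hcov x.asHomogeneousIdeal.toIdeal x.isPrime H j)

/-- The strata of `cls_projVariety_eq_sum` are disjoint, indexed by the position of the first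
nonzero chart coordinate. Their union consists of the vectors whose leading chart coordinate is `1`.
-/
theorem cls_projVariety_eq_mu [IsAlgClosed k] {N m : ℕ} {w : Fin N → ℕ}
    (π : MvPolynomial (Fin N) k →ₐ[k] A)
    (hdeg : ∀ n p, MvPolynomial.IsWeightedHomogeneous w p n → π p ∈ 𝒜 n)
    (hsurj : ∀ n, ∀ a ∈ 𝒜 n, ∃ p, MvPolynomial.IsWeightedHomogeneous w p n ∧ π p = a)
    (h0 : Function.Surjective (algebraMap k (𝒜 0))) [Algebra.FiniteType k A]
    (hπ : Function.Surjective π) (c : Fin m → Fin N) (hc : ∀ i, w (c i) = 1)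
    (hcov : ∀ 𝔭 : Ideal A, 𝔭.IsPrime → (∀ i, π (MvPolynomial.X (c i)) ∈ 𝔭) →
      ∀ j, π (MvPolynomial.X j) ∈ 𝔭) {Z : Set (Fin N → k)}
    (hZ : IsCon k Z) (hmem : ∀ v, v ∈ Z ↔ ∀ p, π p = 0 → MvPolynomial.eval v p = 0) :
    cls (projVariety 𝒜 h0) = mu k {v | v ∈ Z ∧ lead (fun i => v (c i)) = 1} := by
  rw [cls_projVariety_eq_sum π hdeg hsurj h0 hπ c hc
    (iSup_basicOpen_eq_top_of_prime π hdeg hπ c hcov) hZ hmem, ← mu_exists_finite]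
  · congr 1
    ext v
    simp only [Set.mem_ofPred_eq, lead_eq_one_iff]
    exact exists_and_left
  · intro i
    refine hZ.and (.and (.eq (DefMap.id.apply _) (.const 1)) (.forall_finite fun j => ?_))
    by_cases h : j < i
    · simpa [h] using IsCon.eq_zero ((DefMap.id (k := k)).apply (c j))
    · simpa [h] using IsCon.univ (k := k) (V := Fin N → k)
  · rintro i j v ⟨-, hi, hi'⟩ ⟨-, hj, hj'⟩
    rcases lt_trichotomy i j with h | h | h
    · exact (one_ne_zero (hi.symm.trans (hj' i h))).elim
    · exact h
    · exact (one_ne_zero (hj.symm.trans (hi' j h))).elim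

end Proj

/-! ### `Proj` of a quotient of a polynomial ring -/

section Quotient

open MvPolynomial

variable {k : Type u} [Field k] [IsAlgClosed k] {N : ℕ} {w : Fin N → ℕ}
  (𝒜 : ℕ → Submodule k (MvPolynomial (Fin N) k)) [GradedAlgebra 𝒜]

theorem cls_quotGrading_eq_mu {m : ℕ} (h𝒜 : ∀ n p, p ∈ 𝒜 n ↔ IsWeightedHomogeneous w p n)
    (I : HomogeneousIdeal 𝒜) (h0 : Function.Surjective (algebraMap k (quotGrading 𝒜 I 0)))
    {s : Set (MvPolynomial (Fin N) k)} (hs : I.toIdeal = Ideal.span s) (hfin : s.Finite)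
    (c : Fin m → Fin N) (hc : ∀ i, w (c i) = 1)
    (hcov : ∀ 𝔭 : Ideal (MvPolynomial (Fin N) k), 𝔭.IsPrime → s ⊆ 𝔭 →
      (∀ i, X (c i) ∈ 𝔭) → ∀ j, X j ∈ 𝔭) :
    cls (projVariety (quotGrading 𝒜 I) h0) =
      mu k {v | (∀ p ∈ s, eval v p = 0) ∧ lead (fun i => v (c i)) = 1} := by
  have := hfin.to_subtype
  refine cls_projVariety_eq_mu (w := w) (Ideal.Quotient.mkₐ k I.toIdeal) ?_ ?_ h0
    (Ideal.Quotient.mkₐ_surjective k _) c hc ?_ (Z := {v | ∀ p ∈ s, eval v p = 0}) ?_ ?_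
  · exact fun n p hp => ⟨p, (h𝒜 n p).mpr hp, rfl⟩
  · rintro n _ ⟨p, hp, rfl⟩
    exact ⟨p, (h𝒜 n p).mp hp, rfl⟩
  · intro 𝔭 h𝔭 hX j
    refine hcov (𝔭.comap (Ideal.Quotient.mk I.toIdeal)) inferInstance ?_ hX j
    intro p hp
    change Ideal.Quotient.mk I.toIdeal p ∈ 𝔭
    rw [Ideal.Quotient.eq_zero_iff_mem.mpr (hs ▸ Ideal.subset_span hp)]
    exact zero_mem _
  · have : IsCon k {v : Fin N → k | ∀ p : s, eval v p.1 = 0} :=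
      .forall_finite fun p => .eq_zero (.eval p.1 .id)
    simpa using this
  · intro v
    have hmk (p) : Ideal.Quotient.mkₐ k I.toIdeal p = 0 ↔ p ∈ I.toIdeal :=
      Ideal.Quotient.eq_zero_iff_mem
    simp only [hmk, hs]
    constructor
    · intro hv p hp
      have : Ideal.span s ≤ RingHom.ker (eval v) := Ideal.span_le.mpr hv
      exact this hp
    · exact fun hv p hp => hv p (Ideal.subset_span hp)

end Quotient

/-! ### The classes of projective space, the base locus and the hyperelliptic curve -/

section Specialization

open MvPolynomial

attribute [local instance] MvPolynomial.gradedAlgebra MvPolynomial.weightedGradedAlgebra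

variable {k : Type u} [Field k] [IsAlgClosed k]

theorem cls_projectiveSpace (n : ℕ) : cls (projectiveSpace k n) = projClass k (n + 1) := by
  rw [← mu_lead, projectiveSpace, cls_projVariety_eq_mu (w := 1) (AlgHom.id k _)
    (fun n p hp => hp) (fun n p hp => ⟨p, hp, rfl⟩) _ Function.surjective_id id (fun _ => rfl)
    (fun 𝔭 _ h => h) (Z := Set.univ) .univ]
  · simp
  · simp

theorem cls_quadricIntersection {n : ℕ} (q₁ q₂ : homogeneousSubmodule (Fin (n + 1)) k 2) :
    cls (quadricIntersection q₁ q₂) =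
      mu k {v | (eval v q₁.1 = 0 ∧ eval v q₂.1 = 0) ∧ lead v = 1} := by
  rw [quadricIntersection, cls_quotGrading_eq_mu (w := 1) _ (fun n p => Iff.rfl)
    (quadricIdeal q₁ q₂) _ (s := {q₁.1, q₂.1}) rfl (by simp) id (fun _ => rfl)
    (fun 𝔭 _ _ h => h)]
  simp

theorem cls_hyperellipticCurve {g : ℕ} (q₁ q₂ : homogeneousSubmodule (Fin (2 * g + 1 + 1)) k 2) :
    cls (hyperellipticCurve q₁ q₂) =
      mu k {v : Fin 3 → k | v 2 ^ 2 = (v 0 • gramMatrix q₁ + v 1 • gramMatrix q₂).det ∧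
        lead ![v 0, v 1] = 1} := by
  have hdet (v : Fin 3 → k) : eval v (discriminant q₁ q₂) =
      (v 0 • gramMatrix q₁ + v 1 • gramMatrix q₂).det := by
    rw [discriminant, RingHom.map_det]
    congr 1
    ext i j
    simp
  rw [hyperellipticCurve, cls_quotGrading_eq_mu (w := curveWeights g) _ (fun n p => Iff.rfl)
    (curveIdeal q₁ q₂) _ (s := {curveEquation q₁ q₂}) rfl (by simp) ![0, 1]]
  · congr 1
    ext v
    have : (fun i => v (![0, 1] i)) = ![v 0, v 1] := by
      ext i; fin_cases i <;> rfl
    simp [this, curveEquation, hdet, sub_eq_zero]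
  · intro i
    fin_cases i <;> rfl
  -- The charts of `s` and `t` suffice: a prime containing `s`, `t` and the equation contains the
  -- discriminant, whose entries lie in `(s, t)`, hence `y²`, hence `y`.
  · intro 𝔭 h𝔭 hs h j
    have h0 : X 0 ∈ 𝔭 := h 0
    have h1 : X 1 ∈ 𝔭 := h 1
    have hd : discriminant q₁ q₂ ∈ 𝔭 := by
      rw [← Ideal.Quotient.eq_zero_iff_mem, discriminant, RingHom.map_det]
      refine Matrix.det_eq_zero_of_row_eq_zero 0 fun j => ?_
      refine Ideal.Quotient.eq_zero_iff_mem.mpr ?_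
      exact add_mem (Ideal.mul_mem_right _ _ h0) (Ideal.mul_mem_right _ _ h1)
    have h2 : X 2 ∈ 𝔭 := by
      refine h𝔭.mem_of_pow_mem 2 ?_
      have := add_mem (hs rfl) hd
      rwa [curveEquation, sub_add_cancel] at this
    fin_cases j
    exacts [h0, h1, h2]

end Specialization

/-! ### The Gram matrix -/

section Gram

open MvPolynomial

variable {k : Type u} [Field k] {n : ℕ} (q : homogeneousSubmodule (Fin (n + 1)) k 2)

/-- Partial derivatives commute: their commutator is a derivation that kills the variables. -/
lemma gramMatrix_isSymm : (gramMatrix q).IsSymm := by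
  have h (i j : Fin (n + 1)) : ⁅pderiv (R := k) i, pderiv (R := k) j⁆ = 0 :=
    MvPolynomial.derivation_ext fun l => by
      classical
      simp only [Derivation.commutator_apply, pderiv_X, Derivation.coe_zero, Pi.zero_apply]
      simp [Pi.single_apply, apply_ite]
  ext i j
  rw [Matrix.transpose_apply, gramMatrix, gramMatrix]
  congr 2
  have := congrArg (fun D => D q.1) (h j i)
  simpa [Derivation.commutator_apply, sub_eq_zero] using this

/-- Euler's identity, applied to `q` in degree two and to its partial derivatives in degree one; the
second derivatives are constants. -/
lemma eq_sum_gramMatrix [CharZero k] :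
    q.1 = ∑ i, ∑ j, C (gramMatrix q i j) * (X i * X j) := by
  have hq : q.1.IsHomogeneous 2 := q.2
  have h1 := hq.sum_X_mul_pderiv
  have h2 (j) : ∑ i, X i * pderiv i (pderiv j q.1) = pderiv j q.1 := by
    simpa using (hq.pderiv (i := j)).sum_X_mul_pderiv
  have h3 (i j) : pderiv i (pderiv j q.1) = C (2 * gramMatrix q i j) := by
    have h : (pderiv i (pderiv j q.1)).IsHomogeneous 0 := (hq.pderiv (i := j)).pderiv (i := i)
    rw [gramMatrix, mul_inv_cancel_left₀ two_ne_zero]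
    rwa [← totalDegree_zero_iff_isHomogeneous, totalDegree_eq_zero_iff_eq_C] at h
  have : (2 : MvPolynomial (Fin (n + 1)) k) * q.1 =
      2 * ∑ i, ∑ j, C (gramMatrix q i j) * (X i * X j) := by
    rw [nsmul_eq_mul] at h1
    rw [Finset.sum_comm]
    push_cast at h1
    rw [← h1]
    simp only [Finset.mul_sum]
    refine Finset.sum_congr rfl fun j _ => ?_
    rw [← h2 j, Finset.mul_sum]
    refine Finset.sum_congr rfl fun i _ => ?_
    rw [h3, map_mul, show (C 2 : MvPolynomial (Fin (n + 1)) k) = 2 from map_ofNat C 2]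
    ring
  exact mul_left_cancel₀ two_ne_zero this

lemma aeval_eq_sum_gramMatrix [CharZero k] {R : Type u} [CommRing R] [Algebra k R]
    (v : Fin (n + 1) → R) :
    aeval v q.1 = ∑ i, ∑ j, algebraMap k R (gramMatrix q i j) * (v i * v j) := by
  conv_lhs => rw [eq_sum_gramMatrix q]
  simp

lemma eval_eq_dotProduct_gramMatrix [CharZero k] (v : Fin (n + 1) → k) :
    eval v q.1 = v ⬝ᵥ (gramMatrix q).mulVec v := by
  conv_lhs => rw [eq_sum_gramMatrix q]
  simp only [map_sum, map_mul, eval_C, eval_X, dotProduct, Matrix.mulVec, Finset.mul_sum]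
  refine Finset.sum_congr rfl fun i _ => Finset.sum_congr rfl fun j _ => ?_
  ring

end Gram

/-! ### Tangent spaces of smooth varieties -/

section Tangent

variable {k : Type u} [Field k]

/-- A homomorphism to the dual numbers lifting `θ` is a derivation of `C` into `k`, viewed as a
`C`-module through `θ`. Derivations are linear maps on `Ω[C⁄k]`, which is free of rank `n`, so they
form a space of dimension at most `n`. By hypothesis `T` lies in its image under evaluation at the
family `x`. -/
lemma finrank_le_of_isStandardSmooth {C : Type u} [CommRing C] [Algebra k C] {n : ℕ}
    [Algebra.IsStandardSmoothOfRelativeDimension n k C] {ι : Type} [Finite ι] (θ : C →ₐ[k] k)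
    (x : ι → C) (T : Submodule k (ι → k))
    (hT : ∀ ξ ∈ T, ∃ f : C →ₐ[k] DualNumber k, (∀ a, (f a).fst = θ a) ∧
      ∀ j, (f (x j)).snd = ξ j) : Module.finrank k T ≤ n := by
  let _ : Algebra C k := θ.toRingHom.toAlgebra
  have hθ (a : C) (b : k) : a • b = θ a * b := rfl
  have : IsScalarTower k C k := ⟨fun a b c => by rw [hθ, hθ, map_smul, smul_mul_assoc]⟩
  have : Nontrivial C := θ.toRingHom.domain_nontrivial
  have := Algebra.IsStandardSmoothOfRelativeDimension.isStandardSmooth (R := k) (S := C) n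
  have hrank := Algebra.IsStandardSmoothOfRelativeDimension.rank_kaehlerDifferential (R := k)
    (S := C) n
  have hfr : Module.finrank C (Ω[C⁄k]) = n := Module.finrank_eq_of_rank_eq hrank
  let b := Module.finBasisOfFinrankEq C (Ω[C⁄k]) hfr
  let L : Derivation k C k →ₗ[k] (Fin n → k) :=
    { toFun := fun D i => D.liftKaehlerDifferential (b i)
      map_add' := fun D D' => by
        have : (D + D').liftKaehlerDifferential =
            D.liftKaehlerDifferential + D'.liftKaehlerDifferential :=
          Derivation.liftKaehlerDifferential_unique _ _ (by ext; simp)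
        ext i
        rw [this]
        rfl
      map_smul' := fun c D => by
        have : (c • D).liftKaehlerDifferential = c • D.liftKaehlerDifferential :=
          Derivation.liftKaehlerDifferential_unique _ _ (by ext; simp)
        ext i
        rw [this]
        rfl }
  have hL : Function.Injective L := by
    rw [← LinearMap.ker_eq_bot, LinearMap.ker_eq_bot']
    intro D hD
    have : D.liftKaehlerDifferential = 0 := b.ext fun i => congrFun hD i
    ext a
    rw [← Derivation.liftKaehlerDifferential_comp_D, this]
    rfl
  have : FiniteDimensional k (Derivation k C k) := FiniteDimensional.of_injective L hL
  have hDer : Module.finrank k (Derivation k C k) ≤ n := by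
    simpa using LinearMap.finrank_le_finrank_of_injective hL
  let E : Derivation k C k →ₗ[k] (ι → k) :=
    { toFun := fun D j => D (x j)
      map_add' := fun _ _ => rfl
      map_smul' := fun _ _ => rfl }
  have hTE : T ≤ LinearMap.range E := by
    intro ξ hξ
    obtain ⟨f, hf, hfx⟩ := hT ξ hξ
    refine ⟨Derivation.mk' ((TrivSqZeroExt.sndHom k k).comp f.toLinearMap) fun a c => ?_, ?_⟩
    · change (f (a * c)).snd = θ a * (f c).snd + θ c * (f a).snd
      rw [map_mul, TrivSqZeroExt.snd_mul, hf, hf]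
      simp [mul_comm]
    · ext j
      exact hfx j
  exact (Submodule.finrank_mono hTE).trans ((LinearMap.finrank_range_le E).trans hDer)

/-- Reduction to a standard smooth localization at some `t` with `θ t ≠ 0`. The tangent vectors
extend to it because a dual number is a unit as soon as its constant term is. -/
lemma finrank_le_of_locally {B : Type u} [CommRing B] [Algebra k B] {n : ℕ}
    (hB : RingHom.Locally (RingHom.IsStandardSmoothOfRelativeDimension n) (algebraMap k B))
    {ι : Type} [Finite ι] (θ : B →ₐ[k] k) (x : ι → B) (T : Submodule k (ι → k))
    (hT : ∀ ξ ∈ T, ∃ f : B →ₐ[k] DualNumber k, (∀ a, (f a).fst = θ a) ∧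
      ∀ j, (f (x j)).snd = ξ j) : Module.finrank k T ≤ n := by
  obtain ⟨s, hs, h⟩ := hB
  obtain ⟨t, ht, htθ⟩ : ∃ t ∈ s, θ t ≠ 0 := by
    by_contra! H
    have : Ideal.span s ≤ RingHom.ker θ := Ideal.span_le.mpr H
    rw [hs] at this
    exact one_ne_zero ((map_one θ).symm.trans (this (Submodule.mem_top : (1 : B) ∈ ⊤)))
  have ht' := h t ht
  rw [← IsScalarTower.algebraMap_eq,
    RingHom.isStandardSmoothOfRelativeDimension_algebraMap] at ht'
  have hu {R : Type u} [CommRing R] [Algebra k R] (f : B →ₐ[k] R) (hf : IsUnit (f t))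
      (y : Submonoid.powers t) : IsUnit (f y) := by
    obtain ⟨_, m, rfl⟩ := y
    simpa using hf.pow m
  have hθu : IsUnit (θ t) := isUnit_iff_ne_zero.mpr htθ
  refine finrank_le_of_isStandardSmooth (C := Localization.Away t)
    (IsLocalization.liftAlgHom (M := Submonoid.powers t) (f := θ) (hu θ hθu))
    (fun j => algebraMap B _ (x j)) T fun ξ hξ => ?_
  obtain ⟨f, hf, hfx⟩ := hT ξ hξ
  have hfu : IsUnit (f t) := TrivSqZeroExt.isUnit_iff_isUnit_fst.mpr (by rwa [hf])
  refine ⟨IsLocalization.liftAlgHom (M := Submonoid.powers t) (f := f) (hu f hfu), ?_, ?_⟩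
  · have : ((TrivSqZeroExt.fstHom k k k).comp
        (IsLocalization.liftAlgHom (M := Submonoid.powers t) (f := f) (hu f hfu) :
          Localization.Away t →ₐ[k] DualNumber k)) =
        IsLocalization.liftAlgHom (M := Submonoid.powers t) (f := θ) (hu θ hθu) := by
      refine IsLocalization.algHom_ext (Submonoid.powers t) ?_
      ext a
      change TrivSqZeroExt.fst (IsLocalization.lift _ (algebraMap B _ a)) =
        IsLocalization.lift _ (algebraMap B _ a)
      rw [IsLocalization.lift_eq, IsLocalization.lift_eq]
      exact hf a
    exact fun a => AlgHom.congr_fun this a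
  · intro j
    simp [hfx]

end Tangent

/-! ### The Jacobian criterion -/

section Jacobian

open MvPolynomial

variable {k : Type u} [Field k] [CharZero k]

/-- The expansion `q(v + εξ) = q(v) + 2ε (G v) · ξ`, where symmetry of `G` identifies the two cross
terms. -/
lemma aeval_dualNumber_eq_zero {n : ℕ} (q : homogeneousSubmodule (Fin (n + 1)) k 2)
    {v ξ : Fin (n + 1) → k} (hv : eval v q.1 = 0) (hξ : (gramMatrix q).mulVec v ⬝ᵥ ξ = 0) :
    aeval (fun j => (TrivSqZeroExt.inl (v j) + TrivSqZeroExt.inr (ξ j) : DualNumber k)) q.1 =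
      0 := by
  have hsym : v ⬝ᵥ (gramMatrix q).mulVec ξ = 0 := by
    rwa [Matrix.dotProduct_mulVec, ← Matrix.mulVec_transpose, gramMatrix_isSymm q]
  rw [dotProduct_comm] at hξ
  rw [eval_eq_dotProduct_gramMatrix] at hv
  rw [aeval_eq_sum_gramMatrix]
  have halg (c : k) : algebraMap k (DualNumber k) c = TrivSqZeroExt.inl c := rfl
  ext
  · rw [TrivSqZeroExt.fst_zero, ← hv]
    simp only [dotProduct, Matrix.mulVec, Finset.mul_sum]
    simp [TrivSqZeroExt.fst_sum, mul_left_comm, halg]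
  · rw [TrivSqZeroExt.snd_zero, ← add_zero (0 : k)]
    nth_rewrite 1 [← hξ]
    rw [← hsym]
    simp only [dotProduct, Matrix.mulVec, Finset.mul_sum, ← Finset.sum_add_distrib]
    simp only [TrivSqZeroExt.snd_sum]
    refine Finset.sum_congr rfl fun i _ => Finset.sum_congr rfl fun j _ => ?_
    simp [halg]
    ring

attribute [local instance] MvPolynomial.gradedAlgebra

-- Vectors orthogonal to both gradients with `ξ i = 0` give points `v + εξ` of the chart `x i = 1`
-- over the dual numbers, and smoothness bounds the dimension of the space of such vectors.
open HomogeneousLocalization in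
lemma finrank_tangentSpace_le {n d : ℕ} (q₁ q₂ : homogeneousSubmodule (Fin (n + 1)) k 2)
    (hsmooth : SmoothOfRelativeDimension d (quadricIntersection q₁ q₂).obj.hom)
    {v : Fin (n + 1) → k} {i : Fin (n + 1)} (hvi : v i = 1) (h₁ : eval v q₁.1 = 0)
    (h₂ : eval v q₂.1 = 0) (T : Submodule k (Fin (n + 1) → k))
    (hT : ∀ ξ ∈ T, ξ i = 0 ∧ (gramMatrix q₁).mulVec v ⬝ᵥ ξ = 0 ∧
      (gramMatrix q₂).mulVec v ⬝ᵥ ξ = 0) : Module.finrank k T ≤ d := by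
  let I := quadricIdeal q₁ q₂
  let π := Ideal.Quotient.mkₐ k I.toIdeal
  let 𝒜 := quotGrading (homogeneousSubmodule (Fin (n + 1)) k) I
  have hdeg (m p) (hp : IsWeightedHomogeneous (1 : Fin (n + 1) → ℕ) p m) : π p ∈ 𝒜 m :=
    ⟨p, hp, rfl⟩
  have hsurj (m) : ∀ a ∈ 𝒜 m, ∃ p, IsWeightedHomogeneous (1 : Fin (n + 1) → ℕ) p m ∧
      π p = a := by
    rintro _ ⟨p, hp, rfl⟩
    exact ⟨p, hp, rfl⟩
  have hπ : Function.Surjective π := Ideal.Quotient.mkₐ_surjective k _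
  have hi : π (X i) ∈ 𝒜 1 := hdeg 1 _ (isWeightedHomogeneous_X k _ i)
  have hB : RingHom.Locally (RingHom.IsStandardSmoothOfRelativeDimension d)
      (algebraMap k (Away 𝒜 (π (X i)))) := by
    have h : SmoothOfRelativeDimension d (projHom 𝒜) := hsmooth
    -- Relative dimensions add under composition, and the chart is an open immersion, of relative
    -- dimension `0`.
    have h' : SmoothOfRelativeDimension (0 + d) (Proj.awayι 𝒜 _ hi one_pos ≫ projHom 𝒜) :=
      inferInstance
    rw [zero_add, awayι_comp_projHom] at h'
    exact (HasRingHomProperty.Spec_iff (P := @SmoothOfRelativeDimension d)).mp h'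
  have hvan {R : Type u} [CommRing R] [Algebra k R] (x : Fin (n + 1) → R)
      (hx₁ : aeval x q₁.1 = 0) (hx₂ : aeval x q₂.1 = 0) (p) (hp : π p = 0) : aeval x p = 0 := by
    have hp' : p ∈ Ideal.span {q₁.1, q₂.1} := Ideal.Quotient.eq_zero_iff_mem.mp hp
    have hle : Ideal.span {q₁.1, q₂.1} ≤ RingHom.ker (aeval (R := k) x) := by
      refine Ideal.span_le.mpr ?_
      rintro _ (rfl | rfl)
      exacts [hx₁, hx₂]
    exact hle hp'
  have haev (p) : aeval v p = eval v p := RingHom.congr_fun (coe_aeval_eq_eval _) p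
  obtain ⟨θ, hθ⟩ := chartMap_eval π hdeg hi hvi hπ
    (hvan v ((haev _).trans h₁) ((haev _).trans h₂))
  refine finrank_le_of_locally hB θ (fun j => chartMap π hdeg hi (X j)) T fun ξ hξ => ?_
  obtain ⟨h0, ht₁, ht₂⟩ := hT ξ hξ
  obtain ⟨f, hf⟩ := chartMap_eval π hdeg hi (R := DualNumber k)
    (v := fun j => TrivSqZeroExt.inl (v j) + TrivSqZeroExt.inr (ξ j)) (by
      rw [hvi, h0, TrivSqZeroExt.inr_zero, add_zero, TrivSqZeroExt.inl_one]) hπ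
    (hvan _ (aeval_dualNumber_eq_zero q₁ h₁ ht₁) (aeval_dualNumber_eq_zero q₂ h₂ ht₂))
  refine ⟨f, fun a => ?_, fun j => ?_⟩
  · obtain ⟨p, rfl⟩ := chartMap_surjective π hdeg hsurj hi a
    rw [hf, hθ]
    have : (TrivSqZeroExt.fstHom k k k).comp (aeval fun j =>
        (TrivSqZeroExt.inl (v j) + TrivSqZeroExt.inr (ξ j) : DualNumber k)) = aeval v :=
      algHom_ext fun j => by simp
    exact AlgHom.congr_fun this p
  · rw [hf, aeval_X]
    simp

/-- Jacobian criterion. If a member of the pencil killed `v`, the two gradients at `v` would be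
proportional. The tangent space in a chart would then contain the solutions of two linear equations,
a space of dimension at least `n - 1 > d`. -/
theorem mulVec_ne_zero_of_smooth {n d : ℕ} (hd : d + 1 < n)
    (q₁ q₂ : homogeneousSubmodule (Fin (n + 1)) k 2)
    (hsmooth : SmoothOfRelativeDimension d (quadricIntersection q₁ q₂).obj.hom)
    {v : Fin (n + 1) → k} (hv : v ≠ 0) (h₁ : eval v q₁.1 = 0) (h₂ : eval v q₂.1 = 0) {a b : k}
    (hab : a ≠ 0 ∨ b ≠ 0) : (a • gramMatrix q₁ + b • gramMatrix q₂).mulVec v ≠ 0 := by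
  intro h
  obtain ⟨i, hi⟩ := Function.ne_iff.mp hv
  let v' := (v i)⁻¹ • v
  have heval (q : homogeneousSubmodule (Fin (n + 1)) k 2) (hq : eval v q.1 = 0) :
      eval v' q.1 = 0 := by
    rw [eval_eq_dotProduct_gramMatrix] at hq ⊢
    simp [v', Matrix.mulVec_smul, hq]
  have h' : a • (gramMatrix q₁).mulVec v' + b • (gramMatrix q₂).mulVec v' = 0 := by
    rw [← Matrix.smul_mulVec, ← Matrix.smul_mulVec, ← Matrix.add_mulVec, Matrix.mulVec_smul, h,
      smul_zero]
  -- Take for `w` the gradient whose coefficient in the relation may vanish; the other one is a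
  -- multiple of it.
  obtain ⟨w, hw⟩ : ∃ w : Fin (n + 1) → k, ∀ ξ, w ⬝ᵥ ξ = 0 →
      (gramMatrix q₁).mulVec v' ⬝ᵥ ξ = 0 ∧ (gramMatrix q₂).mulVec v' ⬝ᵥ ξ = 0 := by
    have hlin (ξ : Fin (n + 1) → k) : a * ((gramMatrix q₁).mulVec v' ⬝ᵥ ξ) +
        b * ((gramMatrix q₂).mulVec v' ⬝ᵥ ξ) = 0 := by
      rw [← smul_eq_mul, ← smul_eq_mul, ← smul_dotProduct, ← smul_dotProduct, ← add_dotProduct,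
        h', zero_dotProduct]
    rcases hab with ha | hb
    · refine ⟨(gramMatrix q₂).mulVec v', fun ξ hξ => ⟨?_, hξ⟩⟩
      simpa [hξ, ha] using hlin ξ
    · refine ⟨(gramMatrix q₁).mulVec v', fun ξ hξ => ⟨hξ, ?_⟩⟩
      simpa [hξ, hb] using hlin ξ
  let ℓ : (Fin (n + 1) → k) →ₗ[k] k × k :=
    (LinearMap.proj i).prod (dotProductBilin k k w)
  have hle := finrank_tangentSpace_le q₁ q₂ hsmooth (v := v') (i := i)
    (by simp [v', inv_mul_cancel₀ hi]) (heval q₁ h₁) (heval q₂ h₂) (LinearMap.ker ℓ) fun ξ hξ => by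
      have := Prod.ext_iff.mp (LinearMap.mem_ker.mp hξ)
      exact ⟨this.1, hw ξ this.2⟩
  have hrk := LinearMap.finrank_range_add_finrank_ker ℓ
  have hr : Module.finrank k (LinearMap.range ℓ) ≤ 2 := by
    simpa using Submodule.finrank_le (LinearMap.range ℓ)
  simp only [Module.finrank_fintype_fun_eq_card, Fintype.card_fin] at hrk
  omega

end Jacobian

/-! ### Self-adjoint endomorphisms without isotropic eigenvectors -/

section SelfAdjoint

variable {k : Type u} [Field k] [IsAlgClosed k]

/-- Take an eigenvector `u`. As `B u u ≠ 0`, the space is the orthogonal sum of the line of `u` and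
its complement, which is stable under the self-adjoint `M` and inherits the hypotheses. -/
lemma exists_orthogonal_eigenbasis (n : ℕ) : ∀ (V : Type u) [AddCommGroup V] [Module k V]
    [FiniteDimensional k V] (_ : Module.finrank k V = n) (B : LinearMap.BilinForm k V)
    (_ : ∀ x y, B x y = B y x) (M : Module.End k V) (_ : ∀ x y, B (M x) y = B x (M y))
    (_ : ∀ (c : k) x, x ≠ 0 → M x = c • x → B x x ≠ 0),
    ∃ (e : Module.Basis (Fin n) k V) (c : Fin n → k), (∀ i, M (e i) = c i • e i) ∧
      ∀ i j, i ≠ j → B (e i) (e j) = 0 := by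
  induction n with
  | zero =>
    intro V _ _ _ hn B _ M _ _
    exact ⟨Module.finBasisOfFinrankEq k V hn, 0, fun i => i.elim0, fun i => i.elim0⟩
  | succ n ih =>
    intro V _ _ _ hn B hB M hM hiso
    have : Nontrivial V := Module.nontrivial_of_finrank_pos (R := k) (by omega)
    obtain ⟨c, hc⟩ := Module.End.exists_eigenvalue M
    obtain ⟨u, hu⟩ := hc.exists_hasEigenvector
    have hMu : M u = c • u := hu.apply_eq_smul
    have huu : B u u ≠ 0 := hiso c u hu.2 hMu
    let W : Submodule k V := LinearMap.ker (B u)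
    have hW (x : V) : x ∈ W ↔ B u x = 0 := LinearMap.mem_ker
    have hMW : ∀ x ∈ W, M x ∈ W := fun x hx => by
      rw [hW] at hx ⊢
      rw [← hM, hMu, map_smul, LinearMap.smul_apply, hx, smul_zero]
    have hli (a : k) (x : V) (hx : x ∈ W) (h : a • u + x = 0) : a = 0 := by
      have := congrArg (B u) h
      rw [map_add, (hW x).mp hx, map_smul, map_zero, add_zero, smul_eq_mul] at this
      exact (mul_eq_zero.mp this).resolve_right huu
    have hsp (z : V) : ∃ a : k, z + a • u ∈ W := by
      refine ⟨-(B u z / B u u), ?_⟩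
      rw [hW, map_add, map_smul, smul_eq_mul, neg_mul, div_mul_cancel₀ _ huu, add_neg_cancel]
    have hfr : Module.finrank k W = n := by
      have h1 := LinearMap.finrank_range_add_finrank_ker (B u)
      have h2 : LinearMap.range (B u) = ⊤ := by
        refine LinearMap.range_eq_top.mpr (LinearMap.surjective ?_)
        exact fun h => huu (by rw [h]; rfl)
      rw [h2, finrank_top, Module.finrank_self, hn] at h1
      change Module.finrank k (LinearMap.ker (B u)) = n
      omega
    obtain ⟨e, d, he, hd⟩ := ih W hfr (B.restrict W) (fun x y => hB x y) (M.restrict hMW)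
      (fun x y => hM x y) (fun a x hx h => hiso a x (fun h0 => hx (Subtype.ext h0))
        (congrArg Subtype.val h))
    refine ⟨Module.Basis.mkFinCons u e hli hsp, Fin.cons c d, fun i => ?_, fun i j => ?_⟩
    · refine Fin.cases ?_ (fun i => ?_) i
      · simpa using hMu
      · simpa using congrArg Subtype.val (he i)
    · have h0 (l : Fin n) : B u (e l) = 0 := (hW _).mp (e l).2
      refine Fin.cases ?_ (fun i => ?_) i <;> refine Fin.cases ?_ (fun j => ?_) j
      · simp
      · simp [h0]
      · simp [hB _ u, h0]
      · intro hij
        simpa using hd i j (by simpa using hij)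

variable {V : Type u} [AddCommGroup V] [Module k V]

-- Split linear factors off `p` until the remaining factor `r` no longer kills `v`; then `r(M) v` is
-- an eigenvector for the last root removed. The strict degree bound is what keeps it inside a
-- Krylov space that is known to be isotropic.
open Polynomial in
lemma exists_eigenvector_of_aeval_eq_zero (M : Module.End k V) {v : V} (hv : v ≠ 0) (n : ℕ) :
    ∀ p : k[X], p ≠ 0 → p.natDegree ≤ n → aeval M p v = 0 →
      ∃ (r : k[X]) (c : k), r.natDegree < n ∧ aeval M r v ≠ 0 ∧
        M (aeval M r v) = c • aeval M r v := by
  induction n with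
  | zero =>
    intro p hp hn h
    rw [eq_C_of_natDegree_eq_zero (Nat.le_zero.mp hn)] at h hp
    rw [aeval_C, Module.algebraMap_end_apply] at h
    exact ((smul_eq_zero.mp h).elim (fun h => hp (by rw [h, C_0])) hv).elim
  | succ n ih =>
    intro p hp hn h
    by_cases hdeg : p.natDegree = 0
    · obtain ⟨r, c, hr, h'⟩ := ih p hp (by omega) h
      exact ⟨r, c, by omega, h'⟩
    · obtain ⟨c, hc⟩ := IsAlgClosed.exists_root p (fun h0 => hdeg (natDegree_eq_of_degree_eq_some h0))
      obtain ⟨r, rfl⟩ := dvd_iff_isRoot.mpr hc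
      have hr0 : r ≠ 0 := right_ne_zero_of_mul hp
      have hr : r.natDegree ≤ n := by
        rw [natDegree_mul (X_sub_C_ne_zero c) hr0, natDegree_X_sub_C] at hn
        omega
      by_cases hrv : aeval M r v = 0
      · obtain ⟨r, c, hr, h'⟩ := ih r hr0 hr hrv
        exact ⟨r, c, by omega, h'⟩
      · refine ⟨r, c, by omega, hrv, ?_⟩
        rw [map_mul, Module.End.mul_apply, map_sub, aeval_X, aeval_C, LinearMap.sub_apply,
          Module.algebraMap_end_apply, sub_eq_zero] at h
        exact h

variable [FiniteDimensional k V]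

/-- For `v = ∑ aⱼ eⱼ` in an orthogonal eigenbasis, `B (Mⁱ v) v = ∑ cⱼⁱ B(eⱼ, eⱼ) aⱼ²`. These are `m`
linear equations in more than `m` unknowns `bⱼ = aⱼ²`; take a nonzero solution and extract square
roots. -/
lemma exists_isotropic_krylov (B : LinearMap.BilinForm k V)
    (hB : ∀ x y, B x y = B y x) (M : Module.End k V) (hM : ∀ x y, B (M x) y = B x (M y))
    (hiso : ∀ (c : k) x, x ≠ 0 → M x = c • x → B x x ≠ 0) {m : ℕ}
    (hm : m < Module.finrank k V) :
    ∃ v : V, v ≠ 0 ∧ ∀ i < m, B ((M ^ i) v) v = 0 := by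
  obtain ⟨e, c, he, ho⟩ := exists_orthogonal_eigenbasis _ V rfl B hB M hM hiso
  let ℓ : (Fin (Module.finrank k V) → k) →ₗ[k] (Fin m → k) :=
    Matrix.toLin' (Matrix.of fun i j => c j ^ (i : ℕ) * B (e j) (e j))
  obtain ⟨b, hb, hb0⟩ := Submodule.exists_mem_ne_zero_of_ne_bot
    (LinearMap.ker_ne_bot_of_finrank_lt (f := ℓ) (by simpa using hm))
  choose a ha using fun i => IsAlgClosed.exists_eq_mul_self (b i)
  refine ⟨∑ i, a i • e i, fun h => hb0 ?_, fun i hi => ?_⟩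
  · have h0 := Fintype.linearIndependent_iff.mp e.linearIndependent a h
    ext i
    rw [ha, h0 i, mul_zero]
    rfl
  · have hpow (j) : (M ^ i) (e j) = c j ^ i • e j := by
      induction i with
      | zero => simp
      | succ i ih => rw [pow_succ', Module.End.mul_apply, ih (by omega), map_smul, he, smul_smul,
          pow_succ]
    have h1 := congrFun (LinearMap.mem_ker.mp hb) ⟨i, hi⟩
    simp only [ℓ, Matrix.toLin'_apply, Matrix.mulVec, dotProduct, Matrix.of_apply,
      Pi.zero_apply] at h1
    rw [← h1]
    simp only [map_sum, map_smul, hpow, LinearMap.sum_apply, LinearMap.smul_apply]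
    refine Finset.sum_congr rfl fun j _ => ?_
    rw [Finset.sum_eq_single j]
    · rw [ha j]
      simp only [smul_eq_mul]
      ring
    · intro l _ hl
      rw [ho _ _ hl]
      simp
    · simp

/-- The span of `v, Mv, …, M^{g-1}v` works: by self-adjointness all the pairings needed are `B (Mˡ
v) v` with `l ≤ 2g - 1`. A linear dependence among these vectors would produce an eigenvector in
their span, and that eigenvector would be isotropic. -/
lemma exists_isotropic_submodule (B : LinearMap.BilinForm k V)
    (hB : ∀ x y, B x y = B y x) (M : Module.End k V) (hM : ∀ x y, B (M x) y = B x (M y))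
    (hiso : ∀ (c : k) x, x ≠ 0 → M x = c • x → B x x ≠ 0) {g : ℕ}
    (hg : 2 * g < Module.finrank k V) :
    ∃ Λ : Submodule k V, Module.finrank k Λ = g ∧
      ∀ x ∈ Λ, ∀ y ∈ Λ, B x y = 0 ∧ B (M x) y = 0 := by
  obtain ⟨v, hv, h⟩ := exists_isotropic_krylov B hB M hM hiso hg
  have hadj (i : ℕ) (x y) : B ((M ^ i) x) y = B x ((M ^ i) y) := by
    induction i generalizing x y with
    | zero => rfl
    | succ i ih => rw [pow_succ, Module.End.mul_apply, ih, hM, ← Module.End.mul_apply, ← pow_succ',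
        pow_succ]
  have hij (i j : ℕ) (hi : i + j < 2 * g) : B ((M ^ i) v) ((M ^ j) v) = 0 := by
    rw [← hadj, ← Module.End.mul_apply, ← pow_add, add_comm]
    exact h _ hi
  have hind : LinearIndependent k fun i : Fin g => (M ^ (i : ℕ)) v := by
    rw [Fintype.linearIndependent_iff]
    intro a ha
    by_contra! hne
    let p : Polynomial k := ∑ i : Fin g, Polynomial.monomial i (a i)
    have hcoeff (i : Fin g) : p.coeff i = a i := by
      simp [p, Polynomial.finsetSum_coeff, Polynomial.coeff_monomial, Fin.val_inj]
    have hp : p ≠ 0 := by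
      obtain ⟨i, hi⟩ := hne
      intro h0
      exact hi (by rw [← hcoeff, h0, Polynomial.coeff_zero])
    -- An index with nonzero coefficient exists, so the subtraction in `g - 1` is not truncated.
    have hg0 : 0 < g := hne.choose.pos
    have hdeg : p.natDegree ≤ g - 1 :=
      Polynomial.natDegree_sum_le_of_forall_le _ _ fun i _ =>
        (Polynomial.natDegree_monomial_le _).trans (by omega)
    have hpv : Polynomial.aeval M p v = 0 := by
      rw [← ha]
      simp [p, Polynomial.aeval_monomial]
    obtain ⟨r, c, hr, hrv, hM'⟩ := exists_eigenvector_of_aeval_eq_zero M hv _ p hp hdeg hpv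
    refine hiso c _ hrv hM' ?_
    rw [Polynomial.aeval_eq_sum_range]
    simp only [LinearMap.sum_apply, LinearMap.smul_apply, map_sum, map_smul]
    refine Finset.sum_eq_zero fun i hi => ?_
    rw [Finset.mem_range] at hi
    rw [Finset.sum_eq_zero, smul_zero]
    intro j hj
    rw [Finset.mem_range] at hj
    rw [hij _ _ (by omega), smul_zero]
  refine ⟨Submodule.span k (Set.range fun i : Fin g => (M ^ (i : ℕ)) v), ?_, ?_⟩
  · rw [finrank_span_eq_card hind, Fintype.card_fin]
  · intro x hx y hy
    induction hx, hy using Submodule.span_induction₂ with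
    | mem_mem x y hx hy =>
      obtain ⟨i, rfl⟩ := hx
      obtain ⟨j, rfl⟩ := hy
      refine ⟨hij _ _ (by omega), ?_⟩
      rw [← Module.End.mul_apply, ← pow_succ']
      exact hij _ _ (by omega)
    | zero_left y hy => simp
    | zero_right x hx => simp
    | add_left x y z _ _ _ h1 h2 => simp [h1, h2]
    | add_right x y z _ _ _ h1 h2 => simp [h1, h2]
    | smul_left r x y _ _ h => simp [h]
    | smul_right r x y _ _ h => simp [h]

end SelfAdjoint

/-! ### Pencils of quadratic forms with smooth base locus -/

section Pencil

open Matrix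

variable {k : Type u} [Field k] {ι : Type} [Fintype ι]

/-- A pencil of quadratic forms, given by symmetric matrices, whose base locus satisfies the
Jacobian criterion at every point. -/
structure IsSmoothPencil (G₁ G₂ : Matrix ι ι k) : Prop where
  symm₁ : G₁.IsSymm
  symm₂ : G₂.IsSymm
  mulVec_ne_zero : ∀ v ≠ 0, v ⬝ᵥ G₁ *ᵥ v = 0 → v ⬝ᵥ G₂ *ᵥ v = 0 → ∀ a b : k, a ≠ 0 ∨ b ≠ 0 →
    (a • G₁ + b • G₂) *ᵥ v ≠ 0

lemma IsSymm.dotProduct_mulVec_comm {G : Matrix ι ι k} (h : G.IsSymm) (x y : ι → k) :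
    x ⬝ᵥ G *ᵥ y = y ⬝ᵥ G *ᵥ x := by
  rw [dotProduct_mulVec, ← mulVec_transpose, h, dotProduct_comm]

namespace IsSmoothPencil

variable {G₁ G₂ : Matrix ι ι k}

lemma add_smul (h : IsSmoothPencil G₁ G₂) (t : k) : IsSmoothPencil (G₁ + t • G₂) G₂ where
  symm₁ := h.symm₁.add (h.symm₂.smul t)
  symm₂ := h.symm₂
  mulVec_ne_zero v hv h₁ h₂ a b hab := by
    rw [add_mulVec, smul_mulVec, dotProduct_add, dotProduct_smul, h₂, smul_zero, add_zero] at h₁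
    have := h.mulVec_ne_zero v hv h₁ h₂ a (a * t + b) (by
      by_cases ha : a = 0
      · simpa [ha] using hab
      · exact .inl ha)
    rwa [smul_add, smul_smul, add_assoc, ← _root_.add_smul]

/-- Otherwise `G₁ + tG₂` kills a nonzero vector `∑ cₘ tᵐ` with polynomial entries. Its lowest
nonzero coefficient satisfies `G₁ cₘ = 0`, and pairing `G₁ cₘ₊₁ + G₂ cₘ = 0` with `cₘ` shows that
both forms vanish at `cₘ`. So `cₘ` violates the Jacobian criterion. -/
lemma exists_det_ne_zero [Infinite k] [DecidableEq ι] (h : IsSmoothPencil G₁ G₂) :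
    ∃ t : k, (G₁ + t • G₂).det ≠ 0 := by
  let N : Matrix ι ι (Polynomial k) :=
    G₁.map Polynomial.C + (Polynomial.X : Polynomial k) • G₂.map Polynomial.C
  have hN (t : k) : N.det.eval t = (G₁ + t • G₂).det := by
    rw [← Polynomial.coe_evalRingHom, RingHom.map_det]
    congr 1
    ext i j
    simp [N]
    ring
  by_contra! H
  have hdet : N.det = 0 := Polynomial.funext fun t => by rw [hN, H, Polynomial.eval_zero]
  obtain ⟨v, hv, hNv⟩ : ∃ v : ι → Polynomial k, v ≠ 0 ∧ N *ᵥ v = 0 :=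
    Matrix.exists_mulVec_eq_zero_iff.mpr hdet
  let c (m : ℕ) : ι → k := fun i => Polynomial.coeff (v i) m
  have hc : ∃ m, c m ≠ 0 := by
    by_contra! hc
    refine hv (funext fun i => Polynomial.ext fun m => ?_)
    exact congrFun (hc m) i
  have hzero : G₁ *ᵥ c 0 = 0 := by
    ext i
    have := congrArg (fun p : Polynomial k => p.coeff 0) (congrFun hNv i)
    simpa [N, mulVec, dotProduct, add_mul, Polynomial.finsetSum_coeff, mul_assoc] using this
  have hsucc (m : ℕ) : G₁ *ᵥ c (m + 1) + G₂ *ᵥ c m = 0 := by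
    ext i
    have := congrArg (fun p : Polynomial k => p.coeff (m + 1)) (congrFun hNv i)
    simpa [N, mulVec, dotProduct, add_mul, Polynomial.finsetSum_coeff, mul_assoc,
      Finset.sum_add_distrib] using this
  classical
  let m := Nat.find hc
  have hm : c m ≠ 0 := Nat.find_spec hc
  have hG₁ : G₁ *ᵥ c m = 0 := by
    rcases hm' : m with _ | l
    · exact hzero
    · have hl : c l = 0 := by
        by_contra hl
        exact Nat.find_min hc (show l < m by omega) hl
      simpa [hl] using hsucc l
  refine h.mulVec_ne_zero (c m) hm (by rw [hG₁, dotProduct_zero]) ?_ 1 0 (.inl one_ne_zero)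
    (by simpa using hG₁)
  have h1 := congrArg (c m ⬝ᵥ ·) (hsucc m)
  simp only [dotProduct_add, dotProduct_zero] at h1
  rwa [IsSymm.dotProduct_mulVec_comm h.symm₁, hG₁, dotProduct_zero, zero_add] at h1

variable [IsAlgClosed k]

/-- Apply `exists_isotropic_submodule` to the form `G₁` and the operator `M = G₁⁻¹ G₂`. An isotropic
eigenvector with eigenvalue `c` would lie in the base locus and in the kernel of `G₂ - c G₁`. -/
lemma exists_isotropic_of_det_ne_zero [DecidableEq ι] (h : IsSmoothPencil G₁ G₂)
    (hdet : G₁.det ≠ 0) {g : ℕ} (hg : 2 * g < Fintype.card ι) :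
    ∃ Λ : Submodule k (ι → k), Module.finrank k Λ = g ∧
      ∀ x ∈ Λ, ∀ y ∈ Λ, x ⬝ᵥ G₁ *ᵥ y = 0 ∧ x ⬝ᵥ G₂ *ᵥ y = 0 := by
  have hu : IsUnit G₁.det := isUnit_iff_ne_zero.mpr hdet
  let B : LinearMap.BilinForm k (ι → k) := Matrix.toBilin' G₁
  have hB (x y) : B x y = x ⬝ᵥ G₁ *ᵥ y := Matrix.toBilin'_apply' ..
  let M : Module.End k (ι → k) := Matrix.toLin' (G₁⁻¹ * G₂)
  have hM (x) : G₁ *ᵥ (M x) = G₂ *ᵥ x := by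
    rw [Matrix.toLin'_apply, mulVec_mulVec, mul_nonsing_inv_cancel_left _ _ hu]
  have hBs (x y) : B x y = B y x := by
    rw [hB, hB, IsSymm.dotProduct_mulVec_comm h.symm₁]
  have hBM (x y) : B x (M y) = x ⬝ᵥ G₂ *ᵥ y := by rw [hB, hM]
  obtain ⟨Λ, hΛ, h0⟩ := exists_isotropic_submodule B hBs M (fun x y => by
      rw [hBM, hBs, hBM, IsSymm.dotProduct_mulVec_comm h.symm₂]) (fun c x hx hMx hxx => by
      have h2 : x ⬝ᵥ G₂ *ᵥ x = 0 := by rw [← hBM, hMx, map_smul, hxx, smul_zero]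
      refine h.mulVec_ne_zero x hx ((hB x x).symm.trans hxx) h2 (-c) 1 (.inr one_ne_zero) ?_
      rw [add_mulVec, smul_mulVec, smul_mulVec, one_smul, ← hM, hMx, mulVec_smul, neg_smul,
        neg_add_cancel]) (g := g) (by simpa using hg)
  refine ⟨Λ, hΛ, fun x hx y hy => ⟨?_, ?_⟩⟩
  · rw [← hB]
    exact (h0 x hx y hy).1
  · rw [← hBM, hBs]
    exact (h0 y hy x hx).2

/-- Common isotropic subspaces depend only on the pencil, so `G₁` may be replaced by an invertible
`G₁ + tG₂`. -/
lemma exists_isotropic (h : IsSmoothPencil G₁ G₂) {g : ℕ} (hg : 2 * g < Fintype.card ι) :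
    ∃ Λ : Submodule k (ι → k), Module.finrank k Λ = g ∧
      ∀ x ∈ Λ, ∀ y ∈ Λ, x ⬝ᵥ G₁ *ᵥ y = 0 ∧ x ⬝ᵥ G₂ *ᵥ y = 0 := by
  classical
  obtain ⟨t, ht⟩ := h.exists_det_ne_zero
  obtain ⟨Λ, hΛ, h0⟩ := (h.add_smul t).exists_isotropic_of_det_ne_zero ht hg
  refine ⟨Λ, hΛ, fun x hx y hy => ⟨?_, (h0 x hx y hy).2⟩⟩
  have := (h0 x hx y hy).1
  rwa [add_mulVec, smul_mulVec, dotProduct_add, dotProduct_smul, (h0 x hx y hy).2, smul_zero,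
    add_zero] at this

end IsSmoothPencil

end Pencil

/-! ### Normal forms of smooth pencils -/

section NormalForm

open Matrix

variable {k : Type u} [Field k] {ι : Type} [Fintype ι]

lemma exists_binary_zero [IsAlgClosed k] (α β γ : k) :
    ∃ s t : k, (s ≠ 0 ∨ t ≠ 0) ∧ α * s ^ 2 + 2 * β * (s * t) + γ * t ^ 2 = 0 := by
  by_cases hα : α = 0
  · exact ⟨1, 0, .inl one_ne_zero, by simp [hα]⟩
  · obtain ⟨δ, hδ⟩ := IsAlgClosed.exists_eq_mul_self (β ^ 2 - α * γ)
    refine ⟨δ - β, α, .inr hα, ?_⟩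
    linear_combination -α * hδ

namespace IsSmoothPencil

variable {G₁ G₂ : Matrix ι ι k}

/-- Every member of the pencil has corank at most one. On its kernel the two forms are linearly
dependent, so a common zero is a zero of a single binary form, which always exists. If `x` and `y`
were independent, this zero would violate the Jacobian criterion. -/
lemma exists_relation [IsAlgClosed k] (h : IsSmoothPencil G₁ G₂) {a b : k}
    (hab : a ≠ 0 ∨ b ≠ 0) {x y : ι → k} (hx : (a • G₁ + b • G₂) *ᵥ x = 0)
    (hy : (a • G₁ + b • G₂) *ᵥ y = 0) : ∃ s t : k, (s ≠ 0 ∨ t ≠ 0) ∧ s • x + t • y = 0 := by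
  have hlin (v) (hv : (a • G₁ + b • G₂) *ᵥ v = 0) :
      a * (v ⬝ᵥ G₁ *ᵥ v) + b * (v ⬝ᵥ G₂ *ᵥ v) = 0 := by
    have := congrArg (v ⬝ᵥ ·) hv
    simpa [add_mulVec, smul_mulVec, dotProduct_add] using this
  have hker (s t : k) : (a • G₁ + b • G₂) *ᵥ (s • x + t • y) = 0 := by
    rw [mulVec_add, mulVec_smul, mulVec_smul, hx, hy, smul_zero, smul_zero, add_zero]
  have hexp {G : Matrix ι ι k} (hG : G.IsSymm) (s t : k) :
      (s • x + t • y) ⬝ᵥ G *ᵥ (s • x + t • y) = (x ⬝ᵥ G *ᵥ x) * s ^ 2 +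
        2 * (x ⬝ᵥ G *ᵥ y) * (s * t) + (y ⬝ᵥ G *ᵥ y) * t ^ 2 := by
    simp only [mulVec_add, mulVec_smul, dotProduct_add, add_dotProduct, smul_dotProduct,
      dotProduct_smul, smul_eq_mul]
    rw [IsSymm.dotProduct_mulVec_comm hG y x]
    ring
  by_contra! H
  rcases hab with ha | hb
  · obtain ⟨s, t, hst, h0⟩ := exists_binary_zero (x ⬝ᵥ G₂ *ᵥ x) (x ⬝ᵥ G₂ *ᵥ y) (y ⬝ᵥ G₂ *ᵥ y)
    rw [← hexp h.symm₂] at h0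
    have h1 := hlin _ (hker s t)
    rw [h0, mul_zero, add_zero] at h1
    exact h.mulVec_ne_zero _ (H s t hst) ((mul_eq_zero.mp h1).resolve_left ha) h0 a b (.inl ha)
      (hker s t)
  · obtain ⟨s, t, hst, h0⟩ := exists_binary_zero (x ⬝ᵥ G₁ *ᵥ x) (x ⬝ᵥ G₁ *ᵥ y) (y ⬝ᵥ G₁ *ᵥ y)
    rw [← hexp h.symm₁] at h0
    have h1 := hlin _ (hker s t)
    rw [h0, mul_zero, zero_add] at h1
    exact h.mulVec_ne_zero _ (H s t hst) h0 ((mul_eq_zero.mp h1).resolve_left hb) a b (.inr hb)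
      (hker s t)

/-- Base change to a basis adapted to a complement of a common isotropic subspace `Λ`; the zero
blocks express that `Λ` is isotropic. The discriminant changes by the square of the determinant `d`
of the base change, so the double cover does not change. -/
lemma exists_normalForm [IsAlgClosed k] [DecidableEq ι] (h : IsSmoothPencil G₁ G₂) {g m : ℕ}
    (hg : 2 * g < Fintype.card ι) (hcard : Fintype.card ι = m + g) :
    ∃ (Φ : ((Fin m ⊕ Fin g) → k) ≃ₗ[k] (ι → k)) (A₁ A₂ : Matrix (Fin m) (Fin m) k)
      (B₁ B₂ : Matrix (Fin m) (Fin g) k) (d : k), d ≠ 0 ∧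
      IsSmoothPencil (fromBlocks A₁ B₁ B₁ᵀ 0) (fromBlocks A₂ B₂ B₂ᵀ 0) ∧
      (∀ v, Φ v ⬝ᵥ G₁ *ᵥ Φ v = v ⬝ᵥ fromBlocks A₁ B₁ B₁ᵀ 0 *ᵥ v) ∧
      (∀ v, Φ v ⬝ᵥ G₂ *ᵥ Φ v = v ⬝ᵥ fromBlocks A₂ B₂ B₂ᵀ 0 *ᵥ v) ∧
      ∀ a b : k, (a • fromBlocks A₁ B₁ B₁ᵀ 0 + b • fromBlocks A₂ B₂ B₂ᵀ 0).det =
        d ^ 2 * (a • G₁ + b • G₂).det := by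
  obtain ⟨Λ, hΛ, hiso⟩ := h.exists_isotropic hg
  obtain ⟨W, hW⟩ := Λ.exists_isCompl
  have hWm : Module.finrank k W = m := by
    have := Submodule.finrank_add_eq_of_isCompl hW
    rw [Module.finrank_fintype_fun_eq_card, hΛ, hcard] at this
    omega
  let b : Module.Basis (Fin m ⊕ Fin g) k (ι → k) :=
    ((Module.finBasisOfFinrankEq k W hWm).prod (Module.finBasisOfFinrankEq k Λ hΛ)).map
      (Submodule.prodEquivOfIsCompl W Λ hW.symm)
  have hbΛ (j : Fin g) : b (Sum.inr j) ∈ Λ := by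
    simp [b]
  let P : Matrix ι (Fin m ⊕ Fin g) k := fun i s => b s i
  have hP (v) : b.equivFun.symm v = P *ᵥ v := by
    ext i
    simp [P, Module.Basis.equivFun_symm_apply, mulVec, dotProduct, mul_comm]
  have hq (G : Matrix ι ι k) (v w) : b.equivFun.symm v ⬝ᵥ G *ᵥ b.equivFun.symm w =
      v ⬝ᵥ (Pᵀ * G * P) *ᵥ w := by
    rw [hP, hP, ← mulVec_mulVec, ← mulVec_mulVec, dotProduct_mulVec v, vecMul_transpose]
  have hentry (G : Matrix ι ι k) (s t) : (Pᵀ * G * P) s t = b s ⬝ᵥ G *ᵥ b t := by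
    have := hq G (Pi.single s 1) (Pi.single t 1)
    simpa using this.symm
  have hblocks {G : Matrix ι ι k} (hG : G.IsSymm) (h0 : ∀ x ∈ Λ, ∀ y ∈ Λ, x ⬝ᵥ G *ᵥ y = 0) :
      Pᵀ * G * P = fromBlocks (Pᵀ * G * P).toBlocks₁₁ (Pᵀ * G * P).toBlocks₁₂
        (Pᵀ * G * P).toBlocks₁₂ᵀ 0 := by
    conv_lhs => rw [← fromBlocks_toBlocks (Pᵀ * G * P)]
    congr 1
    · ext i j
      rw [transpose_apply]
      simp only [toBlocks₂₁, toBlocks₁₂, of_apply, hentry]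
      rw [IsSymm.dotProduct_mulVec_comm hG]
    · ext i j
      simp only [toBlocks₂₂, of_apply, hentry]
      exact h0 _ (hbΛ i) _ (hbΛ j)
  have hb₁ := hblocks h.symm₁ fun x hx y hy => (hiso x hx y hy).1
  have hb₂ := hblocks h.symm₂ fun x hx y hy => (hiso x hx y hy).2
  have hsymm {G : Matrix ι ι k} (hG : G.IsSymm) : (Pᵀ * G * P).IsSymm := by
    rw [IsSymm, transpose_mul, transpose_mul, transpose_transpose, hG, Matrix.mul_assoc]
  have hcomb (a c : k) : a • (Pᵀ * G₁ * P) + c • (Pᵀ * G₂ * P) =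
      Pᵀ * (a • G₁ + c • G₂) * P := by
    simp [Matrix.mul_add, Matrix.add_mul]
  let e : (Fin m ⊕ Fin g) ≃ ι := b.indexEquiv (Pi.basisFun k ι)
  have hd : (P.submatrix id e.symm).det ≠ 0 := by
    have := (Pi.basisFun k ι).isUnit_det (b.reindex e)
    rw [Module.Basis.det_apply] at this
    convert this.ne_zero using 2
    ext i j
    simp only [Module.Basis.toMatrix_apply, Pi.basisFun_repr, Module.Basis.coe_reindex]
    rfl
  refine ⟨b.equivFun.symm, (Pᵀ * G₁ * P).toBlocks₁₁, (Pᵀ * G₂ * P).toBlocks₁₁,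
    (Pᵀ * G₁ * P).toBlocks₁₂, (Pᵀ * G₂ * P).toBlocks₁₂, (P.submatrix id e.symm).det, hd, ?_,
    fun v => ?_, fun v => ?_, fun a c => ?_⟩
  · rw [← hb₁, ← hb₂]
    refine ⟨hsymm h.symm₁, hsymm h.symm₂, fun v hv h₁ h₂ a c hac h0 => ?_⟩
    rw [← hq] at h₁ h₂
    refine h.mulVec_ne_zero _ (b.equivFun.symm.map_ne_zero_iff.mpr hv) h₁ h₂ a c hac ?_
    rw [hcomb, ← mulVec_mulVec, ← mulVec_mulVec, ← hP] at h0
    -- From `Pᵀ u = 0` conclude `u = 0`: the columns of `P` span, so `u` is orthogonal to every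
    -- vector.
    refine dotProduct_eq_zero _ fun y => ?_
    obtain ⟨z, rfl⟩ := b.equivFun.symm.surjective y
    rw [hP z, dotProduct_mulVec, ← mulVec_transpose, h0, zero_dotProduct]
  · rw [hq, ← hb₁]
  · rw [hq, ← hb₂]
  · rw [← hb₁, ← hb₂, hcomb, ← det_submatrix_equiv_self e.symm]
    have : (Pᵀ * (a • G₁ + c • G₂) * P).submatrix e.symm e.symm =
        (P.submatrix id e.symm)ᵀ * (a • G₁ + c • G₂) * P.submatrix id e.symm := by
      rfl
    rw [this, det_mul, det_mul, det_transpose]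
    ring

end IsSmoothPencil

variable {r s : Type} [Fintype r] [Fintype s] [DecidableEq r] [DecidableEq s]

/-- The columns span the kernel of the transpose of `fromRows X Y`, for `Y` invertible. -/
def kerMatrix (X : Matrix r s k) (Y : Matrix s s k) : Matrix (r ⊕ s) r k :=
  fromRows 1 (-(X * Y⁻¹)ᵀ)

lemma transpose_kerMatrix_mul (X : Matrix r s k) {Y : Matrix s s k} (hY : Y.det ≠ 0) :
    (kerMatrix X Y)ᵀ * fromRows X Y = 0 := by
  rw [kerMatrix, transpose_fromRows, fromCols_mul_fromRows, transpose_neg, transpose_transpose,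
    transpose_one, Matrix.one_mul, Matrix.neg_mul, nonsing_inv_mul_cancel_right _ _ (isUnit_iff_ne_zero.mpr hY),
    add_neg_cancel]

lemma mulVec_transpose_eq_zero_iff (X : Matrix r s k) {Y : Matrix s s k} (hY : Y.det ≠ 0)
    (w : r ⊕ s → k) : (fromRows X Y)ᵀ *ᵥ w = 0 ↔ kerMatrix X Y *ᵥ (w ∘ Sum.inl) = w := by
  constructor
  · intro h
    have h1 : Xᵀ *ᵥ (w ∘ Sum.inl) + Yᵀ *ᵥ (w ∘ Sum.inr) = 0 := by
      rw [← h, transpose_fromRows, ← fromCols_mulVec_sumElim, Sum.elim_comp_inl_inr]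
    have hY' : IsUnit Yᵀ.det := by rw [det_transpose]; exact isUnit_iff_ne_zero.mpr hY
    have h2 := congrArg (Yᵀ⁻¹ *ᵥ ·) h1
    simp only [mulVec_add, mulVec_mulVec, nonsing_inv_mul _ hY', one_mulVec, mulVec_zero] at h2
    rw [kerMatrix, fromRows_mulVec]
    conv_rhs => rw [← Sum.elim_comp_inl_inr w]
    rw [one_mulVec, neg_mulVec, transpose_mul, transpose_nonsing_inv]
    rw [eq_neg_of_add_eq_zero_right h2]
  · intro h
    rw [← h, mulVec_mulVec, ← transpose_transpose (kerMatrix X Y), ← transpose_mul,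
      transpose_kerMatrix_mul X hY, transpose_zero, zero_mulVec]

/-- A unipotent base change `U`, whose first columns are `kerMatrix X Y`, turns the rows `X, Y` into
`0, Y`. Column operations using `Y` then clear the lower rows of the transformed `A`. What remains
is the restriction of `A` to the kernel next to the antidiagonal block of `Y` and `Yᵀ`. -/
lemma det_fromBlocks_fromRows (A : Matrix (r ⊕ s) (r ⊕ s) k) (X : Matrix r s k) {Y : Matrix s s k}
    (hY : Y.det ≠ 0) :
    (fromBlocks A (fromRows X Y) (fromRows X Y)ᵀ 0).det =
      (fromBlocks 0 1 1 0 : Matrix (s ⊕ s) (s ⊕ s) k).det * Y.det ^ 2 *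
        ((kerMatrix X Y)ᵀ * A * kerMatrix X Y).det := by
  have hu : IsUnit Y.det := isUnit_iff_ne_zero.mpr hY
  let Z := X * Y⁻¹
  have hZ : Z * Y = X := nonsing_inv_mul_cancel_right _ _ hu
  let U : Matrix (r ⊕ s) (r ⊕ s) k := fromBlocks 1 0 (-Zᵀ) 1
  have hU : U = fromCols (kerMatrix X Y) (fromRows 0 1) := by
    simp only [U, kerMatrix, fromCols_fromRows_eq_fromBlocks]
    rfl
  let D := Uᵀ * A * U
  have hD : D.toBlocks₁₁ = (kerMatrix X Y)ᵀ * A * kerMatrix X Y := by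
    rw [show D = (fromCols (kerMatrix X Y) (fromRows 0 1))ᵀ * A *
      fromCols (kerMatrix X Y) (fromRows 0 1) from hU ▸ rfl, transpose_fromCols,
      fromRows_mul, fromRows_mul_fromCols, toBlocks_fromBlocks₁₁]
  let V : Matrix s (r ⊕ s) k := -(Y⁻¹ * fromCols D.toBlocks₂₁ D.toBlocks₂₂)
  have hUB : Uᵀ * fromRows X Y = fromRows 0 Y := by
    simp [U, fromBlocks_transpose, fromBlocks_mul_fromRows, hZ]
  have hBU : (fromRows X Y)ᵀ * U = (fromRows 0 Y)ᵀ := by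
    rw [← hUB, transpose_mul, transpose_transpose]
  have hmul : fromBlocks Uᵀ 0 0 (1 : Matrix s s k) *
      fromBlocks A (fromRows X Y) (fromRows X Y)ᵀ 0 * fromBlocks U 0 V 1 =
      fromBlocks (fromBlocks D.toBlocks₁₁ D.toBlocks₁₂ 0 0) (fromRows 0 Y) (fromRows 0 Y)ᵀ 0 := by
    rw [fromBlocks_multiply, fromBlocks_multiply]
    congr 1
    · have hYV : Y * V = -fromCols D.toBlocks₂₁ D.toBlocks₂₂ := by
        rw [Matrix.mul_neg, mul_nonsing_inv_cancel_left _ _ hu]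
      have h1 : Uᵀ * A * U + fromRows 0 Y * V =
          fromBlocks D.toBlocks₁₁ D.toBlocks₁₂ 0 0 := by
        rw [fromRows_mul, hYV, Matrix.zero_mul]
        change D + _ = _
        ext (i | i) (j | j) <;> simp [toBlocks₁₁, toBlocks₁₂, toBlocks₂₁, toBlocks₂₂]
      simpa [hUB] using h1
    · simp [hUB]
    · simp [hBU]
    · simp
  have hdetU : U.det = 1 := by
    simp [U]
  have h1 := congrArg det hmul
  rw [det_mul, det_mul, det_fromBlocks_zero₁₂, det_fromBlocks_zero₁₂, det_transpose, hdetU, det_one,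
    one_mul, one_mul, mul_one] at h1
  have hre : (fromBlocks (fromBlocks D.toBlocks₁₁ D.toBlocks₁₂ 0 0) (fromRows 0 Y)
      (fromRows 0 Y)ᵀ 0).submatrix (Equiv.sumAssoc r s s).symm (Equiv.sumAssoc r s s).symm =
      fromBlocks D.toBlocks₁₁ (fromCols D.toBlocks₁₂ 0) 0 (fromBlocks 0 Y Yᵀ 0) := by
    ext (i | i | i) (j | j | j) <;> rfl
  have hJ : fromBlocks 0 Y Yᵀ 0 = fromBlocks Y 0 0 Yᵀ * fromBlocks 0 1 1 0 := by
    simp [fromBlocks_multiply]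
  rw [h1, ← det_submatrix_equiv_self (Equiv.sumAssoc r s s).symm, hre, det_fromBlocks_zero₂₁, hJ,
    det_mul, det_fromBlocks_zero₂₁, det_transpose, hD]
  ring

lemma det_swap_sq : (fromBlocks 0 1 1 0 : Matrix (s ⊕ s) (s ⊕ s) k).det ≠ 0 := by
  have : (fromBlocks 0 1 1 0 : Matrix (s ⊕ s) (s ⊕ s) k) * fromBlocks 0 1 1 0 = 1 := by
    simp [fromBlocks_multiply]
  exact (isUnit_iff_ne_zero.mp (isUnit_det_of_left_inverse this))

/-- If the restricted form vanished, every vector `w u` of the plane would extend to a kernel vector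
`(w u, z u)` of the block matrix: `z u` solves the rows of `Y`, and the remaining two rows are the
vanishing of the form. The kernel would then contain two independent vectors. -/
lemma transpose_kerMatrix_mul_mul_ne_zero {A : Matrix (Fin 2 ⊕ s) (Fin 2 ⊕ s) k}
    {X : Matrix (Fin 2) s k} {Y : Matrix s s k} (hdet : Y.det ≠ 0)
    (h : ∀ x y, fromBlocks A (fromRows X Y) (fromRows X Y)ᵀ 0 *ᵥ x = 0 →
      fromBlocks A (fromRows X Y) (fromRows X Y)ᵀ 0 *ᵥ y = 0 →
      ∃ a b : k, (a ≠ 0 ∨ b ≠ 0) ∧ a • x + b • y = 0) :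
    (kerMatrix X Y)ᵀ * A * kerMatrix X Y ≠ 0 := by
  intro hR
  let w (u : Fin 2 → k) : Fin 2 ⊕ s → k := kerMatrix X Y *ᵥ u
  have hw (u) : w u ∘ Sum.inl = u := by
    ext i
    simp [w, kerMatrix, fromRows_mulVec]
  let z (u : Fin 2 → k) : s → k := -(Y⁻¹ *ᵥ ((A *ᵥ w u) ∘ Sum.inr))
  have hker (u) : fromBlocks A (fromRows X Y) (fromRows X Y)ᵀ 0 *ᵥ Sum.elim (w u) (z u) = 0 := by
    have h1 : (fromRows X Y)ᵀ *ᵥ w u = 0 := by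
      rw [mulVec_transpose_eq_zero_iff X hdet, hw]
    have h2 : A *ᵥ w u + fromRows X Y *ᵥ z u = 0 := by
      have hr : (A *ᵥ w u) ∘ Sum.inl - (X * Y⁻¹) *ᵥ ((A *ᵥ w u) ∘ Sum.inr) = 0 := by
        have := congrArg (· *ᵥ u) hR
        simp only [zero_mulVec, ← mulVec_mulVec] at this
        rw [kerMatrix, transpose_fromRows, ← kerMatrix,
          ← Sum.elim_comp_inl_inr (A *ᵥ kerMatrix X Y *ᵥ u), fromCols_mulVec_sumElim] at this
        simpa [w, neg_mulVec, sub_eq_add_neg] using this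
      rw [fromRows_mulVec]
      ext (i | i)
      · have := congrFun hr i
        simpa [z, mulVec_neg, mulVec_mulVec, sub_eq_add_neg] using this
      · simp [z, mulVec_neg, mulVec_mulVec, mul_nonsing_inv _ (isUnit_iff_ne_zero.mpr hdet)]
    rw [fromBlocks_mulVec]
    simp only [Sum.elim_comp_inl, Sum.elim_comp_inr, h1, h2]
    ext (i | i) <;> simp
  obtain ⟨a, b, hab, h0⟩ := h _ _ (hker ![1, 0]) (hker ![0, 1])
  have hl (u) (i : Fin 2) : Sum.elim (w u) (z u) (Sum.inl (Sum.inl i)) = u i := congrFun (hw u) i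
  have ha := congrFun h0 (Sum.inl (Sum.inl 0))
  have hb := congrFun h0 (Sum.inl (Sum.inl 1))
  simp only [Pi.add_apply, Pi.smul_apply, hl] at ha hb
  simp at ha hb
  simp [ha, hb] at hab

lemma exists_equiv_det_submatrix_ne_zero {g : ℕ} (B : Matrix (Fin (g + 2)) (Fin g) k)
    (hB : ∀ z, B *ᵥ z = 0 → z = 0) :
    ∃ e : Fin 2 ⊕ Fin g ≃ Fin (g + 2), (B.submatrix (fun j => e (Sum.inr j)) id).det ≠ 0 := by
  have hrank : Module.finrank k (Submodule.span k (Set.range B.row)) = g := by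
    rw [← rank_eq_finrank_span_row, rank, LinearMap.finrank_range_of_inj]
    · simp
    · rw [← LinearMap.ker_eq_bot, LinearMap.ker_eq_bot']
      exact hB
  obtain ⟨κ, a, ha, hspan, hli⟩ := exists_linearIndependent' k B.row
  have : Finite κ := Finite.of_injective a ha
  have := Fintype.ofFinite κ
  have hκ : Fintype.card κ = g := by
    rw [← finrank_span_eq_card hli, hspan, hrank]
  let f : Fin g → Fin (g + 2) := a ∘ (Fintype.equivFinOfCardEq hκ).symm
  have hf : Function.Injective f := ha.comp (Equiv.injective _)
  have hcompl : Fintype.card {i // ¬ i ∈ Set.range f} = 2 := by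
    rw [Fintype.card_subtype_compl, Fintype.card_fin, Set.card_range_of_injective hf,
      Fintype.card_fin]
    omega
  let e : Fin 2 ⊕ Fin g ≃ Fin (g + 2) := (Equiv.sumComm _ _).trans
    (((Equiv.ofInjective f hf).sumCongr (Fintype.equivFinOfCardEq hcompl).symm).trans
      (Equiv.sumCompl (· ∈ Set.range f)))
  refine ⟨e, ?_⟩
  have hli' : LinearIndependent k (B.submatrix (fun j => e (Sum.inr j)) id).row :=
    hli.comp _ (Equiv.injective (Fintype.equivFinOfCardEq hκ).symm)
  rw [linearIndependent_rows_iff_isUnit, isUnit_iff_isUnit_det] at hli'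
  exact hli'.ne_zero

end NormalForm

/-! ### Constructible families of matrices -/

section MatrixFamilies

variable {k : Type u} [Field k] {V : Type u} [AddCommGroup V] [Module k V]
  {l m n : Type} [Fintype m]

lemma DefFun.det [Fintype n] [DecidableEq n] {F : V → Matrix n n k} (hF : ∀ i j, DefFun fun x => F x i j) :
    DefFun fun x => (F x).det := by
  simp only [Matrix.det_apply']
  exact .sum _ fun σ _ => .mul (.const _) (.prod _ fun i _ => hF _ _)

/-- Cramer's rule, valid for singular matrices as well since both inverses are then zero. -/
lemma DefFun.matrix_inv [Fintype n] [DecidableEq n] {F : V → Matrix n n k}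
    (hF : ∀ i j, DefFun fun x => F x i j) (i j : n) : DefFun fun x => (F x)⁻¹ i j := by
  simp only [Matrix.inv_def, Matrix.smul_apply, Ring.inverse_eq_inv, smul_eq_mul,
    Matrix.adjugate_apply]
  refine (DefFun.det hF).inv.mul (.det fun a b => ?_)
  by_cases h : a = j
  · simp only [h, Matrix.updateRow_self]
    exact .const _
  · simp only [Matrix.updateRow_ne h]
    exact hF a b

lemma DefFun.matrix_mul {F : V → Matrix l m k} {H : V → Matrix m n k}
    (hF : ∀ i j, DefFun fun x => F x i j) (hH : ∀ i j, DefFun fun x => H x i j) (i : l) (j : n) :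
    DefFun fun x => (F x * H x) i j := by
  simp only [Matrix.mul_apply]
  exact .sum _ fun a _ => (hF i a).mul (hH a j)

lemma DefFun.mulVec {F : V → Matrix l m k} {v : V → m → k}
    (hF : ∀ i j, DefFun fun x => F x i j) (hv : ∀ i, DefFun fun x => v x i) (i : l) :
    DefFun fun x => (F x).mulVec (v x) i := by
  simp only [Matrix.mulVec, dotProduct]
  exact .sum _ fun a _ => (hF i a).mul (hv a)

lemma DefFun.dotProduct {v w : V → m → k} (hv : ∀ i, DefFun fun x => v x i)
    (hw : ∀ i, DefFun fun x => w x i) : DefFun fun x => v x ⬝ᵥ w x := by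
  simp only [_root_.dotProduct]
  exact .sum _ fun a _ => (hv a).mul (hw a)

lemma DefFun.kerMatrix {r : Type} [Fintype r] [DecidableEq r] [DecidableEq m]
    {X : V → Matrix r m k} {Y : V → Matrix m m k}
    (hX : ∀ i j, DefFun fun x => X x i j) (hY : ∀ i j, DefFun fun x => Y x i j) (i : r ⊕ m)
    (j : r) : DefFun fun x => kerMatrix (X x) (Y x) i j := by
  rcases i with i | i
  · exact .const _
  · exact (DefFun.matrix_mul hX (DefFun.matrix_inv hY) j i).neg

lemma DefMap.vec2 {a b : V → k} (ha : DefFun a) (hb : DefFun b) :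
    DefMap k fun x => ![a x, b x] :=
  .pi (Fin.forall_fin_two.mpr ⟨ha, hb⟩)

end MatrixFamilies

/-! ### Projectivized cones that may contain the origin -/

section Cones

variable {k : Type u} [Field k] [IsAlgClosed k] {V : Type u} [AddCommGroup V] [Module k V]
  [FiniteDimensional k V] {V' : Type u} [AddCommGroup V'] [Module k V'] [FiniteDimensional k V']
  {P : Type u} [AddCommGroup P] [Module k P] [FiniteDimensional k P]

/-- A variant of `mu_cone_eq` for cones that may contain the origin. -/
lemma mu_cone_congr {ν : V → k} {ν' : V' → k} (hν : IsNorm ν) (hν' : IsNorm ν')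
    {S : Set (V × P)} {S' : Set (V' × P)} (hS : IsCon k S) (hS' : IsCon k S')
    (hcone : ∀ (c : k) x p, c ≠ 0 → (x, p) ∈ S → (c • x, p) ∈ S)
    (hcone' : ∀ (c : k) x p, c ≠ 0 → (x, p) ∈ S' → (c • x, p) ∈ S')
    {φ : V × P → V'} {ψ : V' × P → V} (hφ : DefMap k φ) (hψ : DefMap k ψ)
    (hφc : ∀ (c : k) x p, φ (c • x, p) = c • φ (x, p))
    (hψc : ∀ (c : k) x p, ψ (c • x, p) = c • ψ (x, p))
    (h1 : ∀ x p, (x, p) ∈ S → (φ (x, p), p) ∈ S' ∧ ψ (φ (x, p), p) = x)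
    (h2 : ∀ y p, (y, p) ∈ S' → (ψ (y, p), p) ∈ S ∧ φ (ψ (y, p), p) = y) :
    mu k {x | x ∈ S ∧ ν x.1 = 1} = mu k {x | x ∈ S' ∧ ν' x.1 = 1} := by
  have hφ0 (p) : φ (0, p) = 0 := by simpa using hφc 0 0 p
  have hψ0 (p) : ψ (0, p) = 0 := by simpa using hψc 0 0 p
  have key := mu_cone_eq hν hν' (S := {x | x ∈ S ∧ ν x.1 ≠ 0}) (S' := {x | x ∈ S' ∧ ν' x.1 ≠ 0})
    (hS.and (.ne_zero (hν.defFun.comp .fst))) (hS'.and (.ne_zero (hν'.defFun.comp .fst)))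
    (fun c x p hc h => ⟨hcone c x p hc h.1, by
      simpa only [hν.map_smul] using mul_ne_zero hc h.2⟩)
    (fun c x p hc h => ⟨hcone' c x p hc h.1, by
      simpa only [hν'.map_smul] using mul_ne_zero hc h.2⟩)
    (fun p h => h.2 hν.zero) (fun p h => h.2 hν'.zero) hφ hψ hφc hψc
    (fun x p h => ⟨⟨(h1 x p h.1).1, fun h0 => h.2 (by
      change ν x = 0
      rw [← (h1 x p h.1).2, hν'.eq_zero (φ (x, p)) h0, hψ0, hν.zero])⟩, (h1 x p h.1).2⟩)
    (fun y p h => ⟨⟨(h2 y p h.1).1, fun h0 => h.2 (by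
      change ν' y = 0
      rw [← (h2 y p h.1).2, hν.eq_zero (ψ (y, p)) h0, hφ0, hν'.zero])⟩, (h2 y p h.1).2⟩)
  convert key using 2
  · ext x
    exact ⟨fun h => ⟨⟨h.1, h.2 ▸ one_ne_zero⟩, h.2⟩, fun h => ⟨h.1.1, h.2⟩⟩
  · ext x
    exact ⟨fun h => ⟨⟨h.1, h.2 ▸ one_ne_zero⟩, h.2⟩, fun h => ⟨h.1.1, h.2⟩⟩

end Cones

/-! ### Families of zero-dimensional quadrics -/

section Conic

variable {k : Type u} [Field k]

open Classical in
/-- The square root of the discriminant determined by a zero of a binary quadratic form. -/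
def rootOfZero (α β : k) (u : Fin 2 → k) : k :=
  if u 1 = 0 then -β else (α * u 0 + β * u 1) / u 1

open Classical in
/-- The zero of a binary quadratic form determined by a square root of the discriminant. -/
def zeroOfRoot (α β γ y : k) : Fin 2 → k :=
  if α = 0 then if y = -β then ![1, 0] else ![-γ, 2 * β] else ![y - β, α]

lemma rootOfZero_smul {α β c : k} (hc : c ≠ 0) (u : Fin 2 → k) :
    rootOfZero α β (c • u) = rootOfZero α β u := by
  simp only [rootOfZero, Pi.smul_apply, smul_eq_mul]
  by_cases h : u 1 = 0
  · rw [if_pos h, if_pos (by rw [h, mul_zero])]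
  · rw [if_neg h, if_neg (mul_ne_zero hc h)]
    field_simp

/-- At a zero of the form, `(α u₀ + β u₁)² = (β² - αγ) u₁²`. If `u₁ = 0`, then `α = 0` and `-β` is a
square root of the discriminant. -/
lemma rootOfZero_sq {α β γ : k} {u : Fin 2 → k} (hu : u ≠ 0)
    (h : α * u 0 ^ 2 + 2 * β * (u 0 * u 1) + γ * u 1 ^ 2 = 0) :
    rootOfZero α β u ^ 2 = β ^ 2 - α * γ := by
  rw [rootOfZero]
  split_ifs with h1
  · have h0 : u 0 ≠ 0 := fun h0 => hu (by ext i; fin_cases i <;> assumption)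
    have hα : α = 0 := by simpa [h1, h0] using h
    rw [hα]
    ring
  · field_simp
    linear_combination α * h

variable {P : Type u} [AddCommGroup P] [Module k P]

lemma DefFun.rootOfZero {α β : P → k} {u : P → Fin 2 → k} (hα : DefFun α) (hβ : DefFun β)
    (hu : DefMap k u) : DefFun fun p => rootOfZero (α p) (β p) (u p) := by
  classical
  exact .ite (.eq_zero (hu.apply 1)) hβ.neg
    (.div (.add (hα.mul (hu.apply 0)) (hβ.mul (hu.apply 1))) (hu.apply 1))

lemma DefMap.zeroOfRoot {α β γ y : P → k} (hα : DefFun α) (hβ : DefFun β) (hγ : DefFun γ)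
    (hy : DefFun y) : DefMap k fun p => zeroOfRoot (α p) (β p) (γ p) (y p) := by
  classical
  exact .ite (.eq_zero hα) (.ite (.eq hy hβ.neg) (.const _)
    (.vec2 hγ.neg (.mul (.const 2) hβ))) (.vec2 (hy.sub hβ) hα)

variable [CharZero k]

/-- The subtle case is `α = 0`: the zeros are `[1 : 0]`, matched with the root `-β`, and `[-γ :
2β]`, matched with `β`. They are distinguished by `β ≠ -β` unless `β = 0`, when they coincide
because the form is nonzero. -/
lemma zeroOfRoot_rootOfZero {α β γ : k} (hne : ¬ (α = 0 ∧ β = 0 ∧ γ = 0)) {u : Fin 2 → k}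
    (hu : u ≠ 0) (h : α * u 0 ^ 2 + 2 * β * (u 0 * u 1) + γ * u 1 ^ 2 = 0) :
    ∃ c : k, c ≠ 0 ∧ zeroOfRoot α β γ (rootOfZero α β u) = c • u := by
  rw [zeroOfRoot, rootOfZero]
  by_cases h1 : u 1 = 0
  · have h0 : u 0 ≠ 0 := fun h0 => hu (by ext i; fin_cases i <;> assumption)
    have hα : α = 0 := by simpa [h1, h0] using h
    refine ⟨(u 0)⁻¹, inv_ne_zero h0, ?_⟩
    rw [if_pos hα, if_pos h1, if_pos rfl]
    ext i
    fin_cases i <;> simp [h0, h1]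
  · rw [if_neg h1]
    by_cases hα : α = 0
    · have hβ : 2 * β * u 0 + γ * u 1 = 0 := by
        refine (mul_eq_zero.mp (?_ : (2 * β * u 0 + γ * u 1) * u 1 = 0)).resolve_right h1
        rw [hα] at h
        linear_combination h
      have hβ0 : β ≠ 0 := by
        rintro rfl
        refine hne ⟨hα, rfl, ?_⟩
        simpa [h1] using hβ
      have hroot : (α * u 0 + β * u 1) / u 1 = β := by
        rw [hα, zero_mul, zero_add, mul_div_cancel_right₀ _ h1]
      rw [if_pos hα, hroot, if_neg (by rwa [eq_comm, neg_eq_self])]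
      refine ⟨2 * β / u 1, by simp [hβ0, h1], ?_⟩
      ext i
      fin_cases i
      · simp
        field_simp
        linear_combination -hβ
      · simp [h1]
    · rw [if_neg hα]
      refine ⟨α / u 1, by simp [hα, h1], ?_⟩
      ext i
      fin_cases i
      · simp
        field_simp
        ring
      · simp [h1]

lemma zeroOfRoot_spec {α β γ y : k}
    (hy : y ^ 2 = β ^ 2 - α * γ) : zeroOfRoot α β γ y ≠ 0 ∧
      α * zeroOfRoot α β γ y 0 ^ 2 + 2 * β * (zeroOfRoot α β γ y 0 * zeroOfRoot α β γ y 1) +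
        γ * zeroOfRoot α β γ y 1 ^ 2 = 0 ∧
      rootOfZero α β (zeroOfRoot α β γ y) = y := by
  rw [zeroOfRoot]
  by_cases hα : α = 0
  · rw [if_pos hα]
    by_cases hyβ : y = -β
    · rw [if_pos hyβ]
      refine ⟨fun h => one_ne_zero (congrFun h 0), by simp [hα], ?_⟩
      simp [rootOfZero, hyβ]
    · rw [if_neg hyβ]
      have hyβ' : y = β := by
        have : (y - β) * (y + β) = 0 := by
          rw [hα] at hy
          linear_combination hy
        exact sub_eq_zero.mp ((mul_eq_zero.mp this).resolve_right fun h => hyβ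
          (eq_neg_of_add_eq_zero_left h))
      have hβ : β ≠ 0 := fun h => hyβ (by rw [hyβ', h, neg_zero])
      refine ⟨fun h => ?_, ?_, ?_⟩
      · simpa [hβ] using congrFun h 1
      · simp [hα]
        ring
      · simp [rootOfZero, hα, hβ, hyβ']
  · rw [if_neg hα]
    refine ⟨fun h => hα (congrFun h 1), ?_, ?_⟩
    · simp
      linear_combination α * hy
    · simp [rootOfZero, hα]
      field_simp
      ring

/-- The zeros of a nonzero binary form on `ℙ¹` correspond to the square roots of its discriminant,
including the double zero over discriminant `0`. The factor `m` absorbs a square by which the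
equation of the double cover may differ from the discriminant. -/
lemma mu_conic [IsAlgClosed k] [FiniteDimensional k P] {T : Set P} (hT : IsCon k T)
    {α β γ m : P → k} (hα : DefFun α) (hβ : DefFun β) (hγ : DefFun γ) (hm : DefFun m)
    (hne : ∀ p ∈ T, ¬ (α p = 0 ∧ β p = 0 ∧ γ p = 0)) (hm0 : ∀ p ∈ T, m p ≠ 0) :
    mu k {x : (Fin 2 → k) × P | (x.2 ∈ T ∧ α x.2 * x.1 0 ^ 2 + 2 * β x.2 * (x.1 0 * x.1 1) +
      γ x.2 * x.1 1 ^ 2 = 0) ∧ lead x.1 = 1} =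
    mu k {x : P × k | x.1 ∈ T ∧ x.2 ^ 2 = m x.1 ^ 2 * (β x.1 ^ 2 - α x.1 * γ x.1)} := by
  have hn := isNorm_lead (k := k) 2
  have h0 : DefFun fun x : (Fin 2 → k) × P => x.1 0 := DefMap.fst.apply 0
  have h1 : DefFun fun x : (Fin 2 → k) × P => x.1 1 := DefMap.fst.apply 1
  have hsnd : DefFun fun x : P × k => x.2 := DefMap.snd.defFun
  have hz : DefMap k fun x : P × k => zeroOfRoot (α x.1) (β x.1) (γ x.1) (x.2 / m x.1) :=
    .zeroOfRoot (hα.comp .fst) (hβ.comp .fst) (hγ.comp .fst) (hsnd.div (hm.comp .fst))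
  refine mu_eq_of_bij
    (φ := fun x => (x.2, m x.2 * rootOfZero (α x.2) (β x.2) x.1))
    (ψ := fun x => ((lead (zeroOfRoot (α x.1) (β x.1) (γ x.1) (x.2 / m x.1)))⁻¹ •
      zeroOfRoot (α x.1) (β x.1) (γ x.1) (x.2 / m x.1), x.1)) ?_ ?_ ?_ ?_ ?_ ?_
  · exact ((hT.preimage .snd).and (.eq_zero (.add (.add ((hα.comp .snd).mul (h0.pow 2))
      (((DefFun.const 2).mul (hβ.comp .snd)).mul (h0.mul h1))) ((hγ.comp .snd).mul (h1.pow 2))))).and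
      (.eq (hn.defFun.comp .fst) (.const 1))
  · exact (hT.preimage .fst).and (.eq (hsnd.pow 2) (((hm.comp .fst).pow 2).mul
      (((hβ.comp .fst).pow 2).sub ((hα.comp .fst).mul (hγ.comp .fst)))))
  · exact .prodMk .snd (.of_defFun ((hm.comp .snd).mul
      (.rootOfZero (hα.comp .snd) (hβ.comp .snd) .fst)))
  · exact .prodMk (.smul (hn.defFun.comp hz).inv hz) .fst
  · rintro ⟨u, p⟩ ⟨⟨hp, hu⟩, hl⟩
    simp only at hp hu hl ⊢
    have hu0 : u ≠ 0 := by
      rintro rfl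
      rw [hn.zero] at hl
      exact zero_ne_one hl
    refine ⟨⟨hp, ?_⟩, ?_⟩
    · simp only
      rw [mul_pow, rootOfZero_sq hu0 hu]
    · obtain ⟨c, hc, h⟩ := zeroOfRoot_rootOfZero (hne p hp) hu0 hu
      rw [mul_div_cancel_left₀ _ (hm0 p hp), h, hn.map_smul, hl, mul_one, smul_smul,
        inv_mul_cancel₀ hc, one_smul]
  · rintro ⟨p, y⟩ ⟨hp, hy⟩
    simp only at hp hy ⊢
    have hm' := hm0 p hp
    obtain ⟨hz0, hzq, hzr⟩ := zeroOfRoot_spec (α := α p) (β := β p) (γ := γ p)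
      (y := y / m p) (by
      rw [div_pow, hy, mul_div_cancel_left₀ _ (pow_ne_zero 2 hm')])
    have hl : lead (zeroOfRoot (α p) (β p) (γ p) (y / m p)) ≠ 0 := fun h => hz0 (hn.eq_zero _ h)
    refine ⟨⟨⟨hp, ?_⟩, ?_⟩, ?_⟩
    · simp only [Pi.smul_apply, smul_eq_mul]
      linear_combination (lead (zeroOfRoot (α p) (β p) (γ p) (y / m p)))⁻¹ ^ 2 * hzq
    · simp only
      rw [hn.map_smul, inv_mul_cancel₀ hl]
    · rw [rootOfZero_smul (inv_ne_zero hl), hzr, mul_div_cancel₀ _ hm']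

end Conic

/-! ### Parametrizing the kernel of a matrix with a nonvanishing maximal minor -/

section KernelParametrization

open Matrix

variable {k : Type u} [Field k] {g : ℕ} (e : Fin 2 ⊕ Fin g ≃ Fin (g + 2))

/-- A maximal minor, as a square matrix. -/
def minor (B : Matrix (Fin (g + 2)) (Fin g) k) : Matrix (Fin g) (Fin g) k :=
  B.submatrix (fun j => e (Sum.inr j)) id

/-- The columns form a basis of the kernel of `Bᵀ` if the chosen minor does not vanish. -/
def kerParam (B : Matrix (Fin (g + 2)) (Fin g) k) : Matrix (Fin (g + 2)) (Fin 2) k :=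
  (kerMatrix (B.submatrix (fun j => e (Sum.inl j)) id) (minor e B)).submatrix e.symm id

variable {B : Matrix (Fin (g + 2)) (Fin g) k}

omit [Field k] in
lemma submatrix_eq_fromRows : B.submatrix e id =
    fromRows (B.submatrix (fun j => e (Sum.inl j)) id) (minor e B) := by
  ext (i | i) j <;> rfl

lemma kerParam_mulVec_apply (u : Fin 2 → k) :
    (fun j => (kerParam e B *ᵥ u) (e (Sum.inl j))) = u := by
  ext j
  change (kerMatrix _ _ *ᵥ u) (e.symm (e (Sum.inl j))) = u j
  rw [Equiv.symm_apply_apply, kerMatrix, fromRows_mulVec, Sum.elim_inl, one_mulVec]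

lemma transpose_mulVec_eq_zero_iff (hB : (minor e B).det ≠ 0) (w : Fin (g + 2) → k) :
    Bᵀ *ᵥ w = 0 ↔ kerParam e B *ᵥ (fun j => w (e (Sum.inl j))) = w := by
  have h1 : (B.submatrix e id)ᵀ *ᵥ (w ∘ e) = Bᵀ *ᵥ w := by
    have := submatrix_mulVec_equiv Bᵀ (w ∘ e) id e
    simpa [Function.comp_assoc] using this
  rw [← h1, submatrix_eq_fromRows, mulVec_transpose_eq_zero_iff _ hB]
  constructor
  · intro h
    ext i
    exact (congrFun h (e.symm i)).trans (congrArg w (e.apply_symm_apply i))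
  · intro h
    ext i
    have := congrFun h (e i)
    refine Eq.trans ?_ this
    change _ = (kerMatrix _ _ *ᵥ _) (e.symm (e i))
    rw [Equiv.symm_apply_apply]
    rfl

lemma transpose_kerParam_mul_mul (A : Matrix (Fin (g + 2)) (Fin (g + 2)) k) :
    (kerParam e B)ᵀ * A * kerParam e B =
      (kerMatrix (B.submatrix (fun j => e (Sum.inl j)) id) (minor e B))ᵀ * A.submatrix e e *
        kerMatrix (B.submatrix (fun j => e (Sum.inl j)) id) (minor e B) := by
  have hA : A = (A.submatrix e e).submatrix e.symm e.symm := by simp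
  conv_lhs => rw [hA]
  rw [kerParam, transpose_submatrix, submatrix_mul_equiv, submatrix_mul_equiv, submatrix_id_id]

lemma fromBlocks_submatrix_sumCongr (A : Matrix (Fin (g + 2)) (Fin (g + 2)) k) :
    (fromBlocks A B Bᵀ 0).submatrix (e.sumCongr (Equiv.refl (Fin g)))
      (e.sumCongr (Equiv.refl (Fin g))) =
    fromBlocks (A.submatrix e e) (B.submatrix e id) (B.submatrix e id)ᵀ 0 := by
  ext (i | i) (j | j) <;> rfl

/-- Ties the double cover to the kernel plane: up to a constant and a square, the discriminant of
the pencil is that of the binary form on the kernel of `Bᵀ`. -/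
lemma det_fromBlocks_eq (A : Matrix (Fin (g + 2)) (Fin (g + 2)) k) (hB : (minor e B).det ≠ 0) :
    (fromBlocks A B Bᵀ 0).det = (fromBlocks 0 1 1 0 : Matrix (Fin g ⊕ Fin g) (Fin g ⊕ Fin g) k).det *
      (minor e B).det ^ 2 * ((kerParam e B)ᵀ * A * kerParam e B).det := by
  rw [← det_submatrix_equiv_self (e.sumCongr (Equiv.refl (Fin g))), fromBlocks_submatrix_sumCongr,
    submatrix_eq_fromRows, det_fromBlocks_fromRows _ _ hB, transpose_kerParam_mul_mul]

lemma transpose_kerParam_mul_mul_ne_zero {A : Matrix (Fin (g + 2)) (Fin (g + 2)) k}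
    (hB : (minor e B).det ≠ 0)
    (h : ∀ x y, fromBlocks A B Bᵀ 0 *ᵥ x = 0 → fromBlocks A B Bᵀ 0 *ᵥ y = 0 →
      ∃ a b : k, (a ≠ 0 ∨ b ≠ 0) ∧ a • x + b • y = 0) :
    (kerParam e B)ᵀ * A * kerParam e B ≠ 0 := by
  rw [transpose_kerParam_mul_mul]
  refine transpose_kerMatrix_mul_mul_ne_zero hB fun x y hx hy => ?_
  rw [← submatrix_eq_fromRows, ← fromBlocks_submatrix_sumCongr, submatrix_mulVec_equiv] at hx hy
  have hz {f : Fin (g + 2) ⊕ Fin g → k} (hf : f ∘ e.sumCongr (Equiv.refl (Fin g)) = 0) : f = 0 := by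
    ext i
    simpa using congrFun hf ((e.sumCongr (Equiv.refl (Fin g))).symm i)
  obtain ⟨a, b, hab, h0⟩ := h _ _ (hz hx) (hz hy)
  refine ⟨a, b, hab, ?_⟩
  ext i
  simpa using congrFun h0 (e.sumCongr (Equiv.refl (Fin g)) i)

end KernelParametrization

/-! ### Comparison of two families stratum by stratum -/

section Stratification

variable {k : Type u} [Field k] [IsAlgClosed k] {P : Type u} [AddCommGroup P] [Module k P]
  {X : Type u} [AddCommGroup X] [Module k X] [FiniteDimensional k X]
  {X' : Type u} [AddCommGroup X'] [Module k X'] [FiniteDimensional k X']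

lemma mu_fiber_union {π : X → P} (hπ : DefMap k π) {R : X → Prop} (hR : IsCon k {x | R x})
    {T T' : Set P} (hT : IsCon k T) (hT' : IsCon k T') (hd : Disjoint T T') :
    mu k {x | π x ∈ T ∪ T' ∧ R x} = mu k {x | π x ∈ T ∧ R x} + mu k {x | π x ∈ T' ∧ R x} := by
  rw [← mu_union ((hT.preimage hπ).and hR) ((hT'.preimage hπ).and hR)]
  · congr 1
    ext x
    simp [or_and_right]
  · exact Set.disjoint_left.mpr fun x hx hx' => Set.disjoint_left.mp hd hx.1 hx'.1

lemma mu_eq_of_stratification {ι : Type*} [Finite ι] {h : ι → P → k} (hh : ∀ i, DefFun (h i))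
    {T₀ : Set P} (hT₀ : IsCon k T₀) (hcov : ∀ x ∈ T₀, ∃ i, h i x ≠ 0)
    {π : X → P} (hπ : DefMap k π) {R : X → Prop} (hR : IsCon k {x | R x})
    {π' : X' → P} (hπ' : DefMap k π') {R' : X' → Prop} (hR' : IsCon k {x | R' x})
    (hleaf : ∀ i T, IsCon k T → T ⊆ T₀ → (∀ p ∈ T, h i p ≠ 0) →
      mu k {x | π x ∈ T ∧ R x} = mu k {x | π' x ∈ T ∧ R' x}) :
    mu k {x | π x ∈ T₀ ∧ R x} = mu k {x | π' x ∈ T₀ ∧ R' x} := by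
  refine IsCon.strat_induction hh hT₀ hcov
    (fun T => mu k {x | π x ∈ T ∧ R x} = mu k {x | π' x ∈ T ∧ R' x}) ?_ ?_ hleaf
  · simp [mu_empty]
  · intro T T' hT hT' hd h1 h2
    rw [mu_fiber_union hπ hR hT hT' hd, mu_fiber_union hπ' hR' hT hT' hd, h1, h2]

end Stratification

/-! ### The kernel bundle of a smooth pencil in normal form -/

section KernelBundle

open Matrix

variable {k : Type u} [Field k]

/-- The member of a pencil of matrices at a point of the parameter space. -/
def pencil {m n : Type} (G₁ G₂ : Matrix m n k) (p : Fin 2 → k) : Matrix m n k :=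
  p 0 • G₁ + p 1 • G₂

lemma defFun_pencil {V : Type u} [AddCommGroup V] [Module k V] {m n : Type} (G₁ G₂ : Matrix m n k)
    {p : V → Fin 2 → k} (hp : DefMap k p) (i : m) (j : n) :
    DefFun fun x => pencil G₁ G₂ (p x) i j :=
  ((hp.apply 0).mul (.const (G₁ i j))).add ((hp.apply 1).mul (.const (G₂ i j)))

lemma ne_zero_of_lead_eq_one {n : ℕ} {x : Fin n → k} (h : lead x = 1) : x ≠ 0 := by
  rintro rfl
  rw [(isNorm_lead n).zero] at h
  exact zero_ne_one h

lemma or_ne_zero_of_lead_eq_one {p : Fin 2 → k} (h : lead p = 1) : p 0 ≠ 0 ∨ p 1 ≠ 0 := by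
  by_contra! H
  exact ne_zero_of_lead_eq_one h (by ext i; fin_cases i; exacts [H.1, H.2])

variable {g : ℕ} {A₁ A₂ : Matrix (Fin (g + 2)) (Fin (g + 2)) k}
  {B₁ B₂ : Matrix (Fin (g + 2)) (Fin g) k}

lemma pencil_fromBlocks (p : Fin 2 → k) :
    pencil (fromBlocks A₁ B₁ B₁ᵀ 0) (fromBlocks A₂ B₂ B₂ᵀ 0) p =
      fromBlocks (pencil A₁ A₂ p) (pencil B₁ B₂ p) (pencil B₁ B₂ p)ᵀ 0 := by
  simp [pencil, fromBlocks_smul, fromBlocks_add]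

variable (h : IsSmoothPencil (fromBlocks A₁ B₁ B₁ᵀ 0) (fromBlocks A₂ B₂ B₂ᵀ 0))

include h

lemma pencil_isSymm (p : Fin 2 → k) : (pencil A₁ A₂ p).IsSymm := by
  have h1 := (isSymm_fromBlocks_iff.mp h.symm₁).1
  have h2 := (isSymm_fromBlocks_iff.mp h.symm₂).1
  exact (h1.smul _).add (h2.smul _)

/-- If `Bₚ z = 0` with `z ≠ 0`, then `(0, z)` lies in the common isotropic subspace, hence in the
base locus, and is killed by the member at `p`; smoothness excludes this. -/
lemma exists_minor_ne_zero {p : Fin 2 → k} (hp : lead p = 1) :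
    ∃ e : Fin 2 ⊕ Fin g ≃ Fin (g + 2), (minor e (pencil B₁ B₂ p)).det ≠ 0 := by
  refine exists_equiv_det_submatrix_ne_zero _ fun z hz => ?_
  by_contra hz0
  have hq (A : Matrix (Fin (g + 2)) (Fin (g + 2)) k) (B : Matrix (Fin (g + 2)) (Fin g) k) :
      Sum.elim 0 z ⬝ᵥ fromBlocks A B Bᵀ 0 *ᵥ Sum.elim 0 z = 0 := by
    simp [fromBlocks_mulVec]
  refine h.mulVec_ne_zero (Sum.elim 0 z) (fun h0 => hz0 ?_) (hq _ _) (hq _ _) (p 0) (p 1)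
    (or_ne_zero_of_lead_eq_one hp) ?_
  · ext i
    exact congrFun h0 (Sum.inr i)
  · change pencil _ _ p *ᵥ _ = 0
    rw [pencil_fromBlocks, fromBlocks_mulVec]
    ext (i | i) <;> simp [hz]

variable [IsAlgClosed k]

omit h in
lemma mu_swap_lead {P : Type u} [AddCommGroup P] [Module k P] [FiniteDimensional k P]
    {T : Set P} (hT : IsCon k T) (n : ℕ) :
    mu k {x : (Fin n → k) × P | x.2 ∈ T ∧ lead x.1 = 1} = projClass k n * mu k T := by
  rw [← mu_prod_lead hT n]
  exact mu_eq_of_bij ((hT.preimage .snd).and (.eq ((isNorm_lead n).defFun.comp .fst) (.const 1)))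
    ((hT.preimage .fst).and (.eq ((isNorm_lead n).defFun.comp .snd) (.const 1)))
    (φ := fun x => (x.2, x.1)) (ψ := fun x => (x.2, x.1)) (.prodMk .snd .fst) (.prodMk .snd .fst)
    (fun x hx => ⟨hx, rfl⟩) fun x hx => ⟨hx, rfl⟩

omit h [IsAlgClosed k] in
lemma defFun_det_minor (e : Fin 2 ⊕ Fin g ≃ Fin (g + 2)) :
    DefFun fun p : Fin 2 → k => (minor e (pencil B₁ B₂ p)).det :=
  .det fun _ _ => defFun_pencil B₁ B₂ .id _ _

omit h [IsAlgClosed k] in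
lemma defFun_kerParam (e : Fin 2 ⊕ Fin g ≃ Fin (g + 2)) {V : Type u} [AddCommGroup V] [Module k V]
    {p : V → Fin 2 → k} (hp : DefMap k p) (i : Fin (g + 2)) (j : Fin 2) :
    DefFun fun x => kerParam e (pencil B₁ B₂ (p x)) i j :=
  .kerMatrix (fun _ _ => defFun_pencil B₁ B₂ hp _ _) (fun _ _ => defFun_pencil B₁ B₂ hp _ _) _ _

omit h [IsAlgClosed k] in
lemma isCon_kernel : IsCon k {x : (Fin (g + 2) → k) × (Fin 2 → k) |
    (pencil B₁ B₂ x.2)ᵀ *ᵥ x.1 = 0} :=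
  .eq_zero_pi (.pi fun i => .mulVec (fun a b => defFun_pencil B₁ B₂ .snd b a)
    (fun a => DefMap.fst.apply a) i)

omit h [IsAlgClosed k] in
lemma isCon_isotropic : IsCon k {x : (Fin (g + 2) → k) × (Fin 2 → k) |
    x.1 ⬝ᵥ pencil A₁ A₂ x.2 *ᵥ x.1 = 0} :=
  .eq_zero (.dotProduct (fun a => DefMap.fst.apply a)
    (.mulVec (fun a b => defFun_pencil A₁ A₂ .snd a b) fun a => DefMap.fst.apply a))

omit h in
/-- Over a stratum where a minor does not vanish, the kernel bundle is trivial. -/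
lemma mu_kernel_cone_eq (e : Fin 2 ⊕ Fin g ≃ Fin (g + 2)) {T : Set (Fin 2 → k)} (hT : IsCon k T)
    (he : ∀ p ∈ T, (minor e (pencil B₁ B₂ p)).det ≠ 0)
    {R : (Fin (g + 2) → k) × (Fin 2 → k) → Prop} (hR : IsCon k {x | R x})
    (hRc : ∀ (c : k) x p, c ≠ 0 → R (x, p) → R (c • x, p))
    {R' : (Fin 2 → k) × (Fin 2 → k) → Prop} (hR' : IsCon k {x | R' x})
    (hRc' : ∀ (c : k) x p, c ≠ 0 → R' (x, p) → R' (c • x, p))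
    (hRR' : ∀ u p, p ∈ T → (R (kerParam e (pencil B₁ B₂ p) *ᵥ u, p) ↔ R' (u, p))) :
    mu k {x | x.2 ∈ T ∧ (pencil B₁ B₂ x.2)ᵀ *ᵥ x.1 = 0 ∧ R x ∧ lead x.1 = 1} =
      mu k {x | (x.2 ∈ T ∧ R' x) ∧ lead x.1 = 1} := by
  have key := mu_cone_congr (isNorm_lead (k := k) (g + 2)) (isNorm_lead (k := k) 2)
    (S := {x | x.2 ∈ T ∧ (pencil B₁ B₂ x.2)ᵀ *ᵥ x.1 = 0 ∧ R x}) (S' := {x | x.2 ∈ T ∧ R' x})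
    ((hT.preimage .snd).and (isCon_kernel.and hR)) ((hT.preimage .snd).and hR')
    (fun c x p hc hx => ⟨hx.1, by
      simp only
      rw [mulVec_smul, hx.2.1, smul_zero], hRc c x p hc hx.2.2⟩)
    (fun c x p hc hx => ⟨hx.1, hRc' c x p hc hx.2⟩)
    (φ := fun x j => x.1 (e (Sum.inl j)))
    (ψ := fun x => kerParam e (pencil B₁ B₂ x.2) *ᵥ x.1)
    (.pi fun j => DefMap.fst.apply _)
    (.pi fun i => .mulVec (fun a b => defFun_kerParam e .snd a b) (fun a => DefMap.fst.apply a) i)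
    (fun c x p => rfl) (fun c x p => mulVec_smul _ c x)
    (fun w p hx => by
      have hw := (transpose_mulVec_eq_zero_iff e (he p hx.1) w).mp hx.2.1
      refine ⟨⟨hx.1, (hRR' _ p hx.1).mp ?_⟩, hw⟩
      rw [hw]
      exact hx.2.2)
    (fun u p hx => by
      refine ⟨⟨hx.1, ?_, (hRR' u p hx.1).mpr hx.2⟩, kerParam_mulVec_apply e u⟩
      simp only
      rw [transpose_mulVec_eq_zero_iff e (he p hx.1), kerParam_mulVec_apply])
  refine Eq.trans (congrArg (mu k) (Set.ext fun x => ?_)) key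
  simp [and_assoc]

/-- The kernels of `Bₚᵀ` form a rank-two bundle over `ℙ¹`, trivial on each stratum where a fixed
minor is nonzero. -/
lemma mu_kernel : mu k {x : (Fin (g + 2) → k) × (Fin 2 → k) | lead x.2 = 1 ∧
    (pencil B₁ B₂ x.2)ᵀ *ᵥ x.1 = 0 ∧ lead x.1 = 1} = projClass k 2 * projClass k 2 := by
  have hT₀ : IsCon k {p : Fin 2 → k | lead p = 1} := .eq (isNorm_lead 2).defFun (.const 1)
  have hlead {n : ℕ} : IsCon k {x : (Fin n → k) × (Fin 2 → k) | lead x.1 = 1} :=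
    .eq ((isNorm_lead n).defFun.comp .fst) (.const 1)
  refine Eq.trans ?_ ((mu_swap_lead hT₀ 2).trans (by rw [mu_lead]))
  refine mu_eq_of_stratification (h := fun e p => (minor e (pencil B₁ B₂ p)).det)
    (fun e => defFun_det_minor e) hT₀ (fun p hp => exists_minor_ne_zero h hp) .snd
    (isCon_kernel.and hlead) .snd hlead fun e T hT _ he => ?_
  have := mu_kernel_cone_eq e hT he (R := fun _ => True) (R' := fun _ => True) .univ
    (fun _ _ _ _ _ => trivial) .univ (fun _ _ _ _ _ => trivial) fun _ _ _ => Iff.rfl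
  simpa only [true_and, and_true] using this

lemma mu_isotropic_kernel [CharZero k] {δ : (Fin 2 → k) → k} (hδ : DefFun δ) {d : k} (hd : d ≠ 0)
    (hdet : ∀ p, (pencil (fromBlocks A₁ B₁ B₁ᵀ 0) (fromBlocks A₂ B₂ B₂ᵀ 0) p).det =
      d ^ 2 * δ p) :
    mu k {x : (Fin (g + 2) → k) × (Fin 2 → k) | lead x.2 = 1 ∧
      (pencil B₁ B₂ x.2)ᵀ *ᵥ x.1 = 0 ∧ x.1 ⬝ᵥ pencil A₁ A₂ x.2 *ᵥ x.1 = 0 ∧ lead x.1 = 1} =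
    mu k {x : (Fin 2 → k) × k | lead x.1 = 1 ∧ x.2 ^ 2 = δ x.1} := by
  have hT₀ : IsCon k {p : Fin 2 → k | lead p = 1} := .eq (isNorm_lead 2).defFun (.const 1)
  -- The block determinant formula gives `d² δ = det J · minor² · (αγ - β²)`, with `J` the swap
  -- matrix. With `κ² = -det J` and `m = κ / d · minor` this becomes `δ = m² (β² - αγ)`, the form
  -- required by `mu_conic`.
  obtain ⟨κ, hκ⟩ := IsAlgClosed.exists_eq_mul_self
    (-(fromBlocks 0 1 1 0 : Matrix (Fin g ⊕ Fin g) (Fin g ⊕ Fin g) k).det)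
  have hκ0 : κ ≠ 0 := by
    rintro rfl
    rw [mul_zero, neg_eq_zero] at hκ
    exact det_swap_sq hκ
  refine mu_eq_of_stratification (h := fun e p => (minor e (pencil B₁ B₂ p)).det)
    (fun e => defFun_det_minor e) hT₀ (fun p hp => exists_minor_ne_zero h hp) .snd
    (isCon_kernel.and (isCon_isotropic.and (.eq ((isNorm_lead _).defFun.comp .fst) (.const 1))))
    .fst (.eq ((DefMap.snd (k := k)).defFun.pow 2) (hδ.comp .fst)) fun e T hT hTT he => ?_
  let F (p : Fin 2 → k) : Matrix (Fin 2) (Fin 2) k :=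
    (kerParam e (pencil B₁ B₂ p))ᵀ * pencil A₁ A₂ p * kerParam e (pencil B₁ B₂ p)
  have hF (i j) : DefFun fun p => F p i j :=
    .matrix_mul (.matrix_mul (fun a b => defFun_kerParam e .id b a) fun a b => defFun_pencil A₁ A₂ .id a b)
      (fun a b => defFun_kerParam e .id a b) i j
  have hsymm (p) : F p 1 0 = F p 0 1 := by
    have : (F p).IsSymm := by
      simp only [F]
      rw [IsSymm, transpose_mul, transpose_mul, transpose_transpose, pencil_isSymm h p,
        Matrix.mul_assoc]
    exact this.apply 0 1
  have hquad (p u) : (kerParam e (pencil B₁ B₂ p) *ᵥ u) ⬝ᵥ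
      pencil A₁ A₂ p *ᵥ (kerParam e (pencil B₁ B₂ p) *ᵥ u) =
      F p 0 0 * u 0 ^ 2 + 2 * F p 0 1 * (u 0 * u 1) + F p 1 1 * u 1 ^ 2 := by
    have : (kerParam e (pencil B₁ B₂ p) *ᵥ u) ⬝ᵥ
        pencil A₁ A₂ p *ᵥ (kerParam e (pencil B₁ B₂ p) *ᵥ u) = u ⬝ᵥ F p *ᵥ u := by
      simp only [F]
      rw [← mulVec_mulVec, ← mulVec_mulVec, dotProduct_mulVec u, vecMul_transpose]
    rw [this]
    simp only [mulVec, dotProduct, Fin.sum_univ_two, hsymm]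
    ring
  rw [mu_kernel_cone_eq e hT he (R' := fun x => F x.2 0 0 * x.1 0 ^ 2 +
    2 * F x.2 0 1 * (x.1 0 * x.1 1) + F x.2 1 1 * x.1 1 ^ 2 = 0) isCon_isotropic ?_ ?_ ?_ ?_,
    mu_conic hT (hF 0 0) (hF 0 1) (hF 1 1) (m := fun p => κ / d * (minor e (pencil B₁ B₂ p)).det)
      ((DefFun.const _).mul (defFun_det_minor e)) ?_ ?_]
  · congr 1
    ext ⟨p, y⟩
    refine and_congr_right fun hp => ?_
    have h1 := hdet p
    rw [pencil_fromBlocks, det_fromBlocks_eq e _ (he p hp), det_fin_two] at h1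
    change _ * _ * (F p 0 0 * F p 1 1 - F p 0 1 * F p 1 0) = _ at h1
    rw [hsymm] at h1
    have h2 : (κ / d * (minor e (pencil B₁ B₂ p)).det) ^ 2 * (F p 0 1 ^ 2 - F p 0 0 * F p 1 1) =
        δ p := by
      rw [← mul_right_inj' (pow_ne_zero 2 hd), ← h1]
      field_simp
      linear_combination -(F p 0 1 ^ 2 - F p 0 0 * F p 1 1) * (minor e (pencil B₁ B₂ p)).det ^ 2 * hκ
    simp only [h2]
  · rintro p hp ⟨h0, h1, h2⟩
    refine transpose_kerParam_mul_mul_ne_zero e (he p hp) (A := pencil A₁ A₂ p) ?_ ?_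
    · intro x y hx hy
      rw [← pencil_fromBlocks] at hx hy
      exact h.exists_relation (or_ne_zero_of_lead_eq_one (hTT hp)) hx hy
    · change F p = 0
      ext i j
      fin_cases i <;> fin_cases j
      exacts [h0, h1, (hsymm p).trans h1, h2]
  · exact fun p hp => mul_ne_zero (div_ne_zero hκ0 hd) (he p hp)
  · intro c x p hc hx
    simp only at hx ⊢
    rw [mulVec_smul, smul_dotProduct, dotProduct_smul, hx, smul_zero, smul_zero]
  · have h0 : DefFun fun x : (Fin 2 → k) × (Fin 2 → k) => x.1 0 := DefMap.fst.apply 0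
    have h1 : DefFun fun x : (Fin 2 → k) × (Fin 2 → k) => x.1 1 := DefMap.fst.apply 1
    exact .eq_zero (.add (.add (((hF 0 0).comp .snd).mul (h0.pow 2))
      (((DefFun.const 2).mul ((hF 0 1).comp .snd)).mul (h0.mul h1)))
      (((hF 1 1).comp .snd).mul (h1.pow 2)))
  · intro c x p hc hx
    simp only [Pi.smul_apply, smul_eq_mul] at hx ⊢
    linear_combination c ^ 2 * hx
  · intro u p _
    simp only [hquad]

end KernelBundle

/-! ### The incidence variety of a pencil of quadrics -/

section Incidence

open Matrix

variable {k : Type u} [Field k]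

lemma projClass_two : projClass k 2 = 1 + lefschetz k := by
  simp [projClass, Finset.sum_range_succ]

lemma isCon_lead {V : Type u} [AddCommGroup V] [Module k V] {n : ℕ} {φ : V → Fin n → k}
    (hφ : DefMap k φ) : IsCon k {x | lead (φ x) = 1} :=
  .eq ((isNorm_lead n).defFun.comp hφ) (.const 1)

variable [IsAlgClosed k]

/-- The incidence variety is a `ℙ¹`-bundle over the base locus of the pencil, and isomorphic
to the base away from it. -/
lemma mu_incidence {P : Type u} [AddCommGroup P] [Module k P] [FiniteDimensional k P] {T : Set P}
    (hT : IsCon k T) {f₁ f₂ : P → k} (h₁ : DefFun f₁) (h₂ : DefFun f₂) :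
    mu k {x : P × (Fin 2 → k) | x.2 0 * f₁ x.1 + x.2 1 * f₂ x.1 = 0 ∧ lead x.2 = 1 ∧ x.1 ∈ T} =
      mu k T + lefschetz k * mu k {x | (f₁ x = 0 ∧ f₂ x = 0) ∧ x ∈ T} := by
  have hp (i : Fin 2) : DefFun fun x : P × (Fin 2 → k) => x.2 i := DefMap.snd.apply i
  have hX : IsCon k {x | f₁ x = 0 ∧ f₂ x = 0} := (IsCon.eq_zero h₁).and (.eq_zero h₂)
  have hE : IsCon k {x : P × (Fin 2 → k) | x.2 0 * f₁ x.1 + x.2 1 * f₂ x.1 = 0 ∧ lead x.2 = 1 ∧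
      x.1 ∈ T} :=
    (IsCon.eq_zero (.add ((hp 0).mul (h₁.comp .fst)) ((hp 1).mul (h₂.comp .fst)))).and
      ((isCon_lead .snd).and (hT.preimage .fst))
  rw [mu_inter_add_diff hE (hX.preimage .fst), mu_inter_add_diff hT hX]
  have hXT : IsCon k {x | (f₁ x = 0 ∧ f₂ x = 0) ∧ x ∈ T} := hX.and hT
  have hb := mu_prod_lead hXT 2
  rw [projClass_two] at hb
  have e1 : {x : P × (Fin 2 → k) | x.2 0 * f₁ x.1 + x.2 1 * f₂ x.1 = 0 ∧ lead x.2 = 1 ∧ x.1 ∈ T} ∩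
      (fun x => x.1) ⁻¹' {x | f₁ x = 0 ∧ f₂ x = 0} =
      {x | x.1 ∈ {x | (f₁ x = 0 ∧ f₂ x = 0) ∧ x ∈ T} ∧ lead x.2 = 1} := by
    ext x
    constructor
    · rintro ⟨⟨-, hl, hT⟩, hX⟩
      exact ⟨⟨hX, hT⟩, hl⟩
    · rintro ⟨⟨⟨h1, h2⟩, hT⟩, hl⟩
      exact ⟨⟨by rw [h1, h2, mul_zero, mul_zero, add_zero], hl, hT⟩, h1, h2⟩
  have e2 : T ∩ {x | f₁ x = 0 ∧ f₂ x = 0} = {x | (f₁ x = 0 ∧ f₂ x = 0) ∧ x ∈ T} := by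
    ext x
    exact and_comm
  have e3 : mu k ({x : P × (Fin 2 → k) | x.2 0 * f₁ x.1 + x.2 1 * f₂ x.1 = 0 ∧ lead x.2 = 1 ∧
      x.1 ∈ T} \ (fun x => x.1) ⁻¹' {x | f₁ x = 0 ∧ f₂ x = 0}) =
      mu k (T \ {x | f₁ x = 0 ∧ f₂ x = 0}) := by
    -- Away from the base locus, `[-f₂ x : f₁ x]` is the only point `p` with `p₀ f₁ x + p₁ f₂ x =
    -- 0`.
    have hv : DefMap k fun x => ![-f₂ x, f₁ x] := .vec2 h₂.neg h₁
    have hn := isNorm_lead (k := k) 2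
    refine mu_eq_of_bij (hE.diff (hX.preimage .fst)) (hT.diff hX) (φ := fun x => x.1)
      (ψ := fun x => (x, (lead ![-f₂ x, f₁ x])⁻¹ • ![-f₂ x, f₁ x])) .fst
      (.prodMk .id (.smul (hn.defFun.comp hv).inv hv)) ?_ ?_
    · rintro ⟨x, p⟩ ⟨⟨hq, hl, hxT⟩, hx⟩
      refine ⟨⟨hxT, hx⟩, Prod.ext rfl ?_⟩
      simp only at hq hl hx ⊢
      obtain ⟨c, hc, h⟩ : ∃ c : k, c ≠ 0 ∧ ![-f₂ x, f₁ x] = c • p := by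
        rcases or_ne_zero_of_lead_eq_one hl with h0 | h1
        · refine ⟨-f₂ x / p 0, fun hc => hx ?_, ?_⟩
          · have hf₂ : f₂ x = 0 := by simpa [h0] using hc
            rw [hf₂, mul_zero, add_zero] at hq
            exact ⟨(mul_eq_zero.mp hq).resolve_left h0, hf₂⟩
          · ext i
            fin_cases i
            · simp [h0]
            · simp only [Fin.mk_one, cons_val_one, cons_val_fin_one, Pi.smul_apply, smul_eq_mul]
              field_simp
              linear_combination hq
        · refine ⟨f₁ x / p 1, fun hc => hx ?_, ?_⟩
          · have hf₁ : f₁ x = 0 := by simpa [h1] using hc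
            rw [hf₁, mul_zero, zero_add] at hq
            exact ⟨hf₁, (mul_eq_zero.mp hq).resolve_left h1⟩
          · ext i
            fin_cases i
            · simp only [Fin.zero_eta, cons_val_zero, Pi.smul_apply, smul_eq_mul]
              field_simp
              linear_combination -hq
            · simp [h1]
      rw [h, hn.map_smul, hl, mul_one, smul_smul, inv_mul_cancel₀ hc, one_smul]
    · rintro x ⟨hxT, hx⟩
      have hne : lead ![-f₂ x, f₁ x] ≠ 0 := fun h0 => hx (by
        have := hn.eq_zero _ h0
        exact ⟨congrFun this 1, neg_eq_zero.mp (congrFun this 0)⟩)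
      refine ⟨⟨⟨?_, ?_, hxT⟩, hx⟩, rfl⟩
      · simp
        ring
      · simp only
        rw [hn.map_smul, inv_mul_cancel₀ hne]
  rw [e1, e2, e3, hb]
  ring

/-- A family of affine hyperplanes that may degenerate to the empty set or to the whole space. -/
lemma mu_linear_family {P : Type u} [AddCommGroup P] [Module k P] [FiniteDimensional k P]
    {S : Set P} (hS : IsCon k S) {n : ℕ} {c : P → Fin (n + 1) → k} (hc : DefMap k c) {d : P → k}
    (hd : DefFun d) :
    mu k {x : P × (Fin (n + 1) → k) | x.1 ∈ S ∧ ∑ i, c x.1 i * x.2 i + d x.1 = 0} =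
      lefschetz k ^ n * (mu k S - mu k {x | x ∈ S ∧ c x = 0}) +
        lefschetz k ^ (n + 1) * mu k {x | x ∈ S ∧ c x = 0 ∧ d x = 0} := by
  have hc0 : IsCon k {x | c x = 0} := .eq_zero_pi hc
  have hE : IsCon k {x : P × (Fin (n + 1) → k) | x.1 ∈ S ∧ ∑ i, c x.1 i * x.2 i + d x.1 = 0} :=
    .and (hS.preimage .fst) (.eq_zero (.add (.sum _ fun i _ => .mul ((hc.apply i).comp .fst)
      (DefMap.snd.apply i)) (hd.comp .fst)))
  have hS0 : IsCon k {x | x ∈ S ∧ c x = 0 ∧ d x = 0} := hS.and (hc0.and (.eq_zero hd))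
  have h0 := mu_prod_pi hS0 (n + 1)
  have h1 := mu_hyperplane (hS.diff hc0) hc hd fun p hp => Function.ne_iff.mp hp.2
  rw [mu_inter_add_diff hE (hc0.preimage .fst), mu_inter_add_diff hS hc0]
  have e0 : {x : P × (Fin (n + 1) → k) | x.1 ∈ S ∧ ∑ i, c x.1 i * x.2 i + d x.1 = 0} ∩
      (fun x => x.1) ⁻¹' {x | c x = 0} = {x | x ∈ S ∧ c x = 0 ∧ d x = 0} ×ˢ Set.univ := by
    ext x
    constructor
    · rintro ⟨⟨hx, he⟩, hx0 : c x.1 = 0⟩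
      exact ⟨⟨hx, hx0, by simpa [hx0] using he⟩, trivial⟩
    · rintro ⟨⟨hx, hx0, he⟩, -⟩
      exact ⟨⟨hx, by simp [hx0, he]⟩, hx0⟩
  have e1 : {x : P × (Fin (n + 1) → k) | x.1 ∈ S ∧ ∑ i, c x.1 i * x.2 i + d x.1 = 0} \
      (fun x => x.1) ⁻¹' {x | c x = 0} =
      {x | x.1 ∈ S \ {x | c x = 0} ∧ ∑ i, c x.1 i * x.2 i + d x.1 = 0} := by
    ext x
    exact and_right_comm
  have e2 : {x | x ∈ S ∧ c x = 0} = S ∩ {x | c x = 0} := rfl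
  rw [e0, e1, h0, h1, e2]
  ring

variable {n : ℕ} {A₁ A₂ : Matrix (Fin (n + 1 + 2)) (Fin (n + 1 + 2)) k}
  {B₁ B₂ : Matrix (Fin (n + 1 + 2)) (Fin (n + 1)) k}

omit [IsAlgClosed k] in
lemma defFun_quadric : DefFun fun x : (Fin (n + 1 + 2) → k) × (Fin 2 → k) =>
    x.1 ⬝ᵥ pencil A₁ A₂ x.2 *ᵥ x.1 :=
  .dotProduct (fun a => DefMap.fst.apply a)
    (.mulVec (fun a b => defFun_pencil A₁ A₂ .snd a b) fun a => DefMap.fst.apply a)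

omit [IsAlgClosed k] in
lemma defMap_kernel : DefMap k fun x : (Fin (n + 1 + 2) → k) × (Fin 2 → k) =>
    (2 : k) • (pencil B₁ B₂ x.2)ᵀ *ᵥ x.1 :=
  .smul (.const 2) (.pi fun i => .mulVec (fun a b => defFun_pencil B₁ B₂ .snd b a)
    (fun a => DefMap.fst.apply a) i)

/-- The class of a pencil of quadrics in block form, computed by projecting from the common
isotropic subspace. -/
lemma mu_quadric_blocks [CharZero k]
    (h : IsSmoothPencil (fromBlocks A₁ B₁ B₁ᵀ 0) (fromBlocks A₂ B₂ B₂ᵀ 0))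
    {ν : (Fin (n + 1 + 2) → k) × (Fin (n + 1) → k) → k} (hν : IsNorm ν)
    (hν0 : ∀ z, ν (0, z) = lead z) (hν1 : ∀ w z, w ≠ 0 → ν (w, z) = lead w) :
    mu k {x : ((Fin (n + 1 + 2) → k) × (Fin (n + 1) → k)) × (Fin 2 → k) |
      (∑ i, ((2 : k) • (pencil B₁ B₂ x.2)ᵀ *ᵥ x.1.1) i * x.1.2 i +
        x.1.1 ⬝ᵥ pencil A₁ A₂ x.2 *ᵥ x.1.1 = 0 ∧ lead x.2 = 1) ∧
      ν x.1 = 1} =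
    projClass k (n + 1) * projClass k 2 +
      lefschetz k ^ n * (projClass k (n + 1 + 2) * projClass k 2 - projClass k 2 * projClass k 2) +
      lefschetz k ^ (n + 1) * mu k {x : (Fin (n + 1 + 2) → k) × (Fin 2 → k) | lead x.2 = 1 ∧
        (pencil B₁ B₂ x.2)ᵀ *ᵥ x.1 = 0 ∧ x.1 ⬝ᵥ pencil A₁ A₂ x.2 *ᵥ x.1 = 0 ∧ lead x.1 = 1} := by
  set E := {x : ((Fin (n + 1 + 2) → k) × (Fin (n + 1) → k)) × (Fin 2 → k) |
      (∑ i, ((2 : k) • (pencil B₁ B₂ x.2)ᵀ *ᵥ x.1.1) i * x.1.2 i +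
        x.1.1 ⬝ᵥ pencil A₁ A₂ x.2 *ᵥ x.1.1 = 0 ∧ lead x.2 = 1) ∧
      ν x.1 = 1}
  have hT : IsCon k {p : Fin 2 → k | lead p = 1} := isCon_lead .id
  have h11 : DefMap k fun x : ((Fin (n + 1 + 2) → k) × (Fin (n + 1) → k)) × (Fin 2 → k) => x.1.1 :=
    DefMap.fst.comp .fst
  have h12 : DefMap k fun x : ((Fin (n + 1 + 2) → k) × (Fin (n + 1) → k)) × (Fin 2 → k) => x.1.2 :=
    DefMap.snd.comp .fst
  have hw := DefMap.prodMk h11 .snd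
  have hE : IsCon k E :=
    ((IsCon.eq_zero (.add (.sum _ fun i _ => .mul ((defMap_kernel.apply i).comp hw)
      (h12.apply i)) (defFun_quadric.comp hw))).and (isCon_lead .snd)).and
      (.eq (hν.defFun.comp .fst) (.const 1))
  have hS : IsCon k {x : (Fin (n + 1 + 2) → k) × (Fin 2 → k) | lead x.2 = 1 ∧ lead x.1 = 1} :=
    (isCon_lead .snd).and (isCon_lead .fst)
  have hW : IsCon k {x : ((Fin (n + 1 + 2) → k) × (Fin (n + 1) → k)) × (Fin 2 → k) | x.1.1 = 0} :=
    .eq_zero_pi h11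
  -- The centre of projection: the common linear subspace lies in every member of the pencil.
  have hE0 : mu k (E ∩ {x | x.1.1 = 0}) = projClass k (n + 1) * projClass k 2 := by
    rw [← mu_lead 2, ← mu_swap_lead hT]
    refine mu_eq_of_bij (hE.inter hW) ((hT.preimage .snd).and (isCon_lead .fst))
      (φ := fun x => (x.1.2, x.2)) (ψ := fun x => ((0, x.1), x.2)) (.prodMk h12 .snd)
      (.prodMk (.prodMk (.const _) .fst) .snd) ?_ ?_
    · rintro ⟨⟨w, z⟩, p⟩ ⟨⟨⟨-, hp⟩, hz⟩, hw : w = 0⟩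
      subst hw
      exact ⟨⟨hp, (hν0 z).symm.trans hz⟩, rfl⟩
    · rintro ⟨z, p⟩ ⟨hp, hz⟩
      exact ⟨⟨⟨⟨by simp, hp⟩, (hν0 z).trans hz⟩, rfl⟩, rfl⟩
  -- Away from the centre the normalization involves only `w`, so `z` becomes a free affine
  -- coordinate subject to one affine linear equation.
  have hE1 : mu k (E \ {x | x.1.1 = 0}) =
      mu k {x : ((Fin (n + 1 + 2) → k) × (Fin 2 → k)) × (Fin (n + 1) → k) |
        x.1 ∈ {x : (Fin (n + 1 + 2) → k) × (Fin 2 → k) | lead x.2 = 1 ∧ lead x.1 = 1} ∧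
        ∑ i, ((2 : k) • (pencil B₁ B₂ x.1.2)ᵀ *ᵥ x.1.1) i * x.2 i +
          x.1.1 ⬝ᵥ pencil A₁ A₂ x.1.2 *ᵥ x.1.1 = 0} := by
    refine mu_eq_of_bij (hE.diff hW) ((hS.preimage .fst).and (.eq_zero
      (.add (.sum _ fun i _ => .mul ((defMap_kernel.apply i).comp .fst) (DefMap.snd.apply i))
        (defFun_quadric.comp .fst)))) (φ := fun x => ((x.1.1, x.2), x.1.2))
      (ψ := fun x => ((x.1.1, x.2), x.1.2)) (.prodMk hw h12)
      (.prodMk (.prodMk (DefMap.fst.comp .fst) .snd) (DefMap.snd.comp .fst)) ?_ ?_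
    · rintro ⟨⟨w, z⟩, p⟩ ⟨⟨⟨hq, hp⟩, hl⟩, hw : w ≠ 0⟩
      exact ⟨⟨⟨hp, (hν1 w z hw).symm.trans hl⟩, hq⟩, rfl⟩
    · rintro ⟨⟨w, p⟩, z⟩ ⟨⟨hp, hl⟩, hq⟩
      have hw := ne_zero_of_lead_eq_one hl
      exact ⟨⟨⟨⟨hq, hp⟩, (hν1 w z hw).trans hl⟩, hw⟩, rfl⟩
  have hS1 : mu k {x : (Fin (n + 1 + 2) → k) × (Fin 2 → k) | lead x.2 = 1 ∧ lead x.1 = 1} =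
      projClass k (n + 1 + 2) * projClass k 2 := by
    rw [← mu_lead 2, ← mu_swap_lead hT]
    rfl
  rw [mu_inter_add_diff hE hW, hE0, hE1,
    mu_linear_family hS defMap_kernel defFun_quadric, hS1, ← mu_kernel h, ← add_assoc]
  congr 5
  · ext x
    simp [and_assoc, and_comm]
  · ext x
    simp [and_assoc, and_comm]

end Incidence

/-! ### The class of an intersection of two quadrics -/

section BaseLocus

open Matrix

variable {k : Type u} [Field k]

lemma projClass_add (a b : ℕ) :
    projClass k (a + b) = projClass k a + lefschetz k ^ a * projClass k b := by
  simp only [projClass, Finset.sum_range_add, Finset.mul_sum, pow_add]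

lemma projClass_one : projClass k 1 = 1 := by
  simp [projClass]

lemma dotProduct_fromBlocks_mulVec {m n : Type} [Fintype m] [Fintype n] (A : Matrix m m k)
    (B : Matrix m n k) (w : m → k) (z : n → k) :
    Sum.elim w z ⬝ᵥ fromBlocks A B Bᵀ 0 *ᵥ Sum.elim w z =
      ∑ i, ((2 : k) • Bᵀ *ᵥ w) i * z i + w ⬝ᵥ A *ᵥ w := by
  have h : w ⬝ᵥ B *ᵥ z = (Bᵀ *ᵥ w) ⬝ᵥ z := by
    rw [dotProduct_mulVec, mulVec_transpose]
  have h' : ∑ i, ((2 : k) • Bᵀ *ᵥ w) i * z i = 2 * ((Bᵀ *ᵥ w) ⬝ᵥ z) := by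
    simp only [dotProduct, Finset.mul_sum, Pi.smul_apply, smul_eq_mul, mul_assoc]
  rw [fromBlocks_mulVec, h', sumElim_dotProduct_sumElim]
  simp only [Sum.elim_comp_inl, Sum.elim_comp_inr, dotProduct_add, zero_mulVec, add_zero, h,
    dotProduct_comm z]
  ring

lemma dotProduct_pencil_mulVec {ι : Type} [Fintype ι] (G₁ G₂ : Matrix ι ι k) (p : Fin 2 → k)
    (v : ι → k) :
    v ⬝ᵥ pencil G₁ G₂ p *ᵥ v = p 0 * (v ⬝ᵥ G₁ *ᵥ v) + p 1 * (v ⬝ᵥ G₂ *ᵥ v) := by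
  simp only [pencil, add_mulVec, smul_mulVec, dotProduct_add, dotProduct_smul, smul_eq_mul]

variable [IsAlgClosed k] [CharZero k]

open Classical in
/-- The two fibrations of the incidence variety of a smooth pencil of quadrics compute the same
class. -/
theorem projClass_add_lefschetz_mul_mu_baseLocus {n N : ℕ} (hN : N = (n + 1 + 2) + (n + 1))
    {G₁ G₂ : Matrix (Fin N) (Fin N) k} (h : IsSmoothPencil G₁ G₂) :
    projClass k N + lefschetz k *
        mu k {x : Fin N → k | (x ⬝ᵥ G₁ *ᵥ x = 0 ∧ x ⬝ᵥ G₂ *ᵥ x = 0) ∧ lead x = 1} =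
      projClass k (n + 1) * projClass k 2 + lefschetz k ^ n *
          (projClass k (n + 1 + 2) * projClass k 2 - projClass k 2 * projClass k 2) +
        lefschetz k ^ (n + 1) *
          mu k {x : (Fin 2 → k) × k | lead x.1 = 1 ∧ x.2 ^ 2 = (pencil G₁ G₂ x.1).det} := by
  obtain ⟨Φ, A₁, A₂, B₁, B₂, d, hd, hs, h₁, h₂, hdet⟩ :=
    h.exists_normalForm (g := n + 1) (m := n + 1 + 2) (by rw [Fintype.card_fin]; omega)
      (by rw [Fintype.card_fin, hN])
  have hq (G : Matrix (Fin N) (Fin N) k) : DefFun fun x : Fin N → k => x ⬝ᵥ G *ᵥ x :=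
    .dotProduct (fun a => DefMap.id.apply a)
      (.mulVec (fun a b => .const _) fun a => DefMap.id.apply a)
  have hp {V : Type u} [AddCommGroup V] [Module k V] (i : Fin 2) :
      DefFun fun x : V × (Fin 2 → k) => x.2 i := DefMap.snd.apply i
  have hν := (isNorm_lead (k := k) (n + 1 + 2)).prod (isNorm_lead (k := k) (n + 1))
  rw [← mu_isotropic_kernel hs (δ := fun p => (pencil G₁ G₂ p).det)
      (.det fun i j => defFun_pencil G₁ G₂ .id i j) hd fun p => hdet _ _,
    ← mu_quadric_blocks hs hν (fun z => if_pos rfl) fun w z hw => if_neg hw,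
    ← mu_lead N]
  -- Both sides are now classes of the same incidence variety, in the original and in the adapted
  -- coordinates; the linear isomorphism `Ψ` identifies them.
  refine (mu_incidence (isCon_lead .id) (hq G₁) (hq G₂)).symm.trans ?_
  let Ψ : ((Fin (n + 1 + 2) → k) × (Fin (n + 1) → k)) ≃ₗ[k] (Fin N → k) :=
    (LinearEquiv.sumArrowLequivProdArrow _ _ k k).symm.trans Φ
  have hΨ (w z) : Ψ (w, z) = Φ (Sum.elim w z) := rfl
  have key (w z) (p : Fin 2 → k) :
      p 0 * (Ψ (w, z) ⬝ᵥ G₁ *ᵥ Ψ (w, z)) + p 1 * (Ψ (w, z) ⬝ᵥ G₂ *ᵥ Ψ (w, z)) =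
        ∑ i, ((2 : k) • (pencil B₁ B₂ p)ᵀ *ᵥ w) i * z i + w ⬝ᵥ pencil A₁ A₂ p *ᵥ w := by
    rw [hΨ, h₁, h₂, ← dotProduct_pencil_mulVec, pencil_fromBlocks, dotProduct_fromBlocks_mulVec]
  let S : Set ((Fin N → k) × (Fin 2 → k)) := {x |
    x.2 0 * (x.1 ⬝ᵥ G₁ *ᵥ x.1) + x.2 1 * (x.1 ⬝ᵥ G₂ *ᵥ x.1) = 0 ∧ lead x.2 = 1}
  have hS : IsCon k S := (IsCon.eq_zero (.add ((hp 0).mul ((hq G₁).comp .fst))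
    ((hp 1).mul ((hq G₂).comp .fst)))).and (isCon_lead .snd)
  have hc (c : k) (x p) (hx : (x, p) ∈ S) : (c • x, p) ∈ S := by
    refine ⟨?_, hx.2⟩
    have h0 := hx.1
    simp only [mulVec_smul, smul_dotProduct, dotProduct_smul, smul_eq_mul] at h0 ⊢
    linear_combination c ^ 2 * h0
  have hΨd : DefMap k fun x : ((Fin (n + 1 + 2) → k) × (Fin (n + 1) → k)) × (Fin 2 → k) =>
      (Ψ x.1, x.2) := .prodMk ((DefMap.linearMap Ψ.toLinearMap).comp .fst) .snd
  have := mu_cone_congr (isNorm_lead (k := k) N) hν hS (hS.preimage hΨd)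
    (fun c x p _ hx => hc c x p hx)
    (fun c x p _ hx => by
      rw [Set.mem_preimage, map_smul]
      exact hc c _ p hx)
    (φ := fun x => Ψ.symm x.1) (ψ := fun x => Ψ x.1)
    ((DefMap.linearMap Ψ.symm.toLinearMap).comp .fst) ((DefMap.linearMap Ψ.toLinearMap).comp .fst)
    (fun c x p => map_smul _ c x) (fun c x p => map_smul _ c x)
    (fun x p hx => ⟨by
      rw [Set.mem_preimage, LinearEquiv.apply_symm_apply]
      exact hx, Ψ.apply_symm_apply x⟩)
    (fun x p hx => ⟨hx, Ψ.symm_apply_apply x⟩)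
  convert this using 2
  · ext x
    exact and_assoc.symm
  · ext ⟨⟨w, z⟩, p⟩
    simp only [Set.mem_ofPred_eq, Set.mem_preimage, S, key]

omit [IsAlgClosed k] in
lemma isSmoothPencil_gramMatrix {n d : ℕ} (hd : d + 1 < n)
    (q₁ q₂ : MvPolynomial.homogeneousSubmodule (Fin (n + 1)) k 2)
    (hsmooth : SmoothOfRelativeDimension d (quadricIntersection q₁ q₂).obj.hom) :
    IsSmoothPencil (gramMatrix q₁) (gramMatrix q₂) where
  symm₁ := gramMatrix_isSymm q₁
  symm₂ := gramMatrix_isSymm q₂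
  mulVec_ne_zero v hv h₁ h₂ a b hab := by
    rw [← eval_eq_dotProduct_gramMatrix] at h₁ h₂
    exact mulVec_ne_zero_of_smooth hd q₁ q₂ hsmooth hv h₁ h₂ hab

omit [CharZero k] in
lemma cls_hyperellipticCurve_eq_mu {n : ℕ}
    (q₁ q₂ : MvPolynomial.homogeneousSubmodule (Fin (2 * n + 1 + 1)) k 2) :
    cls (hyperellipticCurve q₁ q₂) = mu k {x : (Fin 2 → k) × k |
      lead x.1 = 1 ∧ x.2 ^ 2 = (pencil (gramMatrix q₁) (gramMatrix q₂) x.1).det} := by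
  have hdet : DefFun fun p : Fin 2 → k => (pencil (gramMatrix q₁) (gramMatrix q₂) p).det :=
    .det fun i j => defFun_pencil _ _ .id i j
  have hv (i : Fin 3) : DefFun fun v : Fin 3 → k => v i := DefMap.id.apply i
  rw [cls_hyperellipticCurve]
  refine mu_eq_of_bij (.and (.eq ((hv 2).pow 2) (hdet.comp (.vec2 (hv 0) (hv 1))))
    (isCon_lead (.vec2 (hv 0) (hv 1))))
    ((isCon_lead .fst).and (.eq ((DefMap.snd (k := k)).defFun.pow 2) (hdet.comp .fst)))
    (φ := fun v => (![v 0, v 1], v 2)) (ψ := fun x => ![x.1 0, x.1 1, x.2])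
    (.prodMk (.vec2 (hv 0) (hv 1)) (.of_defFun (hv 2))) (.pi fun i => ?_) ?_ ?_
  · fin_cases i
    exacts [DefMap.fst.apply 0, DefMap.fst.apply 1, (DefMap.snd (k := k)).defFun]
  · rintro v ⟨h, hl⟩
    refine ⟨⟨hl, h⟩, ?_⟩
    ext i
    fin_cases i <;> rfl
  · rintro ⟨p, y⟩ ⟨hl, h⟩
    have hp : ![p 0, p 1] = p := by
      ext i
      fin_cases i <;> rfl
    refine ⟨⟨h, ?_⟩, Prod.ext hp rfl⟩
    change lead ![p 0, p 1] = 1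
    rw [hp]
    exact hl

end BaseLocus

end QuadricPencil

end

/-! ### Comparison of the two computations -/

open QuadricPencil

theorem mainTheorem6 (k : Type*) [Field k] [IsAlgClosed k] [CharZero k] (g : ℕ) (hg : 2 ≤ g)
    (q₁ q₂ : MvPolynomial.homogeneousSubmodule (Fin (2 * g + 1 + 1)) k 2)
    (hsmooth : AlgebraicGeometry.SmoothOfRelativeDimension (2 * g - 1)
      (quadricIntersection q₁ q₂).obj.hom) :
    lefschetz k * cls (quadricIntersection q₁ q₂) =
      lefschetz k * (cls (projectiveSpace k (2 * g - 1)) -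
        lefschetz k ^ (g - 1) * cls (projectiveSpace k 1) +
        lefschetz k ^ (g - 1) * cls (hyperellipticCurve q₁ q₂)) := by
  obtain ⟨n, rfl⟩ : ∃ n, g = n + 1 := ⟨g - 1, by omega⟩
  have key := projClass_add_lefschetz_mul_mu_baseLocus (n := n) (by omega)
    (isSmoothPencil_gramMatrix (by omega) q₁ q₂ hsmooth)
  simp only [← eval_eq_dotProduct_gramMatrix] at key
  rw [← cls_quadricIntersection, ← cls_hyperellipticCurve_eq_mu] at key
  have h₁ : projClass k (2 * (n + 1) + 1 + 1) =
      1 + lefschetz k * (projClass k (n + 1) + lefschetz k ^ (n + 1) * projClass k (n + 2)) := by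
    rw [show 2 * (n + 1) + 1 + 1 = 1 + ((n + 1) + (n + 2)) by omega, projClass_add,
      projClass_add (n + 1), projClass_one, pow_one]
  have h₂ : projClass k (2 * (n + 1) - 1 + 1) =
      projClass k (n + 1) + lefschetz k ^ (n + 1) * projClass k (n + 1) := by
    rw [← projClass_add]
    congr 1
    omega
  have h₃ : projClass k (n + 2) = 1 + lefschetz k * projClass k (n + 1) := by
    rw [add_comm, show 2 + n = 1 + (n + 1) by omega, projClass_add, projClass_one, pow_one]
  have h₄ : projClass k (n + 1 + 2) = 1 + lefschetz k * (1 + lefschetz k * projClass k (n + 1)) := by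
    rw [← h₃, show n + 1 + 2 = 1 + (n + 2) by omega, projClass_add, projClass_one, pow_one]
  -- A second evaluation of the sum in `h₃`. Together they give `(𝕃 - 1)(1 + ⋯ + 𝕃ⁿ) = 𝕃^(n+1) - 1`,
  -- which accounts for the term `-𝕃^(g-1) [ℙ¹]`.
  have h₅ : projClass k (n + 2) = projClass k (n + 1) + lefschetz k ^ (n + 1) := by
    rw [show n + 2 = (n + 1) + 1 by rfl, projClass_add _ 1, projClass_one, mul_one]
  rw [cls_projectiveSpace, cls_projectiveSpace, h₂, Nat.add_sub_cancel]
  rw [h₁, h₃, h₄] at key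
  simp only [one_add_one_eq_two, projClass_two] at key ⊢
  linear_combination key - h₅ + h₃
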